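/- **Parameters.** Let $n,d$ be natural numbers and $\epsilon,\gamma,\delta$ reals with $0<\epsilon<1$, $0<\gamma<1$, $0<\delta<1/2$. Put $L=\lceil\log_{1+\epsilon}(n/(1+3\epsilon))\rceil$, $L_d=\lceil\log_2(d/L^4)\rceil$ and define $\lambda_d$ by $2^{L_d}=d/(\lambda_dL^4)$. Assume $L^4\le d\le n$, $L_d\ge\gamma$ and $L^2\ge 8e^{\gamma}L_d/(\epsilon\gamma\lambda_d)$. **Skeletons.** Let $G=(V,E)$ be a graph with $|V|=n$ and maximum degree at most $d$, and for $F\subseteq E$ let $\deg(v,F)$ be the number of edges of $F$ incident upon $v$. A tuple $(B,T,S,X)$ with $B,T,S\subseteq V$ and $X\subseteq E$ is a *skeleton* of $G$ if 1. $B\cup T=V$ and $B\cap T=\emptyset$; 2. $\deg(v,E)>\epsilon d/L^2$ for all $v\in B$; 3. $\deg(v,E)<3\epsilon d/L^2$ for all $v\in T$; 4. $|S|\le 4\delta|B|$; 5. $e^{-\gamma}(\lambda_dL^4/d)\deg(v,E)\le\deg(v,X)\le e^{\gamma}(\lambda_dL^4/d)\deg(v,E)$ for all $v\in B\setminus S$;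 6. $\deg(v,X)\le\lambda_dL^4+2$ for all $v\in V$; 7. $\deg(v,X)\le 3\epsilon\lambda_dL^2+2$ for all $v\in T\setminus S$. **Theorem.** The edge set of a skeleton can be maintained deterministically under edge insertions and deletions, starting from the empty graph, with amortized update time $O(L^2L_d^3/(\epsilon\gamma\delta))$. Precisely: there are a program for a deterministic word RAM and absolute constants $k$ and $C$ such that the following holds for all parameters $n,d,\epsilon,\gamma,\delta$ as above. The words of the machine are the natural numbers below $n^k$, its operations are $+$, truncated $-$, $\times$, comparison and indirect memory access, each at unit cost, and the real parameters can be used only in comparisons $a\le\theta b$ and $a<\theta b$ of words $a,b$ with $\theta\in\{\epsilon,\gamma,\delta\}$. The memory is initially zero, except that it holds $n,d,L,L_d$. Consider any finite sequence of insertions of absent edges and deletions of present edges that starts from the empty graph on $V=\{0,\dots,n-1\}$ and keeps all degrees at most $d$ at all times. If the program is run once for each update of the sequence, in order, then every run halts without overflow; afterwards the memory holds an explicit list without repetitions of the edges in $X$, for some skeleton $(B,T,S,X)$ of the current graph; and the total number of steps is at most $C\cdot\frac{L^2L_d^3}{\epsilon\gamma\delta}$ times the number of updates in the sequence. -/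

import Mathlib

namespace DynSkeleton

/-! ### Parameters -/

/-- The parameters: the number `n` of nodes, the degree bound `d`, and the reals `ε`, `γ`, `δ`. -/
structure Params where
  n : ℕ
  d : ℕ
  ε : ℝ
  γ : ℝ
  δ : ℝ

namespace Params

/-- `L = ⌈log_β (n / α)⌉`, where `α = 1 + 3 ε` and `β = 1 + ε`. -/
noncomputable def L (p : Params) : ℕ :=
  ⌈Real.logb (1 + p.ε) ((p.n : ℝ) / (1 + 3 * p.ε))⌉₊

/-- `L_d = ⌈log₂ (d / L ^ 4)⌉`. -/
noncomputable def Ld (p : Params) : ℕ :=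
  ⌈Real.logb 2 ((p.d : ℝ) / (p.L : ℝ) ^ 4)⌉₊

/-- `λ_d`, which is determined by `2 ^ L_d = d / (λ_d L ^ 4)`. -/
noncomputable def lam (p : Params) : ℝ :=
  (p.d : ℝ) / (2 ^ p.Ld * (p.L : ℝ) ^ 4)

/-- The standing assumptions on the parameters. -/
structure Admissible (p : Params) : Prop where
  ε_pos : 0 < p.ε
  ε_lt : p.ε < 1
  γ_pos : 0 < p.γ
  γ_lt : p.γ < 1
  δ_pos : 0 < p.δ
  δ_lt : p.δ < 1 / 2
  d_ge : p.L ^ 4 ≤ p.d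
  d_le : p.d ≤ p.n
  Ld_ge : p.γ ≤ (p.Ld : ℝ)
  L_sq_ge : 8 * Real.exp p.γ * p.Ld / (p.ε * p.γ * p.lam) ≤ (p.L : ℝ) ^ 2

end Params

/-! ### Skeletons -/

section Graphs

variable {V : Type*}

/-- `deg(v, F)`: the number of edges of `F` that are incident upon `v`. -/
noncomputable def deg (v : V) (F : Set (Sym2 V)) : ℕ := {e ∈ F | v ∈ e}.ncard

/-- `(B, T, S, X)` is a skeleton of `G`, with respect to the parameters `p`. -/
structure IsSkeleton [Finite V] (p : Params) (G : SimpleGraph V)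
    (B T S : Set V) (X : Set (Sym2 V)) : Prop where
  subset : X ⊆ G.edgeSet
  union : B ∪ T = Set.univ
  inter : B ∩ T = ∅
  big : ∀ v ∈ B, p.ε * p.d / (p.L : ℝ) ^ 2 < deg v G.edgeSet
  tiny : ∀ v ∈ T, (deg v G.edgeSet : ℝ) < 3 * p.ε * p.d / (p.L : ℝ) ^ 2
  spurious : (S.ncard : ℝ) ≤ 4 * p.δ * B.ncard
  scaled_lower : ∀ v ∈ B \ S,
    Real.exp (-p.γ) * (p.lam * (p.L : ℝ) ^ 4 / p.d) * deg v G.edgeSet ≤ deg v X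
  scaled_upper : ∀ v ∈ B \ S,
    (deg v X : ℝ) ≤ Real.exp p.γ * (p.lam * (p.L : ℝ) ^ 4 / p.d) * deg v G.edgeSet
  deg_le : ∀ v, (deg v X : ℝ) ≤ p.lam * (p.L : ℝ) ^ 4 + 2
  tiny_deg_le : ∀ v ∈ T \ S, (deg v X : ℝ) ≤ 3 * p.ε * p.lam * (p.L : ℝ) ^ 2 + 2

/-! ### Dynamic graphs -/

/-- The insertion (`isInsert = true`) or the deletion (`isInsert = false`) of the edge `uv`. -/
structure EdgeUpdate (V : Type*) where
  isInsert : Bool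
  u : V
  v : V

/-- The graph after an edge update. -/
def EdgeUpdate.apply (σ : EdgeUpdate V) (G : SimpleGraph V) : SimpleGraph V :=
  if σ.isInsert then G ⊔ SimpleGraph.edge σ.u σ.v else G \ SimpleGraph.edge σ.u σ.v

/-- Only absent edges are inserted and only present edges are deleted. -/
def EdgeUpdate.Valid (σ : EdgeUpdate V) (G : SimpleGraph V) : Prop :=
  if σ.isInsert then σ.u ≠ σ.v ∧ ¬ G.Adj σ.u σ.v else G.Adj σ.u σ.v

/-- The valid sequence `us` of edge updates turns the empty graph into `G`,
and all node degrees are at most `d` at all times. -/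
inductive Evolves (d : ℕ) : List (EdgeUpdate V) → SimpleGraph V → Prop
  | nil : Evolves d [] ⊥
  | snoc {us : List (EdgeUpdate V)} {G : SimpleGraph V} {σ : EdgeUpdate V} :
      Evolves d us G → σ.Valid G → (∀ v, deg v (σ.apply G).edgeSet ≤ d) →
      Evolves d (us ++ [σ]) (σ.apply G)

end Graphs

/-! ### The machine: a deterministic word RAM

Programs are finite and are written in a structured language with finitely many integer variables
and arrays (both named by numerals that are fixed in the program text). All values are words, that
is, natural numbers below `W`; a computation that produces a larger number gets stuck. Real
parameters `θ 0`, `θ 1`, `θ 2` can only be compared with quotients of two words. -/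

/-- Arithmetic expressions; `read a i` is the cell of array `a` at index `i`,
and `sub` is truncated subtraction. -/
inductive Expr where
  | const (c : ℕ)
  | var (x : ℕ)
  | read (a : ℕ) (i : Expr)
  | add (e f : Expr)
  | sub (e f : Expr)
  | mul (e f : Expr)

/-- Tests; `leParam i e f` is `e ≤ θ i * f`, and `ltParam i e f` is `e < θ i * f`. -/
inductive Test where
  | le (e f : Expr)
  | eq (e f : Expr)
  | leParam (i : Fin 3) (e f : Expr)
  | ltParam (i : Fin 3) (e f : Expr)

/-- Commands; `store a i e` writes `e` into the cell of array `a` at index `i`. -/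
inductive Cmd where
  | skip
  | assign (x : ℕ) (e : Expr)
  | store (a : ℕ) (i e : Expr)
  | seq (c₁ c₂ : Cmd)
  | ite (b : Test) (c₁ c₂ : Cmd)
  | loop (b : Test) (c : Cmd)

/-- The contents of the variables and of the arrays. -/
structure Memory where
  vars : ℕ → ℕ
  arrs : ℕ → ℕ → ℕ

namespace Memory

def setVar (s : Memory) (x v : ℕ) : Memory :=
  { s with vars := Function.update s.vars x v }

def setArr (s : Memory) (a i v : ℕ) : Memory :=
  { s with arrs := Function.update s.arrs a (Function.update (s.arrs a) i v) }

end Memory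

/-- The result `x` of an operation, provided that it fits into a word. -/
def word (W x : ℕ) : Option ℕ := if x < W then some x else none

namespace Expr

/-- The value of an expression; `none` in case of an overflow. -/
def eval (W : ℕ) (s : Memory) : Expr → Option ℕ
  | const c => word W c
  | var x => some (s.vars x)
  | read a i => (i.eval W s).bind fun x => some (s.arrs a x)
  | add e f => (e.eval W s).bind fun x => (f.eval W s).bind fun y => word W (x + y)
  | sub e f => (e.eval W s).bind fun x => (f.eval W s).bind fun y => word W (x - y)
  | mul e f => (e.eval W s).bind fun x => (f.eval W s).bind fun y => word W (x * y)

/-- The number of elementary operations in the evaluation of an expression. -/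
def cost : Expr → ℕ
  | const _ => 1
  | var _ => 1
  | read _ i => i.cost + 1
  | add e f => e.cost + f.cost + 1
  | sub e f => e.cost + f.cost + 1
  | mul e f => e.cost + f.cost + 1

end Expr

namespace Test

open Classical in
/-- The outcome of a test; `none` in case of an overflow. -/
noncomputable def eval (W : ℕ) (θ : Fin 3 → ℝ) (s : Memory) : Test → Option Bool
  | le e f => (e.eval W s).bind fun x => (f.eval W s).bind fun y => some (decide (x ≤ y))
  | eq e f => (e.eval W s).bind fun x => (f.eval W s).bind fun y => some (decide (x = y))
  | leParam i e f => (e.eval W s).bind fun x => (f.eval W s).bind fun y =>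
      some (decide ((x : ℝ) ≤ θ i * y))
  | ltParam i e f => (e.eval W s).bind fun x => (f.eval W s).bind fun y =>
      some (decide ((x : ℝ) < θ i * y))

/-- The number of elementary operations in a test. -/
def cost : Test → ℕ
  | le e f => e.cost + f.cost + 1
  | eq e f => e.cost + f.cost + 1
  | leParam _ e f => e.cost + f.cost + 1
  | ltParam _ e f => e.cost + f.cost + 1

end Test

/-- `Exec W θ c s s' t`: with word bound `W` and real parameters `θ`, the command `c`, started with
memory `s`, halts with memory `s'` after `t` elementary steps. -/
inductive Exec (W : ℕ) (θ : Fin 3 → ℝ) : Cmd → Memory → Memory → ℕ → Prop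
  | skip {s : Memory} : Exec W θ .skip s s 1
  | assign {s : Memory} {x v : ℕ} {e : Expr} :
      e.eval W s = some v →
      Exec W θ (.assign x e) s (s.setVar x v) (e.cost + 1)
  | store {s : Memory} {a j v : ℕ} {i e : Expr} :
      i.eval W s = some j → e.eval W s = some v →
      Exec W θ (.store a i e) s (s.setArr a j v) (i.cost + e.cost + 1)
  | seq {s s₁ s₂ : Memory} {c₁ c₂ : Cmd} {t₁ t₂ : ℕ} :
      Exec W θ c₁ s s₁ t₁ → Exec W θ c₂ s₁ s₂ t₂ →
      Exec W θ (.seq c₁ c₂) s s₂ (t₁ + t₂)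
  | ite_true {s s' : Memory} {b : Test} {c₁ c₂ : Cmd} {t : ℕ} :
      b.eval W θ s = some true → Exec W θ c₁ s s' t →
      Exec W θ (.ite b c₁ c₂) s s' (b.cost + 1 + t)
  | ite_false {s s' : Memory} {b : Test} {c₁ c₂ : Cmd} {t : ℕ} :
      b.eval W θ s = some false → Exec W θ c₂ s s' t →
      Exec W θ (.ite b c₁ c₂) s s' (b.cost + 1 + t)
  | loop_false {s : Memory} {b : Test} {c : Cmd} :
      b.eval W θ s = some false →
      Exec W θ (.loop b c) s s (b.cost + 1)
  | loop_true {s s₁ s₂ : Memory} {b : Test} {c : Cmd} {t₁ t₂ : ℕ} :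
      b.eval W θ s = some true → Exec W θ c s s₁ t₁ → Exec W θ (.loop b c) s₁ s₂ t₂ →
      Exec W θ (.loop b c) s s₂ (b.cost + 1 + t₁ + t₂)

/-- The machine is deterministic. -/
theorem Exec.unique {W : ℕ} {θ : Fin 3 → ℝ} {c : Cmd} {s s₁ s₂ : Memory} {t₁ t₂ : ℕ}
    (h₁ : Exec W θ c s s₁ t₁) (h₂ : Exec W θ c s s₂ t₂) : s₁ = s₂ ∧ t₁ = t₂ := by
  induction h₁ generalizing s₂ t₂ with
  | skip => cases h₂; exact ⟨rfl, rfl⟩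
  | assign h => cases h₂ with | assign h' => simp_all
  | store h k => cases h₂ with | store h' k' => simp_all
  | seq _ _ ih₁ ih₂ =>
    cases h₂ with
    | seq k₁ k₂ =>
      obtain ⟨rfl, rfl⟩ := ih₁ k₁
      obtain ⟨rfl, rfl⟩ := ih₂ k₂
      exact ⟨rfl, rfl⟩
  | ite_true hb _ ih =>
    cases h₂ with
    | ite_true _ k => obtain ⟨rfl, rfl⟩ := ih k; exact ⟨rfl, rfl⟩
    | ite_false hb' _ => simp_all
  | ite_false hb _ ih =>
    cases h₂ with
    | ite_true hb' _ => simp_all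
    | ite_false _ k => obtain ⟨rfl, rfl⟩ := ih k; exact ⟨rfl, rfl⟩
  | loop_false hb =>
    cases h₂ with
    | loop_false _ => exact ⟨rfl, rfl⟩
    | loop_true hb' _ _ => simp_all
  | loop_true hb _ _ ih₁ ih₂ =>
    cases h₂ with
    | loop_false hb' => simp_all
    | loop_true _ k₁ k₂ =>
      obtain ⟨rfl, rfl⟩ := ih₁ k₁
      obtain ⟨rfl, rfl⟩ := ih₂ k₂
      exact ⟨rfl, rfl⟩

/-! ### Dynamic algorithms -/

/-- The initial memory: all cells are zero, except that the variables `3`, `4`, `5`, `6` hold the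
numbers `n`, `d`, `L`, `L_d`. -/
noncomputable def initial (p : Params) : Memory where
  vars x := if x = 3 then p.n else if x = 4 then p.d else if x = 5 then p.L
    else if x = 6 then p.Ld else 0
  arrs _ _ := 0

/-- The real parameters that the machine can use in comparisons. -/
noncomputable def Params.reals (p : Params) : Fin 3 → ℝ := ![p.ε, p.γ, p.δ]

/-- An edge update is handed to the machine in the variables `0`, `1`, `2`: the kind of the update
(`1` for an insertion and `0` for a deletion) and the two endpoints. -/
def Memory.receive {n : ℕ} (s : Memory) (σ : EdgeUpdate (Fin n)) : Memory :=
  ((s.setVar 0 (if σ.isInsert then 1 else 0)).setVar 1 σ.u).setVar 2 σ.v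

/-- `Serves prog W p us s t`: the program `prog` is run once for each edge update in `us`, one after
the other and on the same memory, beginning with the initial memory; this leads to the memory `s`
and takes `t` steps altogether. -/
inductive Serves (prog : Cmd) (W : ℕ) (p : Params) :
    List (EdgeUpdate (Fin p.n)) → Memory → ℕ → Prop
  | nil : Serves prog W p [] (initial p) 0
  | snoc {us : List (EdgeUpdate (Fin p.n))} {σ : EdgeUpdate (Fin p.n)} {s s' : Memory} {t t' : ℕ} :
      Serves prog W p us s t → Exec W p.reals prog (s.receive σ) s' t' →
      Serves prog W p (us ++ [σ]) s' (t + t')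

/-- The memory and the number of steps are determined by the program and the updates. -/
theorem Serves.unique {prog : Cmd} {W : ℕ} {p : Params} {us : List (EdgeUpdate (Fin p.n))}
    {s₁ s₂ : Memory} {t₁ t₂ : ℕ} (h₁ : Serves prog W p us s₁ t₁)
    (h₂ : Serves prog W p us s₂ t₂) : s₁ = s₂ ∧ t₁ = t₂ := by
  induction h₁ generalizing s₂ t₂ with
  | nil =>
    generalize hl : ([] : List (EdgeUpdate (Fin p.n))) = l at h₂
    cases h₂ with
    | nil => exact ⟨rfl, rfl⟩
    | snoc _ _ => simp at hl
  | @snoc us σ _ _ _ _ _ e ih =>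
    generalize hl : us ++ [σ] = l at h₂
    cases h₂ with
    | nil => simp at hl
    | snoc k e' =>
      obtain ⟨rfl, hσ⟩ := List.append_inj' hl rfl
      obtain rfl : σ = _ := by simpa using hσ
      obtain ⟨rfl, rfl⟩ := ih k
      obtain ⟨rfl, rfl⟩ := e.unique e'
      exact ⟨rfl, rfl⟩

/-- The memory holds the edge set `X` as an explicit list without repetitions: the variable `7` is
the number of edges, and the endpoints of the `i`-th edge are stored at index `i` of the arrays `0`
and `1`. -/
def Memory.Holds {n : ℕ} (s : Memory) (X : Set (Sym2 (Fin n))) : Prop :=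
  ∃ u v : Fin (s.vars 7) → Fin n,
    (∀ i : Fin (s.vars 7), s.arrs 0 i = u i ∧ s.arrs 1 i = v i) ∧
    Function.Injective (fun i => s(u i, v i)) ∧
    Set.range (fun i => s(u i, v i)) = X

end DynSkeleton

/-! Write a = ε d / L², K = 2 ^ L_d and g = ⌈1/γ⌉. The edges at the big nodes are split into K
classes, and `X` is one class without the edges deleted since the split. Everything else is lazy. A
node counts the updates at it and is called dirty once the count reaches ε d / (12 L² g), at most γ
a / 12; only then is its membership in the set `B` of clean big nodes revised, with 2a as the
dividing line between the thresholds a and 3a of a skeleton.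

Splitting. Edges get a tail and a head. A round of halving pairs, at every node, the outgoing edges
of equal class and, separately, the incoming ones. An edge has at most one partner on each side, so
the partners form paths and cycles, and cycles alternate between the two sides and are therefore
even. Hence a proper 2-colouring exists and can be found by walking along (`Walking.step`,
`Run.colour`). It halves every class at every node up to rounding, and the invariant `Balanced`,
that |2^i · count - total| ≤ 2^i - 1, passes from round to round (`KeyPairing.card_le`,
`Balanced.halve`). After L_d rounds every class has 1/K of the edges at every node, with an error of
at most 2 (`Phase.balance`).

Correctness. A node is lossy for a class if it has lost at least ε d / (12 K L² g) edges of it. The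
set `S` consists of the dirty nodes and of the lossy nodes of the current class. A class with more
than 2δ|B| lossy nodes is given up for the next one; a new phase begins if no class is left or if
more than 2δ|B| nodes are dirty. Hence |S| ≤ 4δ|B|. At a node of B outside S, K deg(v,X) and
deg(v,E) differ only by rounding, by the counted updates and by K times the lost edges. Each is a
small multiple of γ a (the assumption on L² yields 8K ≤ γ a), altogether at most 5γa/12, while
deg(v,E) > 23a/12. This gives the factors e^γ and e^(-γ) (`Inv.isSkeleton`).

Time. A new phase costs O(L_d (|B|+|D|) d), where D is the set of dirty nodes. If dirty nodes force
it, their counters pay (`dirty_pays`). If the classes run out, each of the K classes has more than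
2δ|B| lossy nodes; since a deleted edge is lost at only two nodes, the deleted edges pay
(`sum_lost_le`, `lossy_pays`). Either way O(L² L_d / (ε γ δ)) per update suffices. Stepping through
the classes and loading them is linear in the size of the phase and is paid in advance when the
phase begins. The potential function `potential` sums these payments (`RunT.rebuild`,
`RunT.restore`, `RunT.update`).

The program is verified by a Hoare logic for total correctness in which all stored values stay below
n^8 and every judgement carries a time bound. -/

namespace DynSkeleton

/-! ### A program logic with running times -/

/-- Word bound `W`, real parameters `θ` and a bound `Q` on all stored values. -/
structure Machine where
  W : ℕ
  Q : ℕ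
  θ : Fin 3 → ℝ
  le_Q : 16 ≤ Q
  lt_W : Q ^ 10 < W

/-- All stored values are at most `Q`. -/
structure Memory.Bounded (Q : ℕ) (s : Memory) : Prop where
  vars : ∀ x, s.vars x ≤ Q
  arrs : ∀ a i, s.arrs a i ≤ Q

/-! ### Evaluation without overflow -/

namespace Expr

instance : Add Expr := ⟨Expr.add⟩
instance : Sub Expr := ⟨Expr.sub⟩
instance : Mul Expr := ⟨Expr.mul⟩

/-- The value of an expression when overflows are ignored. -/
def val (s : Memory) : Expr → ℕ
  | const c => c
  | var x => s.vars x
  | read a i => s.arrs a (i.val s)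
  | add e f => e.val s + f.val s
  | sub e f => e.val s - f.val s
  | mul e f => e.val s * f.val s

@[simp] theorem val_const (s : Memory) (c : ℕ) : (const c).val s = c := rfl
@[simp] theorem val_var (s : Memory) (x : ℕ) : (var x).val s = s.vars x := rfl
@[simp] theorem val_read (s : Memory) (a : ℕ) (i : Expr) :
    (read a i).val s = s.arrs a (i.val s) := rfl
@[simp] theorem val_add (s : Memory) (e f : Expr) : (e + f).val s = e.val s + f.val s := rfl
@[simp] theorem val_sub (s : Memory) (e f : Expr) : (e - f).val s = e.val s - f.val s := rfl
@[simp] theorem val_mul (s : Memory) (e f : Expr) : (e * f).val s = e.val s * f.val s := rfl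

/-- The values of the subexpressions of `e` are at most `Q ^ e.size`. -/
def size : Expr → ℕ
  | const _ => 1
  | var _ => 1
  | read _ i => i.size
  | add e f => e.size + f.size
  | sub e f => e.size + f.size
  | mul e f => e.size + f.size

/-- All constants are at most `16`. -/
def smallConsts : Expr → Bool
  | const c => decide (c ≤ 16)
  | var _ => true
  | read _ i => i.smallConsts
  | add e f => e.smallConsts && f.smallConsts
  | sub e f => e.smallConsts && f.smallConsts
  | mul e f => e.smallConsts && f.smallConsts

/-- The evaluation of `e` cannot overflow on bounded memories. -/
def ok (e : Expr) : Bool := e.smallConsts && decide (e.size ≤ 10)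

theorem one_le_size (e : Expr) : 1 ≤ e.size := by
  induction e <;> simp_all [size] <;> omega

/-- Both factors `Q ^ a` and `Q ^ b` are at least 2, so a sum is bounded by a product and exponents
simply add up. Expressions of size at most 10 thus stay below `Q ^ 10 < W`. -/
theorem val_le {Q : ℕ} {s : Memory} (hQ : 16 ≤ Q) (hs : s.Bounded Q) {e : Expr}
    (he : e.smallConsts) : e.val s ≤ Q ^ e.size := by
  have key : ∀ {a b x y : ℕ}, 1 ≤ a → 1 ≤ b → x ≤ Q ^ a → y ≤ Q ^ b →
      x + y ≤ Q ^ (a + b) ∧ x * y ≤ Q ^ (a + b) := by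
    intro a b x y ha hb hx hy
    have h1 : 2 ≤ Q ^ a := le_trans (by omega) (Nat.le_self_pow (by omega) Q)
    have h2 : 2 ≤ Q ^ b := le_trans (by omega) (Nat.le_self_pow (by omega) Q)
    rw [pow_add]
    exact ⟨by nlinarith, Nat.mul_le_mul hx hy⟩
  induction e with
  | const c => simp [smallConsts] at he; simpa [val, size] using by omega
  | var x => simpa [val, size] using hs.vars x
  | read a i _ =>
    exact le_trans (hs.arrs _ _) (Nat.le_self_pow (by have := one_le_size i; simp [size]; omega) Q)
  | add e f h1 h2 =>
    simp [smallConsts] at he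
    exact (key e.one_le_size f.one_le_size (h1 he.1) (h2 he.2)).1
  | sub e f h1 h2 =>
    simp [smallConsts] at he
    exact le_trans (le_trans (Nat.sub_le _ _) (Nat.le_add_right _ _))
      (key e.one_le_size f.one_le_size (h1 he.1) (h2 he.2)).1
  | mul e f h1 h2 =>
    simp [smallConsts] at he
    exact (key e.one_le_size f.one_le_size (h1 he.1) (h2 he.2)).2

theorem eval_eq_aux {W Q : ℕ} {s : Memory} (hQ : 16 ≤ Q) (hs : s.Bounded Q) {e : Expr}
    (he : e.smallConsts) (hW : Q ^ e.size < W) : e.eval W s = some (e.val s) := by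
  have mono : ∀ {a b : ℕ}, a ≤ b → Q ^ b < W → Q ^ a < W := fun h h' =>
    lt_of_le_of_lt (Nat.pow_le_pow_right (by omega) h) h'
  have hv := val_le hQ hs he
  induction e with
  | const c => simpa [eval, val, word] using lt_of_le_of_lt hv hW
  | var x => rfl
  | read a i ih =>
    simp only [eval]
    rw [ih he hW (val_le hQ hs he)]; rfl
  | add e f h1 h2 =>
    have he' := he
    simp [smallConsts] at he'
    simp only [eval]
    rw [h1 he'.1 (mono (by simp [size]) hW) (val_le hQ hs he'.1),
      h2 he'.2 (mono (by simp [size]) hW) (val_le hQ hs he'.2)]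
    simpa [word, val] using lt_of_le_of_lt hv hW
  | sub e f h1 h2 =>
    have he' := he
    simp [smallConsts] at he'
    simp only [eval]
    rw [h1 he'.1 (mono (by simp [size]) hW) (val_le hQ hs he'.1),
      h2 he'.2 (mono (by simp [size]) hW) (val_le hQ hs he'.2)]
    simpa [word, val] using lt_of_le_of_lt hv hW
  | mul e f h1 h2 =>
    have he' := he
    simp [smallConsts] at he'
    simp only [eval]
    rw [h1 he'.1 (mono (by simp [size]) hW) (val_le hQ hs he'.1),
      h2 he'.2 (mono (by simp [size]) hW) (val_le hQ hs he'.2)]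
    simpa [word, val] using lt_of_le_of_lt hv hW

theorem eval_eq (M : Machine) {s : Memory} (hs : s.Bounded M.Q) {e : Expr} (he : e.ok) :
    e.eval M.W s = some (e.val s) := by
  simp [ok] at he
  exact eval_eq_aux M.le_Q hs he.1
    (lt_of_le_of_lt (Nat.pow_le_pow_right (by have := M.le_Q; omega) he.2) M.lt_W)

/-- A sufficient condition for `e.val s ≤ Q` that is trivial for values that are already stored. -/
def Fits (Q : ℕ) (s : Memory) : Expr → Prop
  | const _ => True
  | var _ => True
  | read _ _ => True
  | sub e f => e.Fits Q s ∨ e.val s - f.val s ≤ Q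
  | add e f => e.val s + f.val s ≤ Q
  | mul e f => e.val s * f.val s ≤ Q

@[simp] theorem fits_const (Q : ℕ) (s : Memory) (c : ℕ) : (const c).Fits Q s ↔ True := Iff.rfl
@[simp] theorem fits_var (Q : ℕ) (s : Memory) (x : ℕ) : (var x).Fits Q s ↔ True := Iff.rfl
@[simp] theorem fits_read (Q : ℕ) (s : Memory) (a : ℕ) (i : Expr) :
    (read a i).Fits Q s ↔ True := Iff.rfl
@[simp] theorem fits_sub (Q : ℕ) (s : Memory) (e f : Expr) :
    (e - f).Fits Q s ↔ e.Fits Q s ∨ e.val s - f.val s ≤ Q := Iff.rfl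
@[simp] theorem fits_add (Q : ℕ) (s : Memory) (e f : Expr) :
    (e + f).Fits Q s ↔ e.val s + f.val s ≤ Q := Iff.rfl
@[simp] theorem fits_mul (Q : ℕ) (s : Memory) (e f : Expr) :
    (e * f).Fits Q s ↔ e.val s * f.val s ≤ Q := Iff.rfl

theorem Fits.le {Q : ℕ} {s : Memory} (hQ : 16 ≤ Q) (hs : s.Bounded Q) {e : Expr}
    (he : e.smallConsts) (h : e.Fits Q s) : e.val s ≤ Q := by
  induction e with
  | const c => simp [smallConsts] at he; simpa [val] using by omega
  | var x => exact hs.vars x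
  | read a i _ => exact hs.arrs _ _
  | add e f _ _ => exact h
  | sub e f h1 _ =>
    simp [smallConsts] at he
    rcases h with h | h
    · exact le_trans (Nat.sub_le _ _) (h1 he.1 h)
    · exact h
  | mul e f _ _ => exact h

end Expr

namespace Test

/-- The outcome of a test when overflows are ignored. -/
def Holds (θ : Fin 3 → ℝ) (s : Memory) : Test → Prop
  | le e f => e.val s ≤ f.val s
  | eq e f => e.val s = f.val s
  | leParam i e f => (e.val s : ℝ) ≤ θ i * f.val s
  | ltParam i e f => (e.val s : ℝ) < θ i * f.val s

@[simp] theorem holds_eq (θ : Fin 3 → ℝ) (s : Memory) (e f : Expr) :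
    (eq e f).Holds θ s ↔ e.val s = f.val s := Iff.rfl
@[simp] theorem holds_leParam (θ : Fin 3 → ℝ) (s : Memory) (i : Fin 3) (e f : Expr) :
    (leParam i e f).Holds θ s ↔ (e.val s : ℝ) ≤ θ i * f.val s := Iff.rfl
@[simp] theorem holds_ltParam (θ : Fin 3 → ℝ) (s : Memory) (i : Fin 3) (e f : Expr) :
    (ltParam i e f).Holds θ s ↔ (e.val s : ℝ) < θ i * f.val s := Iff.rfl

def ok : Test → Bool
  | le e f => e.ok && f.ok
  | eq e f => e.ok && f.ok
  | leParam _ e f => e.ok && f.ok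
  | ltParam _ e f => e.ok && f.ok

open Classical in
theorem eval_eq (M : Machine) {s : Memory} (hs : s.Bounded M.Q) {b : Test} (hb : b.ok) :
    b.eval M.W M.θ s = some (decide (b.Holds M.θ s)) := by
  cases b <;> simp [ok] at hb <;>
    simp [eval, Expr.eval_eq M hs hb.1, Expr.eval_eq M hs hb.2, Holds] <;> congr

end Test

namespace Cmd

/-- No expression of the command can overflow on bounded memories. -/
def ok : Cmd → Bool
  | skip => true
  | assign _ e => e.ok
  | store _ i e => i.ok && e.ok
  | seq c₁ c₂ => c₁.ok && c₂.ok
  | ite b c₁ c₂ => b.ok && c₁.ok && c₂.ok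
  | loop b c => b.ok && c.ok

/-- The number of steps of a loop-free command is at most this. -/
def cost : Cmd → ℕ
  | skip => 1
  | assign _ e => e.cost + 1
  | store _ i e => i.cost + e.cost + 1
  | seq c₁ c₂ => c₁.cost + c₂.cost
  | ite b c₁ c₂ => b.cost + 1 + max c₁.cost c₂.cost
  | loop _ _ => 0

/-- The variables that a command may change. -/
def wv : Cmd → List ℕ
  | skip => []
  | assign x _ => [x]
  | store _ _ _ => []
  | seq c₁ c₂ => c₁.wv ++ c₂.wv
  | ite _ c₁ c₂ => c₁.wv ++ c₂.wv
  | loop _ c => c.wv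

/-- The arrays that a command may change. -/
def wa : Cmd → List ℕ
  | skip => []
  | assign _ _ => []
  | store a _ _ => [a]
  | seq c₁ c₂ => c₁.wa ++ c₂.wa
  | ite _ c₁ c₂ => c₁.wa ++ c₂.wa
  | loop _ c => c.wa

/-- The weakest precondition of a loop-free command. -/
def wp (M : Machine) : Cmd → (Memory → Prop) → Memory → Prop
  | skip, P, s => P s
  | assign x e, P, s => e.Fits M.Q s ∧ P (s.setVar x (e.val s))
  | store a i e, P, s => e.Fits M.Q s ∧ P (s.setArr a (i.val s) (e.val s))
  | seq c₁ c₂, P, s => c₁.wp M (c₂.wp M P) s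
  | ite b c₁ c₂, P, s => (b.Holds M.θ s → c₁.wp M P s) ∧ (¬ b.Holds M.θ s → c₂.wp M P s)
  | loop _ _, _, _ => False

end Cmd

/-- The memories `s` and `s'` agree on all variables outside `vs` and all arrays outside `as`. -/
structure Same (vs as : List ℕ) (s s' : Memory) : Prop where
  vars : ∀ x, x ∉ vs → s'.vars x = s.vars x
  arrs : ∀ a, a ∉ as → s'.arrs a = s.arrs a

theorem Same.refl (vs as : List ℕ) (s : Memory) : Same vs as s s := ⟨fun _ _ => rfl, fun _ _ => rfl⟩

theorem Same.trans {vs as vs' as' : List ℕ} {s s' s'' : Memory} (h : Same vs as s s')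
    (h' : Same vs' as' s' s'') : Same (vs ++ vs') (as ++ as') s s'' := by
  refine ⟨fun x hx => ?_, fun a ha => ?_⟩
  · simp at hx; rw [h'.vars x hx.2, h.vars x hx.1]
  · simp at ha; rw [h'.arrs a ha.2, h.arrs a ha.1]

theorem Same.mono {vs as vs' as' : List ℕ} {s s' : Memory} (h : Same vs as s s')
    (h₁ : vs ⊆ vs') (h₂ : as ⊆ as') : Same vs' as' s s' :=
  ⟨fun x hx => h.vars x fun h' => hx (h₁ h'), fun a ha => h.arrs a fun h' => ha (h₂ h')⟩

/-- This turns the syntactic lists of written variables and arrays into a frame rule; in concrete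
proofs the claim that a cell is unchanged is then settled by `decide`. -/
theorem Exec.same {W : ℕ} {θ : Fin 3 → ℝ} {c : Cmd} {s s' : Memory} {t : ℕ}
    (h : Exec W θ c s s' t) : Same c.wv c.wa s s' := by
  induction h with
  | skip => exact Same.refl _ _ _
  | assign _ =>
    refine ⟨fun x hx => ?_, fun a _ => rfl⟩
    simp [Cmd.wv] at hx
    simp [Memory.setVar, Function.update_of_ne hx]
  | store _ _ =>
    refine ⟨fun x _ => rfl, fun a ha => ?_⟩
    simp [Cmd.wa] at ha
    simp [Memory.setArr, Function.update_of_ne ha]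
  | seq _ _ h₁ h₂ => exact h₁.trans h₂
  | ite_true _ _ ih => exact ih.mono (by simp [Cmd.wv]) (by simp [Cmd.wa])
  | ite_false _ _ ih => exact ih.mono (by simp [Cmd.wv]) (by simp [Cmd.wa])
  | loop_false _ => exact Same.refl _ _ _
  | loop_true _ _ _ h₁ h₂ =>
    exact (h₁.trans h₂).mono (by simp [Cmd.wv]) (by simp [Cmd.wa])

variable {M : Machine}

/-- Started with the bounded memory `s`, the command `c` halts with a bounded memory `s'` after `t`
steps, where `P s' t`. -/
def RunT (M : Machine) (c : Cmd) (s : Memory) (P : Memory → ℕ → Prop) : Prop :=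
  s.Bounded M.Q → ∃ s' t, Exec M.W M.θ c s s' t ∧ s'.Bounded M.Q ∧ P s' t

/-- Started with the bounded memory `s`, the command `c` halts after at most `T` steps with a
bounded memory that satisfies `P`. -/
def Run (M : Machine) (c : Cmd) (s : Memory) (T : ℕ) (P : Memory → Prop) : Prop :=
  RunT M c s fun s' t => t ≤ T ∧ P s'

theorem RunT.bounded {c : Cmd} {s : Memory} {P : Memory → ℕ → Prop}
    (h : s.Bounded M.Q → RunT M c s P) : RunT M c s P := fun hs => h hs hs

theorem RunT.mono {c : Cmd} {s : Memory} {P P' : Memory → ℕ → Prop} (h : RunT M c s P)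
    (hP : ∀ s' t, Same c.wv c.wa s s' → s'.Bounded M.Q → P s' t → P' s' t) : RunT M c s P' := by
  intro hs
  obtain ⟨s', t, h1, h2, h3⟩ := h hs
  exact ⟨s', t, h1, h2, hP s' t h1.same h2 h3⟩

theorem Run.mono {c : Cmd} {s : Memory} {T T' : ℕ} {P P' : Memory → Prop} (h : Run M c s T P)
    (hT : T ≤ T') (hP : ∀ s', Same c.wv c.wa s s' → s'.Bounded M.Q → P s' → P' s') :
    Run M c s T' P' :=
  RunT.mono h fun s' _ hS hB h => ⟨h.1.trans hT, hP s' hS hB h.2⟩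

theorem RunT.seq {c₁ c₂ : Cmd} {s : Memory} {P : Memory → ℕ → Prop}
    (h : RunT M c₁ s fun s₁ t₁ => RunT M c₂ s₁ fun s₂ t₂ => P s₂ (t₁ + t₂)) :
    RunT M (c₁.seq c₂) s P := by
  intro hs
  obtain ⟨s₁, t₁, e₁, b₁, h₁⟩ := h hs
  obtain ⟨s₂, t₂, e₂, b₂, h₂⟩ := h₁ b₁
  exact ⟨s₂, t₁ + t₂, .seq e₁ e₂, b₂, h₂⟩

theorem Run.seq {c₁ c₂ : Cmd} {s : Memory} {T₁ T₂ : ℕ} {P₁ P₂ : Memory → Prop}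
    (h₁ : Run M c₁ s T₁ P₁)
    (h₂ : ∀ s', Same c₁.wv c₁.wa s s' → s'.Bounded M.Q → P₁ s' → Run M c₂ s' T₂ P₂) :
    Run M (c₁.seq c₂) s (T₁ + T₂) P₂ :=
  RunT.seq <| RunT.mono h₁ fun s' _ hS hB h =>
    RunT.mono (h₂ s' hS hB h.2) fun _ _ _ _ h' => ⟨Nat.add_le_add h.1 h'.1, h'.2⟩

theorem RunT.ite {b : Test} {c₁ c₂ : Cmd} {s : Memory} {P : Memory → ℕ → Prop} (hb : b.ok)
    (h₁ : b.Holds M.θ s → RunT M c₁ s fun s' t => P s' (b.cost + 1 + t))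
    (h₂ : ¬ b.Holds M.θ s → RunT M c₂ s fun s' t => P s' (b.cost + 1 + t)) :
    RunT M (.ite b c₁ c₂) s P := by
  intro hs
  have hev := Test.eval_eq M hs hb
  by_cases h : b.Holds M.θ s
  · obtain ⟨s', t, e, hB, hP⟩ := h₁ h hs
    exact ⟨s', _, .ite_true (by simpa [h] using hev) e, hB, hP⟩
  · obtain ⟨s', t, e, hB, hP⟩ := h₂ h hs
    exact ⟨s', _, .ite_false (by simpa [h] using hev) e, hB, hP⟩

theorem Run.ite {b : Test} {c₁ c₂ : Cmd} {s : Memory} {T : ℕ} {P : Memory → Prop} (hb : b.ok)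
    (h₁ : b.Holds M.θ s → Run M c₁ s T P) (h₂ : ¬ b.Holds M.θ s → Run M c₂ s T P) :
    Run M (.ite b c₁ c₂) s (b.cost + 1 + T) P :=
  RunT.ite hb
    (fun h => RunT.mono (h₁ h) fun _ _ _ _ h' => ⟨Nat.add_le_add_left h'.1 _, h'.2⟩)
    (fun h => RunT.mono (h₂ h) fun _ _ _ _ h' => ⟨Nat.add_le_add_left h'.1 _, h'.2⟩)

theorem Memory.Bounded.setVar {Q : ℕ} {s : Memory} (hs : s.Bounded Q) (x : ℕ) {v : ℕ}
    (hv : v ≤ Q) : (s.setVar x v).Bounded Q := by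
  refine ⟨fun y => ?_, hs.arrs⟩
  by_cases h : y = x
  · subst h; simpa [Memory.setVar] using hv
  · simpa [Memory.setVar, Function.update_of_ne h] using hs.vars y

theorem Memory.Bounded.setArr {Q : ℕ} {s : Memory} (hs : s.Bounded Q) (a i : ℕ) {v : ℕ}
    (hv : v ≤ Q) : (s.setArr a i v).Bounded Q := by
  refine ⟨hs.vars, fun b j => ?_⟩
  by_cases h : b = a
  · subst h
    by_cases h' : j = i
    · subst h'; simpa [Memory.setArr] using hv
    · simpa [Memory.setArr, Function.update_of_ne h'] using hs.arrs b j
  · simpa [Memory.setArr, Function.update_of_ne h] using hs.arrs b j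

/-- Branches are charged with the costlier alternative, so the time bound depends on the program
text only. -/
theorem Run.of_wp {c : Cmd} {s : Memory} {P : Memory → Prop} (hc : c.ok) (h : c.wp M P s) :
    Run M c s c.cost P := by
  induction c generalizing s P with
  | skip => exact fun hs => ⟨s, 1, .skip, hs, le_rfl, h⟩
  | assign x e =>
    intro hs
    have hc' := hc
    simp [Cmd.ok, Expr.ok] at hc'
    exact ⟨_, _, .assign (Expr.eval_eq M hs hc), hs.setVar x (Expr.Fits.le M.le_Q hs hc'.1 h.1),
      le_rfl, h.2⟩
  | store a i e =>
    intro hs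
    simp [Cmd.ok] at hc
    have hc' := hc.2
    simp [Expr.ok] at hc'
    exact ⟨_, _, .store (Expr.eval_eq M hs hc.1) (Expr.eval_eq M hs hc.2),
      hs.setArr a _ (Expr.Fits.le M.le_Q hs hc'.1 h.1), le_rfl, h.2⟩
  | seq c₁ c₂ ih₁ ih₂ =>
    simp [Cmd.ok] at hc
    exact Run.seq (ih₁ hc.1 h) fun s' _ _ h' => ih₂ hc.2 h'
  | ite b c₁ c₂ ih₁ ih₂ =>
    simp [Cmd.ok] at hc
    exact Run.ite hc.1.1
      (fun hb => (ih₁ hc.1.2 (h.1 hb)).mono (le_max_left _ _) fun _ _ _ h => h)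
      (fun hb => (ih₂ hc.2 (h.2 hb)).mono (le_max_right _ _) fun _ _ _ h => h)
  | loop b c _ => exact h.elim

/-- A loop with the invariant `I`; the time that is left is the first argument of `I`. -/
theorem RunT.loop {b : Test} {c : Cmd} (hb : b.ok) (I : ℕ → Memory → Prop)
    (step : ∀ k s, I k s → b.Holds M.θ s →
      RunT M c s fun s' t => ∃ k', I k' s' ∧ t + k' + (b.cost + 1) ≤ k) {k : ℕ} {s : Memory}
    (h : I k s) :
    RunT M (.loop b c) s fun s' t => ∃ k', I k' s' ∧ ¬ b.Holds M.θ s' ∧ t + k' ≤ k + (b.cost + 1) := by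
  induction k using Nat.strong_induction_on generalizing s with
  | _ k ih =>
    intro hs
    have hev := Test.eval_eq M hs hb
    by_cases hh : b.Holds M.θ s
    · obtain ⟨s₁, t₁, e₁, b₁, k₁, i₁, l₁⟩ := step k s h hh hs
      -- A round uses up at least `b.cost + 1` units, so the time left strictly decreases and also
      -- proves termination.
      obtain ⟨s₂, t₂, e₂, b₂, k₂, i₂, n₂, l₂⟩ := ih k₁ (by omega) i₁ b₁
      exact ⟨s₂, _, .loop_true (by simpa [hh] using hev) e₁ e₂, b₂, k₂, i₂, n₂, by omega⟩
    · exact ⟨s, _, .loop_false (by simpa [hh] using hev), hs, k, h, hh, by omega⟩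

namespace Cmd

/-- `for i = 0, …, lim - 1 do body`, where `i` and `lim` are variables. -/
def forUp (i lim : ℕ) (body : Cmd) : Cmd :=
  .seq (.assign i (.const 0))
    (.loop (.le (.add (.var i) (.const 1)) (.var lim))
      (.seq body (.assign i (.add (.var i) (.const 1)))))

end Cmd

/-- A for-loop whose invariant keeps account of the time: `I j k s` says that with `k` units of
time left the first `j` rounds have been completed. -/
theorem RunT.forUp {i lim : ℕ} {body : Cmd} (I : ℕ → ℕ → Memory → Prop) (N : ℕ) {s : Memory} {k : ℕ}
    (hi : i ∉ body.wv) (hl : lim ∉ body.wv) (hne : lim ≠ i) (hN : s.vars lim = N) (h0 : I 0 k s)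
    (hI : ∀ j k s v, I j k s → I j k (s.setVar i v))
    (hb : ∀ j k s', Same (i :: body.wv) body.wa s s' → s'.Bounded M.Q → j < N → s'.vars i = j →
      I j k s' → RunT M body s' fun s'' t => ∃ k', I (j + 1) k' s'' ∧ t + k' + 10 ≤ k) :
    RunT M (.forUp i lim body) s fun s' t => ∃ k', I N k' s' ∧ t + k' ≤ k + 10 := by
  apply RunT.bounded
  intro hs0
  -- The limit is itself a stored value, hence the loop counter cannot overflow.
  have hNQ : N ≤ M.Q := hN ▸ hs0.vars lim
  have h1 : Run M (.assign i (.const 0)) s 2 fun s' => s' = s.setVar i 0 :=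
    (Run.of_wp (by rfl) ⟨trivial, rfl⟩)
  apply RunT.seq
  refine RunT.mono h1 ?_
  rintro s' _ hS hB ⟨ht, rfl⟩
  have hS0 : Same (i :: body.wv) body.wa s (s.setVar i 0) :=
    hS.mono (by simp [Cmd.wv]) (by simp [Cmd.wa])
  refine RunT.mono (RunT.loop (b := .le (.add (.var i) (.const 1)) (.var lim)) (by rfl)
    (fun k s' => ∃ j, j ≤ N ∧ s'.vars i = j ∧ Same (i :: body.wv) body.wa s s' ∧ I j k s')
    ?_ ⟨0, Nat.zero_le _, by simp [Memory.setVar], hS0, hI _ _ _ _ h0⟩) ?_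
  · rintro k s' ⟨j, hj, hij, hSj, hIj⟩ hh
    have hlim : s'.vars lim = N := by rw [hSj.vars lim (by simp [hl, hne]), hN]
    have hjN : j < N := by
      have : s'.vars i + 1 ≤ s'.vars lim := hh
      omega
    apply RunT.bounded
    intro hB'
    apply RunT.seq
    refine RunT.mono (hb j k s' hSj hB' hjN hij hIj) ?_
    rintro s₁ t₁ hS₁ hB₁ ⟨k₁, hI₁, hk₁⟩
    have hi1 : s₁.vars i = j := by rw [hS₁.vars i hi, hij]
    have h2 : Run M (.assign i (.add (.var i) (.const 1))) s₁ 4 fun s' => s' = s₁.setVar i (j + 1) :=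
      Run.of_wp (by rfl) ⟨by simp [Expr.Fits, hi1]; omega, by simp [Expr.val, hi1]⟩
    refine RunT.mono h2 ?_
    rintro s₂ t₂ hS₂ _ ⟨ht₂, rfl⟩
    refine ⟨k₁, ⟨j + 1, hjN, by simp [Memory.setVar], ?_, hI _ _ _ _ hI₁⟩, ?_⟩
    · have := (hSj.trans hS₁).trans hS₂
      exact this.mono (by simp [Cmd.wv]) (by simp [Cmd.wa])
    · simp [Test.cost, Expr.cost]; omega
  · rintro s' t' _ _ ⟨k', ⟨j, hj, hij, hSj, hIj⟩, hh, hk⟩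
    have hlim : s'.vars lim = N := by rw [hSj.vars lim (by simp [hl, hne]), hN]
    have hjN : j = N := by
      have : ¬ s'.vars i + 1 ≤ s'.vars lim := hh
      omega
    subst hjN
    refine ⟨k', hIj, ?_⟩
    simp [Test.cost, Expr.cost] at hk; omega

/-- The case of a uniform bound `T` for each round; the 10 covers the test and the increment. -/
theorem Run.forUp {i lim : ℕ} {body : Cmd} (I : ℕ → Memory → Prop) (N T : ℕ) {s : Memory}
    (hi : i ∉ body.wv) (hl : lim ∉ body.wv) (hne : lim ≠ i) (hN : s.vars lim = N) (h0 : I 0 s)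
    (hI : ∀ j s v, I j s → I j (s.setVar i v))
    (hb : ∀ j s', Same (i :: body.wv) body.wa s s' → s'.Bounded M.Q → j < N → s'.vars i = j →
      I j s' → Run M body s' T (I (j + 1))) :
    Run M (.forUp i lim body) s ((T + 10) * N + 10) (I N) := by
  refine RunT.mono (RunT.forUp (fun j k s => j ≤ N ∧ I j s ∧ k = (T + 10) * (N - j)) N hi hl hne hN
    (k := (T + 10) * N) ⟨by omega, h0, by simp⟩ ?_ ?_) ?_
  · rintro j k s v ⟨hj, h, hk⟩; exact ⟨hj, hI j s v h, hk⟩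
  · rintro j k s' hS hB hj hij ⟨_, h, hk⟩
    refine RunT.mono (hb j s' hS hB hj hij h) ?_
    rintro s'' t _ _ ⟨ht, h'⟩
    refine ⟨_, ⟨by omega, h', rfl⟩, ?_⟩
    obtain ⟨r, rfl⟩ : ∃ r, N = j + 1 + r := ⟨N - (j + 1), by omega⟩
    rw [hk, show j + 1 + r - j = r + 1 by omega, show j + 1 + r - (j + 1) = r by omega]
    ring_nf; omega
  · rintro s' t _ _ ⟨k', ⟨_, h, _⟩, hk⟩
    exact ⟨by omega, h⟩

end DynSkeleton

namespace DynSkeleton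

/-! ### Sets of small numbers in arrays -/

/-- Two-dimensional tables are stored in rows of length `m`; cells do not collide as long as the
column indices are below `m`. -/
theorem index_inj {m b b' x x' : ℕ} (hx : x < m) (hx' : x' < m) :
    b * m + x = b' * m + x' ↔ b = b' ∧ x = x' := by
  refine ⟨fun h => ?_, fun h => by rw [h.1, h.2]⟩
  have h1 := congrArg (· / m) h
  have h2 := congrArg (· % m) h
  have hm : 0 < m := by omega
  simp only [mul_comm _ m, Nat.mul_add_div hm, Nat.div_eq_of_lt hx, Nat.div_eq_of_lt hx',
    add_zero] at h1
  subst h1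
  exact ⟨rfl, by omega⟩

/-- The arrays `A`, `P` and `l` represent a family of sets of numbers below `m`: the elements of
`F b` are listed in `A` from index `b * m` on, `l b` is their number, and `P (b * m + x)` is one
more than the position of `x` in the list. -/
structure SetFam (m : ℕ) (A P l : ℕ → ℕ) (F : ℕ → Finset ℕ) : Prop where
  lt : ∀ b, ∀ x ∈ F b, x < m
  card : ∀ b, l b = (F b).card
  mem : ∀ b i, i < (F b).card → A (b * m + i) ∈ F b
  pos : ∀ b, ∀ x ∈ F b, ∃ i < (F b).card, A (b * m + i) = x ∧ P (b * m + x) = i + 1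
  pos_eq : ∀ b i, i < (F b).card → P (b * m + A (b * m + i)) = i + 1

namespace SetFam

variable {m : ℕ} {A P l : ℕ → ℕ} {F : ℕ → Finset ℕ}

theorem card_le (h : SetFam m A P l F) (b : ℕ) : (F b).card ≤ m := by
  have := Finset.card_le_card (fun x hx => Finset.mem_range.2 (h.lt b x hx) : F b ⊆ Finset.range m)
  simpa using this

theorem empty (m : ℕ) (A P : ℕ → ℕ) : SetFam m A P (fun _ => 0) (fun _ => ∅) :=
  ⟨by simp, by simp, by simp, by simp, by simp⟩

/-- A set is emptied by resetting its length alone. Stale entries do no harm, because every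
condition concerns only positions below the length and elements that are present. -/
theorem of_card (h : SetFam m A P l F) {l' : ℕ → ℕ} {F' : ℕ → Finset ℕ}
    (hF : ∀ b, (l' b = l b ∧ F' b = F b) ∨ (l' b = 0 ∧ F' b = ∅)) : SetFam m A P l' F' := by
  constructor
  · intro b x hx; rcases hF b with h' | h' <;> rw [h'.2] at hx
    · exact h.lt b x hx
    · simp at hx
  · intro b; rcases hF b with h' | h' <;> rw [h'.1, h'.2]
    · exact h.card b
    · simp
  · intro b i hi; rcases hF b with h' | h' <;> rw [h'.2] at hi ⊢
    · exact h.mem b i hi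
    · simp at hi
  · intro b x hx; rcases hF b with h' | h' <;> rw [h'.2] at hx ⊢
    · exact h.pos b x hx
    · simp at hx
  · intro b i hi; rcases hF b with h' | h' <;> rw [h'.2] at hi
    · exact h.pos_eq b i hi
    · simp at hi

/-- The list enumerates the set without repetitions. -/
theorem inj (h : SetFam m A P l F) {b i j : ℕ} (hi : i < (F b).card) (hj : j < (F b).card)
    (hij : A (b * m + i) = A (b * m + j)) : i = j := by
  have h1 := h.pos_eq b i hi
  have h2 := h.pos_eq b j hj
  rw [hij] at h1
  omega

theorem insert (h : SetFam m A P l F) {b x : ℕ} (hx : x < m) (hxb : x ∉ F b) :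
    SetFam m (Function.update A (b * m + l b) x) (Function.update P (b * m + x) (l b + 1))
      (Function.update l b (l b + 1)) (Function.update F b (insert x (F b))) := by
  have hlt : (F b).card < m := by
    have := Finset.card_le_card (Finset.insert_subset (Finset.mem_range.2 hx)
      (fun y hy => Finset.mem_range.2 (h.lt b y hy) : F b ⊆ Finset.range m))
    rw [Finset.card_insert_of_notMem hxb] at this
    simpa using this
  have hlb := h.card b
  have hA : ∀ c i, i < (F c).card → Function.update A (b * m + l b) x (c * m + i) = A (c * m + i) := by
    intro c i hi
    rw [Function.update_of_ne]
    intro he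
    rw [index_inj (lt_of_lt_of_le hi (h.card_le c)) (by omega)] at he
    obtain ⟨rfl, rfl⟩ := he
    omega
  have hP : ∀ c y, y ∈ F c → Function.update P (b * m + x) (l b + 1) (c * m + y) = P (c * m + y) := by
    intro c y hy
    rw [Function.update_of_ne]
    intro he
    rw [index_inj (h.lt c y hy) hx] at he
    obtain ⟨rfl, rfl⟩ := he
    exact hxb hy
  constructor
  · intro c y hy
    by_cases hc : c = b
    · subst hc
      rw [Function.update_self] at hy
      rcases Finset.mem_insert.1 hy with rfl | hy
      · exact hx
      · exact h.lt c y hy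
    · rw [Function.update_of_ne hc] at hy; exact h.lt c y hy
  · intro c
    by_cases hc : c = b
    · subst hc; simp [Finset.card_insert_of_notMem hxb, hlb]
    · simp [Function.update_of_ne hc, h.card c]
  · intro c i hi
    by_cases hc : c = b
    · subst hc
      rw [Function.update_self, Finset.card_insert_of_notMem hxb] at hi
      rw [Function.update_self]
      by_cases hic : i = (F c).card
      · rw [hic, ← hlb, Function.update_self]; exact Finset.mem_insert_self _ _
      · rw [hA c i (by omega)]; exact Finset.mem_insert_of_mem (h.mem c i (by omega))
    · rw [Function.update_of_ne hc] at hi ⊢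
      rw [hA c i hi]; exact h.mem c i hi
  · intro c y hy
    by_cases hc : c = b
    · subst hc
      rw [Function.update_self] at hy ⊢
      rw [Finset.card_insert_of_notMem hxb]
      rcases Finset.mem_insert.1 hy with rfl | hy
      · exact ⟨l c, by omega, by simp, by simp⟩
      · obtain ⟨i, hi, h1, h2⟩ := h.pos c y hy
        exact ⟨i, by omega, by rw [hA c i hi, h1], by rw [hP c y hy, h2]⟩
    · rw [Function.update_of_ne hc] at hy ⊢
      obtain ⟨i, hi, h1, h2⟩ := h.pos c y hy
      exact ⟨i, hi, by rw [hA c i hi, h1], by rw [hP c y hy, h2]⟩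
  · intro c i hi
    by_cases hc : c = b
    · subst hc
      rw [Function.update_self, Finset.card_insert_of_notMem hxb] at hi
      by_cases hic : i = (F c).card
      · rw [hic, ← hlb, Function.update_self, Function.update_self]
      · rw [hA c i (by omega), hP c _ (h.mem c i (by omega)), h.pos_eq c i (by omega)]
    · rw [Function.update_of_ne hc] at hi
      rw [hA c i hi, hP c _ (h.mem c i hi), h.pos_eq c i hi]

/-- The last entry of the list moves into the gap, which takes constant time. If `x` is itself the
last entry, the move is a harmless write to a position that no longer counts. -/
theorem erase (h : SetFam m A P l F) {b x : ℕ} (hxb : x ∈ F b) :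
    SetFam m (Function.update A (b * m + (P (b * m + x) - 1)) (A (b * m + (l b - 1))))
      (Function.update P (b * m + A (b * m + (l b - 1))) (P (b * m + x) - 1 + 1))
      (Function.update l b (l b - 1)) (Function.update F b ((F b).erase x)) := by
  obtain ⟨p, hp, hAp, hPp⟩ := h.pos b x hxb
  have hlb := h.card b
  have hle := h.card_le b
  rw [hPp, hlb, Nat.add_sub_cancel]
  set r := (F b).card - 1 with hr
  have hy := h.mem b r (by omega)
  have hPy := h.pos_eq b r (by omega)
  set y := A (b * m + r) with hydef
  have hym := h.lt b y hy
  have hcard : ((F b).erase x).card = r := Finset.card_erase_of_mem hxb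
  have hA : ∀ c i, i < (F c).card → (c ≠ b ∨ i ≠ p) →
      Function.update A (b * m + p) y (c * m + i) = A (c * m + i) := by
    intro c i hi hne
    rw [Function.update_of_ne]
    intro he
    rw [index_inj (lt_of_lt_of_le hi (h.card_le c)) (by omega)] at he
    rcases hne with h' | h'
    · exact h' he.1
    · exact h' he.2
  have hP : ∀ c z, z ∈ F c → (c ≠ b ∨ z ≠ y) →
      Function.update P (b * m + y) (p + 1) (c * m + z) = P (c * m + z) := by
    intro c z hz hne
    rw [Function.update_of_ne]
    intro he
    rw [index_inj (h.lt c z hz) hym] at he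
    rcases hne with h' | h'
    · exact h' he.1
    · exact h' he.2
  have hne : ∀ i, i < r → i ≠ p → A (b * m + i) ≠ x ∧ A (b * m + i) ≠ y := by
    intro i hi hip
    refine ⟨fun he => hip (h.inj (by omega) hp (by rw [he, hAp])), fun he => ?_⟩
    have := h.inj (b := b) (i := i) (j := r) (by omega) (by omega) (by rw [he])
    omega
  have hyx : p < r → y ≠ x := by
    intro hpr he
    have := h.inj (b := b) (i := p) (j := r) (by omega) (by omega) (by rw [hAp, ← he])
    omega
  constructor
  · intro c z hz
    by_cases hc : c = b
    · subst hc
      rw [Function.update_self] at hz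
      exact h.lt c z (Finset.mem_of_mem_erase hz)
    · rw [Function.update_of_ne hc] at hz; exact h.lt c z hz
  · intro c
    by_cases hc : c = b
    · subst hc; simp [hcard]
    · simp [Function.update_of_ne hc, h.card c]
  · intro c i hi
    by_cases hc : c = b
    · subst hc
      rw [Function.update_self, hcard] at hi
      rw [Function.update_self]
      by_cases hip : i = p
      · rw [hip, Function.update_self]
        exact Finset.mem_erase.2 ⟨hyx (by omega), hy⟩
      · rw [hA c i (by omega) (Or.inr hip)]
        exact Finset.mem_erase.2 ⟨(hne i hi hip).1, h.mem c i (by omega)⟩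
    · rw [Function.update_of_ne hc] at hi ⊢
      rw [hA c i hi (Or.inl hc)]; exact h.mem c i hi
  · intro c z hz
    by_cases hc : c = b
    · subst hc
      rw [Function.update_self] at hz ⊢
      rw [hcard]
      obtain ⟨hzx, hz⟩ := Finset.mem_erase.1 hz
      obtain ⟨i, hi, h1, h2⟩ := h.pos c z hz
      have hip : i ≠ p := by rintro rfl; exact hzx (by rw [← h1, hAp])
      by_cases hzy : z = y
      · subst hzy
        have hir : i = r := by omega
        exact ⟨p, by omega, by rw [Function.update_self], by rw [Function.update_self]⟩
      · have hir : i ≠ r := by rintro rfl; exact hzy (by rw [← h1])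
        exact ⟨i, by omega, by rw [hA c i hi (Or.inr hip), h1],
          by rw [hP c z hz (Or.inr hzy), h2]⟩
    · rw [Function.update_of_ne hc] at hz ⊢
      obtain ⟨i, hi, h1, h2⟩ := h.pos c z hz
      exact ⟨i, hi, by rw [hA c i hi (Or.inl hc), h1], by rw [hP c z hz (Or.inl hc), h2]⟩
  · intro c i hi
    by_cases hc : c = b
    · subst hc
      rw [Function.update_self, hcard] at hi
      by_cases hip : i = p
      · rw [hip, Function.update_self, Function.update_self]
      · rw [hA c i (by omega) (Or.inr hip), hP c _ (h.mem c i (by omega)) (Or.inr (hne i hi hip).2),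
          h.pos_eq c i (by omega)]
    · rw [Function.update_of_ne hc] at hi
      rw [hA c i hi (Or.inl hc), hP c _ (h.mem c i hi) (Or.inl hc), h.pos_eq c i hi]

end SetFam

end DynSkeleton

namespace DynSkeleton

/-! ### The program

Variables: `0`–`2` the update, `3` `n`, `4` `d`, `5` `L`, `6` `L_d`, `7` the size of `X`, `8` `n ^ 3`,
`9` `2 ^ L_d`, `10` `⌈1 / γ⌉`, `11` the number of edges of the current phase, `12` the current class.

Arrays: `0`, `1` the edges in `X`; the set families `2`–`4` (neighbours of a node), `5`–`7` (dirty
nodes), `8`–`10` (clean big nodes), `11`–`13` (edges in `X`), `14`–`16` (edges of a class);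
`17` the number of updates at a node since it was last clean; `18`, `19`, `20` tail, head and class of
an edge of the phase; `21` the number of an edge of the phase, given its endpoints; `22` the number of
deleted edges at a node, by class; `23` the number of nodes that have lost too many edges of a class;
`24` the two partners of an edge; `25` its colour; `26` the edge that waits for a partner;
`27` membership in the set of clean big nodes. -/

namespace Cmd

open DynSkeleton.Expr

infixr:30 " ;; " => Cmd.seq

/-- Insert the value of the variable `15` into the set number `var 14` of the family `(A, P, l)`. -/
def setInsert (A P l : ℕ) : Cmd :=
  store A (var 14 * var 8 + read l (var 14)) (var 15) ;;
  store P (var 14 * var 8 + var 15) (read l (var 14) + const 1) ;;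
  store l (var 14) (read l (var 14) + const 1)

/-- Remove the value of the variable `15` from the set number `var 14` of the family `(A, P, l)`. -/
def setErase (A P l : ℕ) : Cmd :=
  assign 16 (read P (var 14 * var 8 + var 15) - const 1) ;;
  store l (var 14) (read l (var 14) - const 1) ;;
  assign 17 (read A (var 14 * var 8 + read l (var 14))) ;;
  store A (var 14 * var 8 + var 16) (var 17) ;;
  store P (var 14 * var 8 + var 17) (var 16 + const 1)

/-- Compute `n ^ 3`, `2 ^ L_d` and `⌈1 / γ⌉`. -/
def setup : Cmd :=
  assign 8 (var 3 * var 3 * var 3) ;;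
  assign 9 (const 1) ;;
  forUp 20 6 (assign 9 (var 9 + var 9)) ;;
  assign 10 (const 0) ;;
  assign 13 (const 1) ;;
  loop (.eq (var 13) (const 1))
    (ite (.leParam 1 (const 1) (var 10)) (assign 13 (const 0)) (assign 10 (var 10 + const 1)))

/-- Insert the edge into the adjacency lists. -/
def insertEdge : Cmd :=
  (assign 14 (var 1) ;; assign 15 (var 2)) ;; setInsert 2 3 4 ;;
  (assign 14 (var 2) ;; assign 15 (var 1)) ;; setInsert 2 3 4

/-- Delete the edge from the adjacency lists. -/
def eraseEdge : Cmd :=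
  (assign 14 (var 1) ;; assign 15 (var 2)) ;; setErase 2 3 4 ;;
  (assign 14 (var 2) ;; assign 15 (var 1)) ;; setErase 2 3 4

/-- `ε d / (12 L ^ 2 ⌈1 / γ⌉)` exceeds the number of updates at the node `var 15`. -/
def cleanTest : Test :=
  .ltParam 0 (read 17 (var 15) * (const 12 * (var 5 * var 5 * var 10))) (var 4)

/-- Count an update at the node `var 15`. -/
def touch : Cmd :=
  ite cleanTest
    (store 17 (var 15) (read 17 (var 15) + const 1) ;;
      ite cleanTest skip
        (assign 14 (const 0) ;; setInsert 5 6 7 ;;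
          ite (.eq (read 27 (var 15)) (const 0)) skip
            (store 27 (var 15) (const 0) ;; setErase 8 9 10)))
    skip

/-- The node `var 18` has lost few edges of the class `var 19`. -/
def classTest : Test :=
  .ltParam 0 (read 22 (var 18 * var 8 + var 19) * (const 12 * (var 9 * (var 5 * var 5 * var 10))))
    (var 4)

/-- Count the deletion of an edge of the class `var 19` at the node `var 18`. -/
def lose : Cmd :=
  ite classTest
    (store 22 (var 18 * var 8 + var 19) (read 22 (var 18 * var 8 + var 19) + const 1) ;;
      ite classTest skip (store 23 (var 19) (read 23 (var 19) + const 1)))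
    (store 22 (var 18 * var 8 + var 19) (read 22 (var 18 * var 8 + var 19) + const 1))

/-- Remove the edge `var 15` from `X`. -/
def eraseX : Cmd :=
  assign 14 (const 0) ;; setErase 11 12 13 ;;
  store 0 (var 16) (read 0 (read 13 (var 14))) ;;
  store 1 (var 16) (read 1 (read 13 (var 14)))

/-- Remove the deleted edge from the current phase, if it belongs to it. -/
def erasePhase : Cmd :=
  assign 15 (read 21 (var 1 * var 8 + var 2)) ;;
  ite (.eq (var 15) (const 0)) skip
    ((store 21 (var 1 * var 8 + var 2) (const 0) ;; store 21 (var 2 * var 8 + var 1) (const 0) ;;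
      assign 19 (read 20 (var 15)) ;; assign 18 (var 1)) ;; lose ;; assign 18 (var 2) ;; lose ;;
      ite (.eq (var 19) (var 12)) eraseX skip)

/-- Clear the tables of the old phase. -/
def cleanup : Cmd :=
  forUp 20 11
    (assign 21 (var 20 + const 1) ;;
      assign 22 (read 18 (var 21)) ;; assign 23 (read 19 (var 21)) ;; assign 24 (read 20 (var 21)) ;;
      store 21 (var 22 * var 8 + var 23) (const 0) ;; store 21 (var 23 * var 8 + var 22) (const 0) ;;
      store 22 (var 22 * var 8 + var 24) (const 0) ;; store 22 (var 23 * var 8 + var 24) (const 0) ;;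
      store 23 (var 24) (const 0) ;; store 16 (var 24) (const 0))

/-- Make all dirty nodes clean, and find out which of them are big. -/
def reclassify : Cmd :=
  assign 25 (read 7 (const 0)) ;;
  forUp 20 25
    (assign 15 (read 5 (var 20)) ;; store 17 (var 15) (const 0) ;;
      ite (.leParam 0 (read 4 (var 15) * (var 5 * var 5)) (const 2 * var 4)) skip
        (assign 14 (const 0) ;; setInsert 8 9 10 ;; store 27 (var 15) (const 1))) ;;
  store 7 (const 0) (const 0)

/-- Collect the edges at the node `var 22`. -/
def collectAt : Cmd :=
  forUp 21 26
    (assign 23 (read 2 (var 22 * var 8 + var 21)) ;;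
      ite (.eq (read 21 (var 22 * var 8 + var 23)) (const 0))
        (assign 11 (var 11 + const 1) ;;
          store 18 (var 11) (var 22) ;; store 19 (var 11) (var 23) ;; store 20 (var 11) (const 1) ;;
          store 21 (var 22 * var 8 + var 23) (var 11) ;; store 21 (var 23 * var 8 + var 22) (var 11))
        skip)

/-- Collect the edges at the big nodes. -/
def collect : Cmd :=
  (assign 11 (const 0) ;; assign 25 (read 10 (const 0))) ;;
  forUp 20 25
    ((assign 22 (read 8 (var 20)) ;; assign 26 (read 4 (var 22))) ;; collectAt)

/-- Pair the edges that have the same endpoint in the array `src` and the same class. -/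
def pairUp (src side : ℕ) : Cmd :=
  forUp 20 11
    (assign 21 (var 20 + const 1) ;;
      assign 23 (read src (var 21) * var 8 + read 20 (var 21)) ;;
      assign 22 (read 26 (var 23)) ;;
      store 24 (var 21 + var 21 + const side) (var 22) ;;
      ite (.eq (var 22) (const 0))
        (store 26 (var 23) (var 21))
        (store 24 (var 22 + var 22 + const side) (var 21) ;; store 26 (var 23) (const 0)))

/-- Forget the edges that still wait for a partner. -/
def unpair (src : ℕ) : Cmd :=
  forUp 20 11
    (assign 21 (var 20 + const 1) ;;
      store 26 (read src (var 21) * var 8 + read 20 (var 21)) (const 0))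

/-- Colour alternately the edges from the edge `var 21` on; the colour of this edge is `var 22`, and
the next partner is on the side `var 23`. -/
def walk : Cmd :=
  loop (.eq (read 25 (var 21)) (const 0))
    (store 25 (var 21) (var 22) ;;
      assign 21 (read 24 (var 21 + var 21 + var 23)) ;;
      assign 22 (const 3 - var 22) ;; assign 23 (const 1 - var 23))

/-- Colour the edges so that partners have different colours. -/
def colour : Cmd :=
  store 25 (const 0) (const 1) ;;
  forUp 20 11 (store 25 (var 20 + const 1) (const 0)) ;;
  forUp 20 11
    (assign 24 (var 20 + const 1) ;;
      ite (.eq (read 25 (var 24)) (const 0))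
        ((store 25 (var 24) (const 1) ;; assign 21 (read 24 (var 24 + var 24)) ;;
          assign 22 (const 2) ;; assign 23 (const 1)) ;; walk ;;
         (assign 21 (read 24 (var 24 + var 24 + const 1)) ;;
          assign 22 (const 2) ;; assign 23 (const 0)) ;; walk)
        skip)

/-- Split every class in two according to the colours. -/
def refine : Cmd :=
  forUp 20 11
    (assign 21 (var 20 + const 1) ;;
      store 20 (var 21) (read 20 (var 21) + read 20 (var 21) + read 25 (var 21) - const 1))

/-- Split every class into halves. -/
def halve : Cmd :=
  pairUp 18 0 ;; unpair 18 ;; pairUp 19 1 ;; unpair 19 ;; colour ;; refine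

/-- List the edges of every class. -/
def distribute : Cmd :=
  forUp 20 11
    ((assign 15 (var 20 + const 1) ;; assign 14 (read 20 (var 15))) ;; setInsert 14 15 16)

/-- Let `X` be the set of the edges of the current class that have not been deleted. -/
def load : Cmd :=
  (store 13 (const 0) (const 0) ;; assign 25 (read 16 (var 12))) ;;
  forUp 20 25
    (assign 15 (read 14 (var 12 * var 8 + var 20)) ;;
      ite (.eq (read 21 (read 18 (var 15) * var 8 + read 19 (var 15))) (var 15))
        (assign 14 (const 0) ;;
          store 0 (read 13 (const 0)) (read 18 (var 15)) ;;
          store 1 (read 13 (const 0)) (read 19 (var 15)) ;; setInsert 11 12 13)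
        skip)

/-- Begin a new phase. -/
def rebuild : Cmd :=
  cleanup ;; reclassify ;; collect ;; forUp 27 6 halve ;; distribute ;; assign 12 (var 9) ;; load

/-- Go to the first class, from the current class on, that has few lossy nodes. -/
def advance : Cmd :=
  (assign 28 (var 12) ;; assign 13 (const 1)) ;;
  loop (.eq (var 13) (const 1))
    (ite (.leParam 2 (read 23 (var 12)) (const 2 * read 10 (const 0)))
      (assign 13 (const 0)) (assign 12 (var 12 + const 1)))

/-- Restore the bounds on the number of spurious nodes. -/
def restore : Cmd :=
  ite (.leParam 2 (read 7 (const 0)) (const 2 * read 10 (const 0)))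
    (advance ;;
      ite (.eq (var 12) (var 9 + var 9)) rebuild (ite (.eq (var 12) (var 28)) skip load))
    rebuild

/-- The reaction to an edge update. -/
def update : Cmd :=
  setup ;; ite (.eq (var 0) (const 1)) insertEdge (eraseEdge ;; erasePhase) ;;
  (assign 15 (var 1) ;; touch) ;; (assign 15 (var 2) ;; touch) ;;
  restore ;; assign 7 (read 13 (const 0))

end Cmd

end DynSkeleton

/-! ### Constant-time operations on sets -/

namespace DynSkeleton

variable {M : Machine}

@[simp] theorem Memory.setVar_vars (s : Memory) (x v : ℕ) :
    (s.setVar x v).vars = Function.update s.vars x v := rfl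
@[simp] theorem Memory.setVar_arrs (s : Memory) (x v : ℕ) : (s.setVar x v).arrs = s.arrs := rfl
@[simp] theorem Memory.setArr_vars (s : Memory) (a i v : ℕ) : (s.setArr a i v).vars = s.vars := rfl
@[simp] theorem Memory.setArr_arrs (s : Memory) (a i v : ℕ) :
    (s.setArr a i v).arrs = Function.update s.arrs a (Function.update (s.arrs a) i v) := rfl

/-- The conditions `hc` and `hT` are computations on the program text and are proved by `rfl`; only
the weakest precondition needs an argument. -/
theorem Run.block {c : Cmd} {s : Memory} {T : ℕ} {P : Memory → Prop} (hc : c.ok = true)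
    (hT : c.cost.ble T = true) (h : c.wp M P s) : Run M c s T P :=
  (Run.of_wp hc h).mono (Nat.le_of_ble_eq_true hT) fun _ _ _ h => h

theorem Run.setInsert {A P l m b x : ℕ} {F : ℕ → Finset ℕ} {s : Memory} (h₁ : A ≠ P) (h₂ : A ≠ l)
    (h₃ : P ≠ l) (hF : SetFam m (s.arrs A) (s.arrs P) (s.arrs l) F) (h8 : s.vars 8 = m)
    (h14 : s.vars 14 = b) (h15 : s.vars 15 = x) (hx : x < m) (hxb : x ∉ F b) (hQ : m + 1 ≤ M.Q) :
    Run M (Cmd.setInsert A P l) s 30 fun s' =>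
      SetFam m (s'.arrs A) (s'.arrs P) (s'.arrs l) (Function.update F b (insert x (F b))) ∧
      s'.arrs A = Function.update (s.arrs A) (b * m + (F b).card) x ∧
      s'.arrs l = Function.update (s.arrs l) b ((F b).card + 1) := by
  refine Run.block rfl rfl ?_
  have hc := hF.card b
  have hle := hF.card_le b
  simp [Cmd.setInsert, Cmd.wp, h8, h14, h15, h₁, h₂, h₃, h₁.symm, h₂.symm, h₃.symm]
  have := hF.insert hx hxb
  rw [hc] at this ⊢
  exact ⟨by omega, this, by simp⟩

theorem Run.setErase {A P l m b x : ℕ} {F : ℕ → Finset ℕ} {s : Memory} (h₁ : A ≠ P) (h₂ : A ≠ l)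
    (h₃ : P ≠ l) (hF : SetFam m (s.arrs A) (s.arrs P) (s.arrs l) F) (h8 : s.vars 8 = m)
    (h14 : s.vars 14 = b) (h15 : s.vars 15 = x) (hxb : x ∈ F b) (hQ : m + 1 ≤ M.Q) :
    Run M (Cmd.setErase A P l) s 40 fun s' =>
      SetFam m (s'.arrs A) (s'.arrs P) (s'.arrs l) (Function.update F b ((F b).erase x)) ∧
      s'.arrs A = Function.update (s.arrs A) (b * m + s'.vars 16)
        (s.arrs A (b * m + ((F b).card - 1))) ∧
      s'.arrs l = Function.update (s.arrs l) b ((F b).card - 1) ∧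
      s'.vars 16 < (F b).card ∧ s.arrs A (b * m + s'.vars 16) = x := by
  refine Run.block rfl rfl ?_
  have hc := hF.card b
  have hle := hF.card_le b
  obtain ⟨i, hi, hi1, hi2⟩ := hF.pos b x hxb
  have := hF.erase hxb
  simp [Cmd.setErase, Cmd.wp, h8, h14, h15, h₁, h₂, h₃, h₁.symm, h₂.symm, h₃.symm]
  simp only [hi2, hc, Nat.add_sub_cancel] at this ⊢
  refine ⟨by omega, this, ?_⟩
  simpa using ⟨hi, hi1⟩

end DynSkeleton

namespace DynSkeleton

variable {M : Machine}

/-! ### Pairing edges -/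

/-- `q` is a partial pairing of the numbers from `1` to `m`, where `0` stands for no partner. -/
def Pairing (m : ℕ) (q : ℕ → ℕ) : Prop :=
  ∀ e, 1 ≤ e → e ≤ m → q e = 0 ∨ (1 ≤ q e ∧ q e ≤ m ∧ q e ≠ e ∧ q (q e) = e)

/-- `q` pairs numbers with equal keys, and at most one number of each key has no partner. -/
structure KeyPairing (k : ℕ → ℕ) (m : ℕ) (q : ℕ → ℕ) : Prop where
  pairing : Pairing m q
  key : ∀ e, 1 ≤ e → e ≤ m → q e ≠ 0 → k (q e) = k e
  unique : ∀ e e', 1 ≤ e → e ≤ m → 1 ≤ e' → e' ≤ m → q e = 0 → q e' = 0 → k e = k e' → e = e'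

/-- The first `j` numbers have been paired; those without partner wait in the table `w`. -/
structure PairingUpTo (k : ℕ → ℕ) (j : ℕ) (q w : ℕ → ℕ) : Prop where
  pairing : Pairing j q
  key : ∀ e, 1 ≤ e → e ≤ j → q e ≠ 0 → k (q e) = k e
  waits : ∀ e, 1 ≤ e → e ≤ j → q e = 0 → w (k e) = e
  waiting : ∀ x, w x ≠ 0 → w x ≤ j ∧ k (w x) = x ∧ q (w x) = 0

namespace PairingUpTo

variable {k q w : ℕ → ℕ} {j : ℕ}

/-- Two unpaired numbers with the same key would occupy the same cell of the waiting table. -/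
theorem keyPairing (h : PairingUpTo k j q w) : KeyPairing k j q :=
  ⟨h.pairing, h.key, fun e e' h1 h2 h3 h4 h5 h6 h7 => by
    rw [← h.waits e h1 h2 h5, ← h.waits e' h3 h4 h6, h7]⟩

theorem wait (h : PairingUpTo k j q w) (hw : w (k (j + 1)) = 0) :
    PairingUpTo k (j + 1) (Function.update q (j + 1) 0) (Function.update w (k (j + 1)) (j + 1)) := by
  have hq : ∀ e, e ≤ j → Function.update q (j + 1) 0 e = q e := fun e he =>
    Function.update_of_ne (by omega) _ _
  constructor
  · intro e h1 h2
    by_cases he : e = j + 1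
    · subst he; simp
    · rw [hq e (by omega)]
      rcases h.pairing e h1 (by omega) with h' | ⟨h3, h4, h5, h6⟩
      · exact Or.inl h'
      · exact Or.inr ⟨h3, by omega, h5, by rw [hq _ h4, h6]⟩
  · intro e h1 h2 h3
    by_cases he : e = j + 1
    · subst he; simp at h3
    · rw [hq e (by omega)] at h3 ⊢; exact h.key e h1 (by omega) h3
  · intro e h1 h2 h3
    by_cases he : e = j + 1
    · subst he; simp
    · rw [hq e (by omega)] at h3
      have := h.waits e h1 (by omega) h3
      rw [Function.update_of_ne, this]
      intro h'; rw [h', hw] at this; omega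
  · intro x hx
    by_cases hxk : x = k (j + 1)
    · subst hxk; simp
    · rw [Function.update_of_ne hxk] at hx ⊢
      obtain ⟨h1, h2, h3⟩ := h.waiting x hx
      exact ⟨by omega, h2, by rw [hq _ h1, h3]⟩

/-- The number waiting under the key of `j + 1` becomes its partner, which frees the cell. Earlier
pairs are not disturbed: a number whose partner entry is 0 is not the partner of another one. -/
theorem link (h : PairingUpTo k j q w) (hw : w (k (j + 1)) ≠ 0) :
    PairingUpTo k (j + 1)
      (Function.update (Function.update q (j + 1) (w (k (j + 1)))) (w (k (j + 1))) (j + 1))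
      (Function.update w (k (j + 1)) 0) := by
  obtain ⟨hf, hkf, hqf⟩ := h.waiting _ hw
  set f := w (k (j + 1)) with hfdef
  set q' := Function.update (Function.update q (j + 1) f) f (j + 1) with hq'
  have hqj : q' (j + 1) = f := by
    rw [hq', Function.update_of_ne (by omega), Function.update_self]
  have hqff : q' f = j + 1 := by rw [hq', Function.update_self]
  have hq : ∀ e, e ≤ j → e ≠ f → q' e = q e := fun e he hef => by
    rw [hq', Function.update_of_ne hef, Function.update_of_ne (by omega)]
  constructor
  · intro e h1 h2
    by_cases he : e = j + 1
    · subst he; rw [hqj]; exact Or.inr ⟨by omega, by omega, by omega, hqff⟩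
    by_cases hef : e = f
    · rw [hef, hqff]; exact Or.inr ⟨by omega, le_rfl, by omega, hqj⟩
    rw [hq e (by omega) hef]
    rcases h.pairing e h1 (by omega) with h' | ⟨h3, h4, h5, h6⟩
    · exact Or.inl h'
    · refine Or.inr ⟨h3, by omega, h5, ?_⟩
      rw [hq _ h4, h6]
      intro h'; rw [h', hqf] at h6; omega
  · intro e h1 h2 h3
    by_cases he : e = j + 1
    · subst he; rw [hqj, hkf]
    by_cases hef : e = f
    · rw [hef, hqff, hkf]
    rw [hq e (by omega) hef] at h3 ⊢
    exact h.key e h1 (by omega) h3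
  · intro e h1 h2 h3
    by_cases he : e = j + 1
    · subst he; rw [hqj] at h3; omega
    by_cases hef : e = f
    · rw [hef, hqff] at h3; omega
    rw [hq e (by omega) hef] at h3
    have := h.waits e h1 (by omega) h3
    rw [Function.update_of_ne, this]
    intro h'; rw [h', ← hfdef] at this; exact hef this.symm
  · intro x hx
    by_cases hxk : x = k (j + 1)
    · subst hxk; simp at hx
    · rw [Function.update_of_ne hxk] at hx ⊢
      obtain ⟨h1, h2, h3⟩ := h.waiting x hx
      refine ⟨by omega, h2, ?_⟩
      rw [hq _ h1, h3]
      intro h'; rw [h', hkf] at h2; exact hxk h2.symm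

end PairingUpTo

/-- Array 24 interleaves the partner tables of the two sides; a write on one side is an ordinary
update of the table of that side. -/
theorem update_double (a : ℕ → ℕ) (r e v : ℕ) :
    (fun x => Function.update a (e + e + r) v (x + x + r)) =
      Function.update (fun x => a (x + x + r)) e v := by
  funext x
  by_cases h : x = e
  · subst h; simp
  · rw [Function.update_of_ne h, Function.update_of_ne (by omega)]

/-- The key of an edge: its endpoint in the array `src`, and its class. -/
def edgeKey (s : Memory) (src e : ℕ) : ℕ := s.arrs src e * s.vars 8 + s.arrs 20 e

theorem Run.pairUp {src side m : ℕ} {s : Memory} (h₁ : src ≠ 24) (h₂ : src ≠ 26) (hside : side < 2)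
    (h11 : s.vars 11 = m) (hk : ∀ e, 1 ≤ e → e ≤ m → edgeKey s src e ≤ M.Q) (hm : m < M.Q)
    (hw : ∀ x, s.arrs 26 x = 0) :
    Run M (Cmd.pairUp src side) s (100 * m + 10) fun s' =>
      PairingUpTo (edgeKey s src) m (fun e => s'.arrs 24 (e + e + side)) (s'.arrs 26) ∧
      ∀ i, i % 2 ≠ side → s'.arrs 24 i = s.arrs 24 i := by
  refine (Run.forUp (fun j s' =>
    PairingUpTo (edgeKey s src) j (fun e => s'.arrs 24 (e + e + side)) (s'.arrs 26) ∧
      ∀ i, i % 2 ≠ side → s'.arrs 24 i = s.arrs 24 i) m 90 (by simp [Cmd.wv]) (by simp [Cmd.wv])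
      (by decide) h11 ?_ ?_ ?_).mono (by omega) fun _ _ _ h => h
  · exact ⟨⟨fun e h1 h2 => by omega, fun e h1 h2 => by omega, fun e h1 h2 => by omega,
      fun x hx => absurd (hw x) hx⟩, fun _ _ => rfl⟩
  · exact fun _ _ _ h => h
  · rintro j s' hS hB hj hij ⟨hP, hO⟩
    have h8 : s'.vars 8 = s.vars 8 := hS.vars 8 (by simp [Cmd.wv])
    have hsrc : s'.arrs src = s.arrs src := hS.arrs src (by simp [Cmd.wa, h₁, h₂])
    have h20 : s'.arrs 20 = s.arrs 20 := hS.arrs 20 (by simp [Cmd.wa])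
    have hks : s'.arrs src (j + 1) * s.vars 8 + s'.arrs 20 (j + 1) = edgeKey s src (j + 1) := by
      rw [hsrc, h20, edgeKey]
    have hkj := hk (j + 1) (by omega) (by omega)
    have hd := update_double (s'.arrs 24) side
    have hS1 : side = 0 ∨ side = 1 := by omega
    refine Run.block (by rcases hS1 with h | h <;> rw [h] <;> rfl) rfl ?_
    simp [Cmd.wp, hij, h8, hks]
    refine ⟨by omega, hkj, fun h0 => ?_, fun h0 => ?_⟩
    · rw [h0]
      refine ⟨?_, fun i hi => ?_⟩
      · rw [hd]; exact hP.wait h0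
      · rw [Function.update_of_ne (by omega), hO i hi]
    · refine ⟨?_, fun i hi => ?_⟩
      · rw [update_double, hd]; exact hP.link h0
      · rw [Function.update_of_ne (by omega), Function.update_of_ne (by omega), hO i hi]

/-- The waiting table is far larger than `m`, but only cells indexed by keys of edges can be
occupied, so a loop over the edges clears it. -/
theorem Run.unpair {src m : ℕ} {s : Memory} (h₂ : src ≠ 26)
    (h11 : s.vars 11 = m) (hm : m < M.Q)
    (hw : ∀ x, s.arrs 26 x ≠ 0 → ∃ e, 1 ≤ e ∧ e ≤ m ∧ x = edgeKey s src e) :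
    Run M (Cmd.unpair src) s (40 * m + 10) fun s' => ∀ x, s'.arrs 26 x = 0 := by
  refine (Run.forUp (fun j s' => ∀ x, s'.arrs 26 x ≠ 0 → ∃ e, j < e ∧ e ≤ m ∧ x = edgeKey s src e)
    m 30 (by simp [Cmd.wv]) (by simp [Cmd.wv])
      (by decide) h11 hw ?_ ?_).mono (by omega) fun _ _ _ h => ?_
  · exact fun _ _ _ h => h
  · rintro j s' hS hB hj hij hP
    have h8 : s'.vars 8 = s.vars 8 := hS.vars 8 (by simp [Cmd.wv])
    have hsrc : s'.arrs src = s.arrs src := hS.arrs src (by simp [Cmd.wa, h₂])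
    have h20 : s'.arrs 20 = s.arrs 20 := hS.arrs 20 (by simp [Cmd.wa])
    have hks : s'.arrs src (j + 1) * s.vars 8 + s'.arrs 20 (j + 1) = edgeKey s src (j + 1) := by
      rw [hsrc, h20, edgeKey]
    refine Run.block rfl rfl ?_
    simp [Cmd.wp, hij, h8, hks]
    refine ⟨by omega, fun x hx => ?_⟩
    by_cases hxe : x = edgeKey s src (j + 1)
    · subst hxe; simp at hx
    · rw [Function.update_of_ne hxe] at hx
      obtain ⟨e, h1, h2, h3⟩ := hP x hx
      have : e ≠ j + 1 := by rintro rfl; exact hxe h3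
      exact ⟨e, by omega, h2, h3⟩
  · intro x
    by_contra hx
    obtain ⟨e, h1, h2, _⟩ := h x hx
    omega

/-! ### Alternating colours -/

/-- The number of uncoloured edges. -/
def uncoloured (m : ℕ) (c : ℕ → ℕ) : ℕ := ((Finset.Icc 1 m).filter (c · = 0)).card

theorem uncoloured_update {m x v : ℕ} {c : ℕ → ℕ} (hx : 1 ≤ x) (hxm : x ≤ m) (hc : c x = 0)
    (hv : v ≠ 0) : uncoloured m (Function.update c x v) + 1 = uncoloured m c := by
  have : (Finset.Icc 1 m).filter (fun e => Function.update c x v e = 0) =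
      ((Finset.Icc 1 m).filter (c · = 0)).erase x := by
    ext e
    by_cases he : e = x
    · subst he; simp [hv]
    · simp [he]
  rw [uncoloured, uncoloured, this, Finset.card_erase_add_one]
  simp [hx, hxm, hc]

/-- A partial colouring with the colours `1` and `2` in which partners have different colours. -/
structure Proper (q : ℕ → ℕ → ℕ) (m : ℕ) (c : ℕ → ℕ) : Prop where
  zero : c 0 = 1
  le : ∀ e, 1 ≤ e → e ≤ m → c e ≤ 2
  ne : ∀ i < 2, ∀ e, 1 ≤ e → e ≤ m → q i e ≠ 0 → c e ≠ 0 → c (q i e) ≠ 0 → c (q i e) ≠ c e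

/-- The state of a walk that is about to give the colour `k` to the edge `x`, which is the partner
on the side `1 - i` of a coloured edge. Other coloured edges with uncoloured partners are in `E`. -/
structure Walking (q : ℕ → ℕ → ℕ) (m : ℕ) (E : ℕ → ℕ → Prop) (c : ℕ → ℕ) (x k i : ℕ) : Prop where
  proper : Proper q m c
  x_le : x ≤ m
  k_mem : k = 1 ∨ k = 2
  i_mem : i = 0 ∨ i = 1
  front : ∀ r < 2, ∀ e, 1 ≤ e → e ≤ m → c e ≠ 0 → q r e ≠ 0 → c (q r e) = 0 →
    (q r e = x ∧ r = 1 - i ∧ c e = 3 - k) ∨ E r e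
  last : x ≠ 0 → ∃ e, 1 ≤ e ∧ e ≤ m ∧ c e = 3 - k ∧ q (1 - i) e = x
  exempt : ∀ r e, E r e → r = 1 ∧ c e = 1 ∧ k = i + 1

/-- The danger is that a walk closes a cycle with the wrong parity at its start edge, whose side 1
is still open and recorded in `E`. Colour and side flip together, so `k = i + 1` persists as long as
there is such an exemption. An edge that is entered from side 1 then gets the colour 1, and its
partner on that side has the colour 2; hence it is not the partner there of the start edge, which
has the colour 1. -/
theorem Walking.step {q : ℕ → ℕ → ℕ} {m : ℕ} {E : ℕ → ℕ → Prop} {c : ℕ → ℕ} {x k i : ℕ}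
    (h : Walking q m E c x k i) (hq : ∀ r < 2, Pairing m (q r)) (hx : c x = 0) :
    Walking q m E (Function.update c x k) (q i x) (3 - k) (1 - i) := by
  have hx0 : x ≠ 0 := by rintro rfl; rw [h.proper.zero] at hx; omega
  have hxm := h.x_le
  have hi := h.i_mem
  have hk := h.k_mem
  obtain ⟨a, ha1, ha2, ha3, ha4⟩ := h.last hx0
  have hback : ∀ r < 2, ∀ e, 1 ≤ e → e ≤ m → q r e = x → q r x = e := by
    intro r hr e h1 h2 h3
    rcases hq r hr e h1 h2 with h' | h'
    · omega
    · rw [← h3]; exact h'.2.2.2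
  have hxa : q (1 - i) x = a := hback _ (by omega) a ha1 ha2 ha4
  have hup : ∀ e, e ≠ x → Function.update c x k e = c e := fun e he => Function.update_of_ne he _ _
  have hqx : ∀ r < 2, q r x ≤ m ∧ q r x ≠ x := by
    intro r hr
    rcases hq r hr x (by omega) hxm with h' | h' <;> omega
  -- a coloured partner of `x` has the other colour
  have hdiff : ∀ r < 2, ∀ e, 1 ≤ e → e ≤ m → q r e = x → c e ≠ 0 → c e ≠ k := by
    intro r hr e h1 h2 h3 h4 h5
    rcases h.front r hr e h1 h2 h4 (by omega) (by rw [h3, hx]) with ⟨_, _, h6⟩ | h6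
    · omega
    · obtain ⟨rfl, h7, h8⟩ := h.exempt r e h6
      obtain rfl : i = 0 := by omega
      have h9 := hback 1 (by omega) e h1 h2 h3
      rw [show 1 - 0 = 1 by rfl, h9] at hxa
      subst hxa
      omega
  constructor
  · constructor
    · rw [hup 0 hx0.symm, h.proper.zero]
    · intro e h1 h2
      by_cases he : e = x
      · subst he; rw [Function.update_self]; omega
      · rw [hup e he]; exact h.proper.le e h1 h2
    · intro r hr e h1 h2 h3 h4 h5
      by_cases he : e = x
      · subst he
        have h6 := hqx r hr
        rw [hup _ h6.2] at h5 ⊢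
        rw [Function.update_self]
        refine hdiff r hr _ (by omega) h6.1 ?_ h5
        rcases hq r hr e h1 h2 with h' | h'
        · omega
        · exact h'.2.2.2
      · rw [hup e he] at h4 ⊢
        by_cases hqe : q r e = x
        · rw [hqe, Function.update_self]
          exact (hdiff r hr e h1 h2 hqe h4).symm
        · rw [hup _ hqe] at h5 ⊢
          exact h.proper.ne r hr e h1 h2 h3 h4 h5
  · exact (hqx i (by omega)).1
  · omega
  · omega
  · intro r hr e h1 h2 h3 h4 h5
    by_cases he : e = x
    · subst he
      left
      -- On the side from which `x` was entered its partner is `a`, which is already coloured.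
      have hri : r = i := by
        by_contra hne
        have : r = 1 - i := by omega
        rw [this, hxa, hup a (by rintro rfl; omega)] at h5
        omega
      subst hri
      exact ⟨rfl, by omega, by rw [Function.update_self]; omega⟩
    · rw [hup e he] at h3
      have hqe : q r e ≠ x := by
        intro h'; rw [h', Function.update_self] at h5; omega
      rw [hup _ hqe] at h5
      rcases h.front r hr e h1 h2 h3 h4 h5 with h6 | h6
      · exact absurd h6.1 hqe
      · exact Or.inr h6
  · intro _
    refine ⟨x, by omega, hxm, by rw [Function.update_self]; omega, ?_⟩
    congr 1; omega
  · intro r e hre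
    obtain ⟨h1, h2, h3⟩ := h.exempt r e hre
    refine ⟨h1, ?_, by omega⟩
    rw [hup e (by rintro rfl; omega), h2]

/-- The partners of the edges. -/
def partner (s : Memory) (i e : ℕ) : ℕ := s.arrs 24 (e + e + i)

/-- The edge number 0 serves as a sentinel of colour 1, so a missing partner ends the walk like a
coloured one. Every round colours a new edge, and 40 units for each of them pay for the walk. -/
theorem RunT.walk {m : ℕ} {E : ℕ → ℕ → Prop} {s : Memory}
    (hq : ∀ r < 2, Pairing m (partner s r))
    (h : Walking (partner s) m E (s.arrs 25) (s.vars 21) (s.vars 22) (s.vars 23)) :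
    RunT M Cmd.walk s fun s' t => Proper (partner s) m (s'.arrs 25) ∧
      (∀ r < 2, ∀ e, 1 ≤ e → e ≤ m → s'.arrs 25 e ≠ 0 → partner s r e ≠ 0 →
        s'.arrs 25 (partner s r e) = 0 → E r e) ∧
      (∀ e, s.arrs 25 e ≠ 0 → s'.arrs 25 e = s.arrs 25 e) ∧
      t + 40 * uncoloured m (s'.arrs 25) ≤ 40 * uncoloured m (s.arrs 25) + 10 := by
  refine RunT.mono (RunT.loop (by rfl) (fun k s' =>
    Walking (partner s) m E (s'.arrs 25) (s'.vars 21) (s'.vars 22) (s'.vars 23) ∧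
      s'.arrs 24 = s.arrs 24 ∧ (∀ e, s.arrs 25 e ≠ 0 → s'.arrs 25 e = s.arrs 25 e) ∧
      k = 40 * uncoloured m (s'.arrs 25)) ?_ ⟨h, rfl, fun _ _ => rfl, rfl⟩) ?_
  · rintro k s' ⟨hw, h24, hmono, rfl⟩ hb
    have hx : s'.arrs 25 (s'.vars 21) = 0 := hb
    have hx0 : s'.vars 21 ≠ 0 := by intro h0; rw [h0, hw.proper.zero] at hx; omega
    have hk0 : s'.vars 22 ≠ 0 := by have := hw.k_mem; omega
    have hu := uncoloured_update (Nat.one_le_iff_ne_zero.2 hx0) hw.x_le hx hk0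
    have hstep := hw.step hq hx
    refine RunT.mono (P := fun s'' t => t ≤ 30 ∧ s''.arrs 24 = s.arrs 24 ∧
      s''.arrs 25 = Function.update (s'.arrs 25) (s'.vars 21) (s'.vars 22) ∧
      s''.vars 21 = partner s (s'.vars 23) (s'.vars 21) ∧ s''.vars 22 = 3 - s'.vars 22 ∧
      s''.vars 23 = 1 - s'.vars 23) ?_ ?_
    · refine Run.block rfl rfl ?_
      simp [Cmd.wp, h24, partner]
    · rintro s'' t _ _ ⟨ht, g1, g2, g3, g4, g5⟩
      refine ⟨_, ⟨?_, g1, fun e he => ?_, rfl⟩, ?_⟩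
      · rw [g2, g3, g4, g5]; exact hstep
      · rw [g2, Function.update_of_ne, hmono e he]
        rintro rfl; rw [hmono _ he] at hx; exact he hx
      · rw [g2]; simp [Test.cost, Expr.cost]; omega
  · rintro s' t _ _ ⟨k, ⟨hw, h24, hmono, rfl⟩, hb, hk⟩
    refine ⟨hw.proper, fun r hr e h1 h2 h3 h4 h5 => ?_, hmono, ?_⟩
    · rcases hw.front r hr e h1 h2 h3 h4 h5 with h6 | h6
      · exact absurd (by rw [h6.1] at h5; exact h5) hb
      · exact h6
    · simp [Test.cost, Expr.cost] at hk; omega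

/-- Every edge has one of two colours, and partners have different colours. -/
structure TwoColouring (q : ℕ → ℕ → ℕ) (m : ℕ) (c : ℕ → ℕ) : Prop where
  mem : ∀ e, 1 ≤ e → e ≤ m → c e = 1 ∨ c e = 2
  ne : ∀ i < 2, ∀ e, 1 ≤ e → e ≤ m → q i e ≠ 0 → c (q i e) ≠ c e

/-- The coloured edges are closed under taking partners. -/
def Closed (q : ℕ → ℕ → ℕ) (m : ℕ) (E : ℕ → ℕ → Prop) (c : ℕ → ℕ) : Prop :=
  ∀ r < 2, ∀ e, 1 ≤ e → e ≤ m → c e ≠ 0 → q r e ≠ 0 → c (q r e) = 0 → E r e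

/-- The start of a walk that leaves `e` on the side `1 - i`. With `i = 1` the condition `2 = i + 1`
admits an exemption, which the first of two walks from `e` needs; with `i = 0` there can be none. -/
theorem Proper.walking {q : ℕ → ℕ → ℕ} {m : ℕ} {E : ℕ → ℕ → Prop} {c : ℕ → ℕ} {e i : ℕ}
    (h : Proper q m c) (hq : ∀ r < 2, Pairing m (q r)) (he : 1 ≤ e) (hem : e ≤ m) (hi : i = 0 ∨ i = 1)
    (hc : c e = 1) (hE : ∀ r e, E r e → r = 1 ∧ c e = 1 ∧ 2 = i + 1)
    (hcl : Closed q m (fun r a => r = 1 - i ∧ a = e ∨ E r a) c) :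
    Walking q m E c (q (1 - i) e) 2 i := by
  refine ⟨h, ?_, by simp, hi, fun r hr a h1 h2 h3 h4 h5 => ?_, fun _ => ⟨e, he, hem, hc, rfl⟩, hE⟩
  · rcases hq (1 - i) (by omega) e he hem with h' | h' <;> omega
  · rcases hcl r hr a h1 h2 h3 h4 h5 with ⟨rfl, rfl⟩ | h6
    · exact Or.inl ⟨rfl, rfl, hc⟩
    · exact Or.inr h6

/-- Since the coloured edges are closed under partners, an uncoloured edge has no coloured partner
and may take the colour 1 freely; it opens a new path or cycle. -/
theorem Proper.update {q : ℕ → ℕ → ℕ} {m : ℕ} {c : ℕ → ℕ} {e : ℕ}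
    (h : Proper q m c) (hq : ∀ r < 2, Pairing m (q r)) (he : 1 ≤ e) (hem : e ≤ m)
    (hc : c e = 0) (hcl : Closed q m (fun _ _ => False) c) :
    Proper q m (Function.update c e 1) ∧
      Closed q m (fun r a => r = 0 ∧ a = e ∨ r = 1 ∧ a = e) (Function.update c e 1) := by
  have hup : ∀ a, a ≠ e → Function.update c e 1 a = c a := fun a ha => Function.update_of_ne ha _ _
  have hun : ∀ r < 2, ∀ a, 1 ≤ a → a ≤ m → q r a = e → c a = 0 := by
    intro r hr a h1 h2 h3
    by_contra h4
    exact hcl r hr a h1 h2 h4 (by omega) (by rw [h3, hc])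
  refine ⟨⟨by rw [hup 0 (by omega), h.zero], ?_, ?_⟩, ?_⟩
  · intro a h1 h2
    by_cases ha : a = e
    · subst ha; simp
    · rw [hup a ha]; exact h.le a h1 h2
  · intro r hr a h1 h2 h3 h4 h5
    by_cases ha : a = e
    · subst ha
      rcases hq r hr a h1 h2 with h' | h'
      · exact absurd h' h3
      · rw [hup _ h'.2.2.1] at h5
        exact absurd (hcl r hr _ h'.1 h'.2.1 h5 (by rw [h'.2.2.2]; omega) (by rw [h'.2.2.2, hc])) id
    · rw [hup a ha] at h4 ⊢
      have hqa : q r a ≠ e := fun h' => h4 (hun r hr a h1 h2 h')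
      rw [hup _ hqa] at h5 ⊢
      exact h.ne r hr a h1 h2 h3 h4 h5
  · intro r hr a h1 h2 h3 h4 h5
    by_cases ha : a = e
    · have : r = 0 ∨ r = 1 := by omega
      simp [this, ha]
    · rw [hup a ha] at h3
      have hqa : q r a ≠ e := fun h' => h3 (hun r hr a h1 h2 h')
      rw [hup _ hqa] at h5
      exact absurd (hcl r hr a h1 h2 h3 h4 h5) id

theorem Run.colour {m : ℕ} {s : Memory} (h11 : s.vars 11 = m) (hm : m < M.Q)
    (hq : ∀ r < 2, Pairing m (partner s r)) :
    Run M Cmd.colour s (200 * m + 100) fun s' => TwoColouring (partner s) m (s'.arrs 25) := by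
  have step1 : Run M (.store 25 (.const 0) (.const 1)) s 10 fun s' => s'.arrs 25 0 = 1 :=
    Run.block rfl rfl (by simp [Cmd.wp])
  refine (Run.seq step1 fun s₁ hS₁ _ hz₁ => Run.seq (Run.forUp (fun j s' => s'.arrs 25 0 = 1 ∧
    ∀ e, 1 ≤ e → e ≤ j → s'.arrs 25 e = 0) m 10 (by decide) (by decide) (by decide)
    ?_ ⟨hz₁, fun e h1 h2 => by omega⟩ (fun _ _ _ h => h) ?_) fun s₂ hS₂ _ h₂ => ?_).mono
      (T := 10 + ((10 + 10) * m + 10 + (120 * m + 50))) (by omega) fun _ _ _ h => h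
  · rw [hS₁.vars 11 (by decide), h11]
  · rintro j s' hS hB hj hij ⟨hz, hI⟩
    refine Run.block rfl rfl ?_
    simp [Cmd.wp, hij, hz]
    intro e h1 h2
    by_cases he : e = j + 1
    · subst he; simp
    · rw [Function.update_of_ne he]; exact hI e h1 (by omega)
  · have h24 : s₂.arrs 24 = s.arrs 24 := by rw [hS₂.arrs 24 (by decide), hS₁.arrs 24 (by decide)]
    have h11' : s₂.vars 11 = m := by rw [hS₂.vars 11 (by decide), hS₁.vars 11 (by decide), h11]
    have hun : uncoloured m (s₂.arrs 25) ≤ m := by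
      refine (Finset.card_filter_le _ _).trans ?_
      simp
    -- A single walk can be long, but all walks together colour each edge once; the term with
    -- `uncoloured` spreads their time over the rounds of the loop.
    refine RunT.mono (RunT.forUp (fun j k s' => s'.arrs 24 = s.arrs 24 ∧
      Proper (partner s) m (s'.arrs 25) ∧ Closed (partner s) m (fun _ _ => False) (s'.arrs 25) ∧
      (∀ e, 1 ≤ e → e ≤ j → s'.arrs 25 e ≠ 0) ∧
      k = 80 * (m - j) + 40 * uncoloured m (s'.arrs 25)) m (k := 80 * m + 40 * uncoloured m (s₂.arrs 25))
        (by decide) (by decide) (by decide)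
      h11' ⟨h24, ⟨h₂.1, fun e h1 h2 => by rw [h₂.2 e h1 h2]; omega,
        fun r hr e h1 h2 h3 h4 h5 => absurd (h₂.2 e h1 h2) h4⟩,
        fun r hr e h1 h2 h3 h4 h5 => absurd (h₂.2 e h1 h2) h3, fun e h1 h2 => by omega, rfl⟩
      (fun _ _ _ _ h => h) ?_) ?_
    · rintro j k s₃ hS₃ _ hj hij ⟨g24, gP, gC, gI, rfl⟩
      apply RunT.seq
      have a1 : Run M (.assign 24 (.var 20 + .const 1)) s₃ 4 fun s' =>
          s' = s₃.setVar 24 (j + 1) := Run.block rfl rfl (by simp [Cmd.wp, hij]; omega)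
      refine RunT.mono a1 ?_
      rintro s₄ t₄ _ _ ⟨ht₄, rfl⟩
      refine RunT.ite (by rfl) (fun hb => ?_) (fun hb => ?_)
      · have hb0 : s₃.arrs 25 (j + 1) = 0 := by simpa using hb
        obtain ⟨gP', gC'⟩ := gP.update hq (by omega) (by omega) hb0 gC
        have hu := uncoloured_update (m := m) (x := j + 1) (v := 1) (c := s₃.arrs 25)
          (by omega) (by omega) hb0 (by omega)
        apply RunT.seq
        have a2 : Run M (.store 25 (.var 24) (.const 1) ;;
            .assign 21 (.read 24 (.var 24 + .var 24)) ;; .assign 22 (.const 2) ;;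
            .assign 23 (.const 1)) (s₃.setVar 24 (j + 1)) 20 fun s' =>
            s'.arrs 24 = s.arrs 24 ∧ s'.arrs 25 = Function.update (s₃.arrs 25) (j + 1) 1 ∧
            s'.vars 21 = partner s 0 (j + 1) ∧ s'.vars 22 = 2 ∧ s'.vars 23 = 1 ∧
            s'.vars 24 = j + 1 :=
          Run.block rfl rfl (by simp [Cmd.wp, g24, partner])
        refine RunT.mono a2 ?_
        rintro s₅ t₅ _ _ ⟨ht₅, b24, b25, b21, b22, b23, bv24⟩
        have hps₅ : partner s₅ = partner s := by funext i e; simp [partner, b24]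
        apply RunT.seq
        -- The first walk leaves through side 0, and side 1 of the start edge is the only exemption.
        -- The second walk takes care of it and needs none.
        have w1 := gP'.walking (e := j + 1) (i := 1) (E := fun r a => r = 1 ∧ a = j + 1) hq
          (by omega) (by omega) (by simp) (by simp)
          (by rintro r e ⟨rfl, rfl⟩; simp) (by simpa using gC')
        refine RunT.mono (RunT.walk (M := M) (m := m) (E := fun r a => r = 1 ∧ a = j + 1)
          (s := s₅) (by rw [hps₅]; exact hq) (by rw [hps₅, b21, b22, b23, b25]; exact w1)) ?_
        rintro s₆ t₆ hS₆ _ ⟨c1, c2, c3, c4⟩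
        rw [hps₅] at c1 c2
        have c24 : s₆.arrs 24 = s.arrs 24 := by rw [hS₆.arrs 24 (by decide), b24]
        have cv24 : s₆.vars 24 = j + 1 := by rw [hS₆.vars 24 (by decide), bv24]
        have cj : s₆.arrs 25 (j + 1) = 1 := by rw [c3 _ (by simp [b25]), b25]; simp
        apply RunT.seq
        have a3 : Run M (.assign 21 (.read 24 (.var 24 + .var 24 + .const 1)) ;; .assign 22 (.const 2) ;;
            .assign 23 (.const 0)) s₆ 20 fun s' =>
            s'.arrs 24 = s.arrs 24 ∧ s'.arrs 25 = s₆.arrs 25 ∧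
            s'.vars 21 = partner s 1 (j + 1) ∧ s'.vars 22 = 2 ∧ s'.vars 23 = 0 :=
          Run.block rfl rfl (by simp [Cmd.wp, c24, cv24, partner])
        refine RunT.mono a3 ?_
        rintro s₇ t₇ _ _ ⟨ht₇, d24, d25, d21, d22, d23⟩
        have hps₇ : partner s₇ = partner s := by funext i e; simp [partner, d24]
        have w2 := c1.walking (e := j + 1) (i := 0) (E := fun _ _ => False) hq
          (by omega) (by omega) (by simp) cj (by simp) (by simpa [Closed] using c2)
        refine RunT.mono (RunT.walk (M := M) (m := m) (E := fun _ _ => False)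
          (s := s₇) (by rw [hps₇]; exact hq) (by rw [hps₇, d21, d22, d23, d25]; exact w2)) ?_
        rintro s₈ t₈ hS₈ _ ⟨e1, e2, e3, e4⟩
        rw [hps₇] at e1 e2
        rw [d25] at e3 e4
        rw [b25] at c3 c4
        refine ⟨_, ⟨by rw [hS₈.arrs 24 (by decide), d24], e1, e2, fun e h1 h2 => ?_, rfl⟩, ?_⟩
        · have h6 : s₆.arrs 25 e ≠ 0 := by
            by_cases he : e = j + 1
            · subst he; omega
            · have := gI e h1 (by omega)
              rw [c3 e (by rwa [Function.update_of_ne he]), Function.update_of_ne he]; exact this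
          rw [e3 e h6]; exact h6
        · simp [Test.cost, Expr.cost]; omega
      · have hb0 : s₃.arrs 25 (j + 1) ≠ 0 := by simpa using hb
        refine RunT.mono (Run.block (T := 1) rfl rfl (P := fun s' => s' = s₃.setVar 24 (j + 1)) rfl) ?_
        rintro s₅ t₅ _ _ ⟨ht₅, rfl⟩
        refine ⟨_, ⟨g24, gP, gC, fun e h1 h2 => ?_, rfl⟩, ?_⟩
        · by_cases he : e = j + 1
          · subst he; exact hb0
          · exact gI e h1 (by omega)
        · simp [Test.cost, Expr.cost]; omega
    · rintro s₃ t _ _ ⟨k, ⟨g24, gP, gC, gI, rfl⟩, hk⟩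
      refine ⟨by omega, fun e h1 h2 => ?_, fun i hi e h1 h2 h3 => ?_⟩
      · have := gP.le e h1 h2; have := gI e h1 h2; omega
      · have hqe := hq i hi e h1 h2
        exact gP.ne i hi e h1 h2 h3 (gI e h1 h2) (gI _ (by omega) (by omega))

end DynSkeleton

namespace DynSkeleton

variable {M : Machine}

/-! ### Halving the classes -/

/-- The number of edges with the endpoint `v` in `src` and the class `c`. -/
def classCount (src cl : ℕ → ℕ) (m v c : ℕ) : ℕ :=
  ((Finset.Icc 1 m).filter fun e => src e = v ∧ cl e = c).card

/-- The number of edges with the endpoint `v` in `src`. -/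
def totalCount (src : ℕ → ℕ) (m v : ℕ) : ℕ := ((Finset.Icc 1 m).filter fun e => src e = v).card

/-- After `i` rounds of halving, every class has about the fraction `1 / 2 ^ i` of the edges at
every node. -/
def Balanced (src cl : ℕ → ℕ) (m i : ℕ) : Prop :=
  ∀ v c, 2 ^ i ≤ c → c < 2 ^ (i + 1) →
    2 ^ i * classCount src cl m v c + 1 ≤ totalCount src m v + 2 ^ i ∧
    totalCount src m v + 1 ≤ 2 ^ i * classCount src cl m v c + 2 ^ i

/-- Taking partners maps the paired edges of colour `a` injectively to edges of colour `b` with the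
same key. At most one edge of this key has no partner, hence the `+ 1`. -/
theorem KeyPairing.card_le {k q c : ℕ → ℕ} {m κ a b : ℕ} (h : KeyPairing k m q)
    (hc : ∀ e, 1 ≤ e → e ≤ m → q e ≠ 0 → c e = a → c (q e) = b) :
    ((Finset.Icc 1 m).filter fun e => k e = κ ∧ c e = a).card ≤
      ((Finset.Icc 1 m).filter fun e => k e = κ ∧ c e = b).card + 1 := by
  classical
  set A := (Finset.Icc 1 m).filter fun e => k e = κ ∧ c e = a with hA
  rw [← Finset.card_filter_add_card_filter_not (s := A) (p := fun e => q e ≠ 0)]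
  apply Nat.add_le_add
  · apply Finset.card_le_card_of_injOn q
    · intro e he
      simp [hA] at he ⊢
      obtain ⟨⟨⟨h1, h2⟩, h3, h4⟩, h5⟩ := he
      have := h.pairing e h1 h2
      exact ⟨by omega, by rw [h.key e h1 h2 h5, h3], hc e h1 h2 h5 h4⟩
    · intro e he e' he' hee
      simp [hA] at he he'
      have h1 := h.pairing e he.1.1.1 he.1.1.2
      have h2 := h.pairing e' he'.1.1.1 he'.1.1.2
      rcases h1 with h1 | h1
      · exact absurd h1 he.2
      rcases h2 with h2 | h2
      · exact absurd h2 he'.2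
      rw [← h1.2.2.2, hee, h2.2.2.2]
  · rw [Finset.card_le_one]
    intro e he e' he'
    simp [hA] at he he'
    exact h.unique e e' he.1.1.1 he.1.1.2 he'.1.1.1 he'.1.1.2 he.2 he'.2 (by omega)

/-- Twice the size of a half differs from the size of the class by at most 1, at every node. The
error therefore grows from 2^i - 1 to at most 2^i - 1 + 2^i = 2^(i+1) - 1. Class c splits into 2c
and 2c + 1, so the classes after i rounds are the numbers with i + 1 binary digits. -/
theorem Balanced.halve {src cl cl' q col : ℕ → ℕ} {m m₈ i : ℕ} (h : Balanced src cl m i)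
    (hcl : ∀ e, 1 ≤ e → e ≤ m → cl e < m₈) (hi : 2 ^ (i + 1) ≤ m₈)
    (hq : KeyPairing (fun e => src e * m₈ + cl e) m q)
    (hcol : ∀ e, 1 ≤ e → e ≤ m → col e = 1 ∨ col e = 2)
    (hne : ∀ e, 1 ≤ e → e ≤ m → q e ≠ 0 → col (q e) ≠ col e)
    (hcl' : ∀ e, 1 ≤ e → e ≤ m → cl' e = cl e + cl e + col e - 1) :
    Balanced src cl' m (i + 1) := by
  classical
  intro v c' h1 h2
  have h3 : 2 ^ (i + 1) = 2 * 2 ^ i := by ring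
  have h4 : 2 ^ (i + 1 + 1) = 2 * 2 ^ (i + 1) := by ring
  obtain ⟨c, b, rfl, hb⟩ : ∃ c b, c' = 2 * c + b ∧ b < 2 := ⟨c' / 2, c' % 2, by omega, by omega⟩
  obtain ⟨h5, h6⟩ := h v c (by omega) (by omega)
  have hcard : ∀ a, ((Finset.Icc 1 m).filter fun e => src e * m₈ + cl e = v * m₈ + c ∧ col e = a) =
      (Finset.Icc 1 m).filter fun e => (src e = v ∧ cl e = c) ∧ col e = a := by
    intro a
    apply Finset.filter_congr
    intro e he
    simp at he
    rw [index_inj (hcl e he.1 he.2) (by omega)]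
  have hswap : ∀ a b, (a = 1 ∧ b = 2 ∨ a = 2 ∧ b = 1) → ∀ e, 1 ≤ e → e ≤ m → q e ≠ 0 →
      col e = a → col (q e) = b := by
    intro a b hab e h1 h2 h3 h4
    have h5 := hne e h1 h2 h3
    have h6 := hq.pairing e h1 h2
    have h7 := hcol (q e) (by omega) (by omega)
    omega
  have h12 := hq.card_le (κ := v * m₈ + c) (hswap 1 2 (by simp))
  have h21 := hq.card_le (κ := v * m₈ + c) (hswap 2 1 (by simp))
  rw [hcard, hcard] at h12 h21
  have hsum : classCount src cl m v c =
      ((Finset.Icc 1 m).filter fun e => (src e = v ∧ cl e = c) ∧ col e = 1).card +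
      ((Finset.Icc 1 m).filter fun e => (src e = v ∧ cl e = c) ∧ col e = 2).card := by
    rw [classCount, ← Finset.card_filter_add_card_filter_not (p := fun e => col e = 1),
      Finset.filter_filter, Finset.filter_filter]
    congr 2
    apply Finset.filter_congr
    intro e he
    simp at he
    have := hcol e he.1 he.2
    constructor <;> rintro ⟨g1, g2⟩ <;> exact ⟨g1, by omega⟩
  have hnew : classCount src cl' m v (2 * c + b) =
      ((Finset.Icc 1 m).filter fun e => (src e = v ∧ cl e = c) ∧ col e = b + 1).card := by
    rw [classCount]
    congr 1
    apply Finset.filter_congr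
    intro e he
    simp at he
    have := hcol e he.1 he.2
    have := hcl' e he.1 he.2
    constructor
    · rintro ⟨g1, g2⟩; exact ⟨⟨g1, by omega⟩, by omega⟩
    · rintro ⟨⟨g1, g2⟩, g3⟩; exact ⟨g1, by omega⟩
  have hN : 2 * classCount src cl' m v (2 * c + b) ≤ classCount src cl m v c + 1 ∧
      classCount src cl m v c ≤ 2 * classCount src cl' m v (2 * c + b) + 1 := by
    rw [hnew]
    rcases (by omega : b = 0 ∨ b = 1) with rfl | rfl <;> simp only [zero_add, Nat.reduceAdd] <;> omega
  have g1 := Nat.mul_le_mul_left (2 ^ i) hN.1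
  have g2 := Nat.mul_le_mul_left (2 ^ i) hN.2
  rw [h3]
  ring_nf at g1 g2 h5 h6 ⊢
  omega

/-- The state after `i` rounds of halving. -/
structure Split (n m i : ℕ) (s : Memory) : Prop where
  size : s.vars 8 = n ^ 3
  count : s.vars 11 = m
  tail_lt : ∀ e, 1 ≤ e → e ≤ m → s.arrs 18 e < n
  head_lt : ∀ e, 1 ≤ e → e ≤ m → s.arrs 19 e < n
  class_ge : ∀ e, 1 ≤ e → e ≤ m → 2 ^ i ≤ s.arrs 20 e
  class_lt : ∀ e, 1 ≤ e → e ≤ m → s.arrs 20 e < 2 ^ (i + 1)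
  tails : Balanced (s.arrs 18) (s.arrs 20) m i
  heads : Balanced (s.arrs 19) (s.arrs 20) m i
  waiting : ∀ x, s.arrs 26 x = 0

theorem Run.refine {m : ℕ} {s : Memory} (h11 : s.vars 11 = m) (hm : m < M.Q)
    (hQ : ∀ e, 1 ≤ e → e ≤ m → s.arrs 20 e + s.arrs 20 e + s.arrs 25 e ≤ M.Q) :
    Run M Cmd.refine s (40 * m + 10) fun s' => ∀ e, 1 ≤ e → e ≤ m →
      s'.arrs 20 e = s.arrs 20 e + s.arrs 20 e + s.arrs 25 e - 1 := by
  refine (Run.forUp (fun j s' => (∀ e, 1 ≤ e → e ≤ j →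
      s'.arrs 20 e = s.arrs 20 e + s.arrs 20 e + s.arrs 25 e - 1) ∧
      ∀ e, j < e → s'.arrs 20 e = s.arrs 20 e) m 30 (by decide) (by decide) (by decide) h11
      ⟨fun e h1 h2 => by omega, fun _ _ => rfl⟩ (fun _ _ _ h => h) ?_).mono (by omega)
      fun _ _ _ h => h.1
  rintro j s' hS hB hj hij ⟨h1, h2⟩
  have h25 : s'.arrs 25 = s.arrs 25 := hS.arrs 25 (by decide)
  refine Run.block rfl rfl ?_
  simp [Cmd.wp, hij, h25, h2 (j + 1) (by omega)]
  refine ⟨by omega, Or.inl (hQ (j + 1) (by omega) (by omega)), fun e h3 h4 => ?_, fun e h3 => ?_⟩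
  · by_cases he : e = j + 1
    · subst he; simp
    · rw [Function.update_of_ne he, h1 e h3 (by omega)]
  · rw [Function.update_of_ne (by omega), h2 e (by omega)]

theorem Run.halve {n m i : ℕ} {s : Memory} (h : Split n m i s) (hi : 2 ^ (i + 1) ≤ n ^ 3)
    (hm : m < n ^ 3) (hn : 4 ≤ n) (hQ : n ^ 8 ≤ M.Q) :
    Run M Cmd.halve s (600 * m + 200) (Split n m (i + 1)) := by
  have hQ1 : n * n ^ 3 ≤ n ^ 8 := by
    calc n * n ^ 3 = n ^ 4 := by ring
      _ ≤ n ^ 8 := Nat.pow_le_pow_right (by omega) (by omega)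
  have hQ2 : n ^ 3 * 4 ≤ n * n ^ 3 := by rw [mul_comm]; exact Nat.mul_le_mul_right _ hn
  have hmQ : m < M.Q := by omega
  have hkey : ∀ {a c : ℕ}, a < n → c < 2 ^ (i + 1) → a * n ^ 3 + c ≤ M.Q := by
    intro a c ha hc
    have : (a + 1) * n ^ 3 ≤ n * n ^ 3 := Nat.mul_le_mul_right _ ha
    rw [Nat.add_mul] at this
    omega
  have hfun : ∀ {s' : Memory} {src : ℕ}, s'.vars 8 = s.vars 8 → s'.arrs src = s.arrs src →
      s'.arrs 20 = s.arrs 20 → edgeKey s' src = fun e => s.arrs src e * n ^ 3 + s.arrs 20 e := by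
    intro s' src h1 h2 h3; funext e; rw [edgeKey, h1, h2, h3, h.size]
  have hk18 := hfun (s' := s) (src := 18) rfl rfl rfl
  refine (Run.seq (Run.pairUp (src := 18) (side := 0) (m := m) (by decide) (by decide) (by decide)
    h.count (by
      rw [hk18]; exact fun e h1 h2 => hkey (h.tail_lt e h1 h2) (h.class_lt e h1 h2)) hmQ h.waiting)
    fun s₁ hS₁ _ h₁ => ?_).mono (T := 100 * m + 10 + (40 * m + 10 + (100 * m + 10 +
      (40 * m + 10 + (200 * m + 100 + (40 * m + 10)))))) (by omega) fun _ _ _ h => h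
  have e1 : edgeKey s₁ 18 = edgeKey s 18 := by
    rw [hk18]; exact hfun (hS₁.vars 8 (by decide)) (hS₁.arrs 18 (by decide)) (hS₁.arrs 20 (by decide))
  refine Run.seq (Run.unpair (m := m) (by decide) (by rw [hS₁.vars 11 (by decide), h.count]) hmQ ?_)
    fun s₂ hS₂ _ h₂ => ?_
  · intro x hx
    obtain ⟨g1, g2, g3⟩ := h₁.1.waiting x hx
    exact ⟨_, Nat.one_le_iff_ne_zero.2 hx, g1, by rw [e1, g2]⟩
  have hS₁₂ := hS₁.trans hS₂
  have hk19 := hfun (s' := s₂) (src := 19) (hS₁₂.vars 8 (by decide)) (hS₁₂.arrs 19 (by decide))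
    (hS₁₂.arrs 20 (by decide))
  refine Run.seq (Run.pairUp (src := 19) (side := 1) (m := m) (by decide) (by decide) (by decide)
    (by rw [hS₁₂.vars 11 (by decide), h.count]) (by
      rw [hk19]; exact fun e h1 h2 => hkey (h.head_lt e h1 h2) (h.class_lt e h1 h2)) hmQ h₂)
    fun s₃ hS₃ _ h₃ => ?_
  have hS₁₃ := hS₁₂.trans hS₃
  have e3 : edgeKey s₃ 19 = edgeKey s₂ 19 := by
    rw [hk19]; exact hfun (hS₁₃.vars 8 (by decide)) (hS₁₃.arrs 19 (by decide))
      (hS₁₃.arrs 20 (by decide))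
  refine Run.seq (Run.unpair (m := m) (by decide) (by rw [hS₁₃.vars 11 (by decide), h.count]) hmQ ?_)
    fun s₄ hS₄ _ h₄ => ?_
  · intro x hx
    obtain ⟨g1, g2, g3⟩ := h₃.1.waiting x hx
    exact ⟨_, Nat.one_le_iff_ne_zero.2 hx, g1, by rw [e3, g2]⟩
  have hS₁₄ := hS₁₃.trans hS₄
  -- The pairing by heads writes only to odd cells, so the pairing by tails survives in the even
  -- ones.
  have hp0 : partner s₄ 0 = fun e => s₁.arrs 24 (e + e + 0) := by
    funext e
    rw [partner, hS₄.arrs 24 (by decide), h₃.2 _ (by omega), hS₂.arrs 24 (by decide)]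
  have hp1 : partner s₄ 1 = fun e => s₃.arrs 24 (e + e + 1) := by
    funext e
    rw [partner, hS₄.arrs 24 (by decide)]
  have k0 : KeyPairing (fun e => s.arrs 18 e * n ^ 3 + s.arrs 20 e) m (partner s₄ 0) := by
    rw [hp0, ← hk18]; exact h₁.1.keyPairing
  have k1 : KeyPairing (fun e => s.arrs 19 e * n ^ 3 + s.arrs 20 e) m (partner s₄ 1) := by
    rw [hp1, ← hk19]; exact h₃.1.keyPairing
  refine Run.seq (Run.colour (m := m) (by rw [hS₁₄.vars 11 (by decide), h.count]) hmQ ?_)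
    fun s₅ hS₅ _ h₅ => ?_
  · intro r hr
    rcases (by omega : r = 0 ∨ r = 1) with rfl | rfl
    · exact k0.pairing
    · exact k1.pairing
  have hS₁₅ := hS₁₄.trans hS₅
  have h20 : s₅.arrs 20 = s.arrs 20 := hS₁₅.arrs 20 (by decide)
  have hlt3 : ∀ e, 1 ≤ e → e ≤ m → s.arrs 20 e < n ^ 3 := fun e h1 h2 =>
    lt_of_lt_of_le (h.class_lt e h1 h2) hi
  refine (Run.refine (m := m) (by rw [hS₁₅.vars 11 (by decide), h.count]) hmQ ?_).mono le_rfl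
    fun s₆ hS₆ _ h₆ => ?_
  · intro e h1 h2
    have := hlt3 e h1 h2
    have := h₅.mem e h1 h2
    rw [h20]
    omega
  have hS := hS₁₅.trans hS₆
  have f18 : s₆.arrs 18 = s.arrs 18 := hS.arrs 18 (by decide)
  have f19 : s₆.arrs 19 = s.arrs 19 := hS.arrs 19 (by decide)
  rw [h20] at h₆
  have hp : (2 : ℕ) ^ (i + 1) = 2 * 2 ^ i := by ring
  have hp' : (2 : ℕ) ^ (i + 1 + 1) = 2 * 2 ^ (i + 1) := by ring
  exact
    { size := by rw [hS.vars 8 (by decide), h.size]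
      count := by rw [hS.vars 11 (by decide), h.count]
      tail_lt := by rw [f18]; exact h.tail_lt
      head_lt := by rw [f19]; exact h.head_lt
      class_ge := fun e h1 h2 => by
        have := h.class_ge e h1 h2
        have := h₅.mem e h1 h2
        rw [h₆ e h1 h2]; omega
      class_lt := fun e h1 h2 => by
        have := h.class_lt e h1 h2
        have := h₅.mem e h1 h2
        rw [h₆ e h1 h2]; omega
      tails := by
        rw [f18]
        exact h.tails.halve hlt3 hi k0 h₅.mem (h₅.ne 0 (by omega)) h₆
      heads := by
        rw [f19]
        exact h.heads.halve hlt3 hi k1 h₅.mem (h₅.ne 1 (by omega)) h₆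
      waiting := by rw [hS₆.arrs 26 (by decide), hS₅.arrs 26 (by decide)]; exact h₄ }

theorem Run.split {n m r : ℕ} {s : Memory} (h : Split n m 0 s) (h6 : s.vars 6 = r)
    (hr : 2 ^ (r + 1) ≤ n ^ 3) (hm : m < n ^ 3) (hn : 4 ≤ n) (hQ : n ^ 8 ≤ M.Q) :
    Run M (.forUp 27 6 .halve) s ((600 * m + 210) * r + 10) (Split n m r) := by
  refine (Run.forUp (fun i s' => Split n m i s') r (600 * m + 200) (by decide) (by decide)
    (by decide) h6 h ?_ ?_).mono le_rfl fun _ _ _ h => h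
  · rintro i s v ⟨h1, h2, h3, h4, h5, h6, h7, h8, h9⟩
    exact ⟨h1, h2, h3, h4, h5, h6, h7, h8, h9⟩
  · intro i s' _ _ hi _ h'
    exact Run.halve h' (le_trans (Nat.pow_le_pow_right (by omega) (by omega)) hr) hm hn hQ

end DynSkeleton

namespace DynSkeleton

variable {M : Machine}

/-! ### The parts of a rebuild -/

/-- The family whose only set that may be nonempty is the set number `0`. -/
def single (S : Finset ℕ) : ℕ → Finset ℕ := fun b => if b = 0 then S else ∅

@[simp] theorem single_zero (S : Finset ℕ) : single S 0 = S := rfl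

@[simp] theorem update_single (S T : Finset ℕ) : Function.update (single S) 0 T = single T := by
  funext b
  by_cases hb : b = 0
  · subst hb; simp
  · simp [hb, single]

theorem SetFam.clear {m : ℕ} {A P l : ℕ → ℕ} {S : Finset ℕ} (h : SetFam m A P l (single S)) :
    SetFam m A P (Function.update l 0 0) (single ∅) := by
  refine h.of_card fun b => ?_
  by_cases hb : b = 0
  · subst hb; simp
  · simp [hb, single]

/-- The elements of a set of a family in the order of the list. -/
theorem SetFam.image_range {m : ℕ} {A P l : ℕ → ℕ} {F : ℕ → Finset ℕ} (h : SetFam m A P l F) (b : ℕ) :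
    (Finset.range (F b).card).image (fun i => A (b * m + i)) = F b := by
  ext x
  simp only [Finset.mem_image, Finset.mem_range]
  constructor
  · rintro ⟨i, hi, rfl⟩; exact h.mem b i hi
  · intro hx
    obtain ⟨i, hi, h1, _⟩ := h.pos b x hx
    exact ⟨i, hi, h1⟩

theorem SetFam.notMem_image {m : ℕ} {A P l : ℕ → ℕ} {F : ℕ → Finset ℕ} (h : SetFam m A P l F)
    {b j : ℕ} (hj : j < (F b).card) :
    A (b * m + j) ∉ (Finset.range j).image (fun i => A (b * m + i)) := by
  simp only [Finset.mem_image, Finset.mem_range, not_exists, not_and]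
  intro i hi he
  have := h.inj (b := b) (i := i) (j := j) (by omega) hj he
  omega

theorem image_range_succ (f : ℕ → ℕ) (j : ℕ) :
    (Finset.range (j + 1)).image f = insert (f j) ((Finset.range j).image f) := by
  rw [Finset.range_add_one, Finset.image_insert]

/-- The tables are too large to be cleared cell by cell. Every nonzero cell is named by the
endpoints or the class of an edge of the old phase, so a loop over these edges reaches all of them.
-/
theorem Run.cleanup {m r : ℕ} {s : Memory} (h8 : s.vars 8 = r) (h11 : s.vars 11 = m)
    (hm : m < M.Q)
    (h21 : ∀ x, s.arrs 21 x ≠ 0 → ∃ e, 1 ≤ e ∧ e ≤ m ∧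
      (x = s.arrs 18 e * r + s.arrs 19 e ∨ x = s.arrs 19 e * r + s.arrs 18 e))
    (h22 : ∀ x, s.arrs 22 x ≠ 0 → ∃ e, 1 ≤ e ∧ e ≤ m ∧
      (x = s.arrs 18 e * r + s.arrs 20 e ∨ x = s.arrs 19 e * r + s.arrs 20 e))
    (h23 : ∀ x, s.arrs 23 x ≠ 0 → ∃ e, 1 ≤ e ∧ e ≤ m ∧ x = s.arrs 20 e)
    (h16 : ∀ x, s.arrs 16 x ≠ 0 → ∃ e, 1 ≤ e ∧ e ≤ m ∧ x = s.arrs 20 e) :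
    Run M Cmd.cleanup s (100 * m + 10) fun s' => (∀ x, s'.arrs 21 x = 0) ∧ (∀ x, s'.arrs 22 x = 0) ∧
      (∀ x, s'.arrs 23 x = 0) ∧ ∀ x, s'.arrs 16 x = 0 := by
  refine (Run.forUp (fun j s' =>
    (∀ x, s'.arrs 21 x ≠ 0 → ∃ e, j < e ∧ e ≤ m ∧
      (x = s.arrs 18 e * r + s.arrs 19 e ∨ x = s.arrs 19 e * r + s.arrs 18 e)) ∧
    (∀ x, s'.arrs 22 x ≠ 0 → ∃ e, j < e ∧ e ≤ m ∧
      (x = s.arrs 18 e * r + s.arrs 20 e ∨ x = s.arrs 19 e * r + s.arrs 20 e)) ∧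
    (∀ x, s'.arrs 23 x ≠ 0 → ∃ e, j < e ∧ e ≤ m ∧ x = s.arrs 20 e) ∧
    (∀ x, s'.arrs 16 x ≠ 0 → ∃ e, j < e ∧ e ≤ m ∧ x = s.arrs 20 e)) m 80 (by decide) (by decide)
    (by decide) h11 ⟨h21, h22, h23, h16⟩ (fun _ _ _ h => h) ?_).mono (by omega) ?_
  · rintro j s' hS hB hj hij ⟨g21, g22, g23, g16⟩
    have v8 : s'.vars 8 = r := by rw [hS.vars 8 (by decide), h8]
    have f18 : s'.arrs 18 = s.arrs 18 := hS.arrs 18 (by decide)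
    have f19 : s'.arrs 19 = s.arrs 19 := hS.arrs 19 (by decide)
    have f20 : s'.arrs 20 = s.arrs 20 := hS.arrs 20 (by decide)
    refine Run.block rfl rfl ?_
    simp only [Cmd.wp, Expr.fits_add, Expr.fits_read, Expr.fits_const, Expr.val_add, Expr.val_var,
      Expr.val_const, Expr.val_read, Expr.val_mul, Memory.setVar_vars, Memory.setVar_arrs,
      Memory.setArr_vars, Memory.setArr_arrs, true_and, ne_eq, Nat.reduceEqDiff, not_false_eq_true,
      Function.update_of_ne, Function.update_self, hij, v8, f18, f19, f20]
    refine ⟨by omega, fun x hx => ?_, fun x hx => ?_, fun x hx => ?_, fun x hx => ?_⟩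
    · by_cases e1 : x = s.arrs 19 (j + 1) * r + s.arrs 18 (j + 1)
      · exact absurd (by rw [e1, Function.update_self]) hx
      rw [Function.update_of_ne e1] at hx
      by_cases e2 : x = s.arrs 18 (j + 1) * r + s.arrs 19 (j + 1)
      · exact absurd (by rw [e2, Function.update_self]) hx
      rw [Function.update_of_ne e2] at hx
      obtain ⟨e, h1, h2, h3⟩ := g21 x hx
      have : e ≠ j + 1 := by rintro rfl; exact h3.elim e2 e1
      exact ⟨e, by omega, h2, h3⟩
    · by_cases e1 : x = s.arrs 19 (j + 1) * r + s.arrs 20 (j + 1)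
      · exact absurd (by rw [e1, Function.update_self]) hx
      rw [Function.update_of_ne e1] at hx
      by_cases e2 : x = s.arrs 18 (j + 1) * r + s.arrs 20 (j + 1)
      · exact absurd (by rw [e2, Function.update_self]) hx
      rw [Function.update_of_ne e2] at hx
      obtain ⟨e, h1, h2, h3⟩ := g22 x hx
      have : e ≠ j + 1 := by rintro rfl; exact h3.elim e2 e1
      exact ⟨e, by omega, h2, h3⟩
    · by_cases e1 : x = s.arrs 20 (j + 1)
      · exact absurd (by rw [e1, Function.update_self]) hx
      rw [Function.update_of_ne e1] at hx
      obtain ⟨e, h1, h2, h3⟩ := g23 x hx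
      have : e ≠ j + 1 := by rintro rfl; exact e1 h3
      exact ⟨e, by omega, h2, h3⟩
    · by_cases e1 : x = s.arrs 20 (j + 1)
      · exact absurd (by rw [e1, Function.update_self]) hx
      rw [Function.update_of_ne e1] at hx
      obtain ⟨e, h1, h2, h3⟩ := g16 x hx
      have : e ≠ j + 1 := by rintro rfl; exact e1 h3
      exact ⟨e, by omega, h2, h3⟩
  · rintro s' _ _ ⟨g21, g22, g23, g16⟩
    refine ⟨fun x => ?_, fun x => ?_, fun x => ?_, fun x => ?_⟩ <;> by_contra hx
    · obtain ⟨e, h1, h2, _⟩ := g21 x hx; omega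
    · obtain ⟨e, h1, h2, _⟩ := g22 x hx; omega
    · obtain ⟨e, h1, h2, _⟩ := g23 x hx; omega
    · obtain ⟨e, h1, h2, _⟩ := g16 x hx; omega

/-- The flags of the elements of `B` are `1`. -/
def flag (B : Finset ℕ) (v : ℕ) : ℕ := if v ∈ B then 1 else 0

theorem update_flag_insert (B : Finset ℕ) (v : ℕ) :
    Function.update (flag B) v 1 = flag (insert v B) := by
  funext w
  by_cases h : w = v
  · subst h; simp [flag]
  · simp [flag, h]

theorem update_flag_erase (B : Finset ℕ) (v : ℕ) :
    Function.update (flag B) v 0 = flag (B.erase v) := by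
  funext w
  by_cases h : w = v
  · subst h; simp [flag]
  · simp [flag, h]

-- The test compares the degree with 2 ε d / L², midway between the bounds for the two sides of a
-- skeleton, so that a clean node may drift in both directions before its side has to be revised.
open Classical in
theorem Run.reclassify {r : ℕ} {D B : Finset ℕ} {s : Memory} {big : ℕ → Prop}
    (h8 : s.vars 8 = r) (hr : r + 1 ≤ M.Q)
    (hD : SetFam r (s.arrs 5) (s.arrs 6) (s.arrs 7) (single D))
    (hB : SetFam r (s.arrs 8) (s.arrs 9) (s.arrs 10) (single B)) (hDB : Disjoint D B)
    (hflag : s.arrs 27 = flag B)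
    (hbig : ∀ v, big v ↔ ¬ (((s.arrs 4 v * (s.vars 5 * s.vars 5) : ℕ) : ℝ) ≤
      M.θ 0 * ((2 * s.vars 4 : ℕ) : ℝ))) :
    Run M Cmd.reclassify s (100 * D.card + 30) fun s' =>
      SetFam r (s'.arrs 5) (s'.arrs 6) (s'.arrs 7) (single ∅) ∧
      SetFam r (s'.arrs 8) (s'.arrs 9) (s'.arrs 10) (single (B ∪ D.filter big)) ∧
      s'.arrs 27 = flag (B ∪ D.filter big) ∧
      ∀ v, s'.arrs 17 v = if v ∈ D then 0 else s.arrs 17 v := by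
  have hc : s.arrs 7 0 = D.card := by simpa using hD.card 0
  have h1 : Run M (.assign 25 (.read 7 (.const 0))) s 10 fun s' => s' = s.setVar 25 D.card :=
    Run.block rfl rfl (by simp [Cmd.wp, hc])
  have hlt : ∀ v ∈ D, v < r := fun v hv => hD.lt 0 v (by simpa using hv)
  have hmem : ∀ i, i < D.card → s.arrs 5 i ∈ D := fun i hi => by simpa using hD.mem 0 i (by simpa using hi)
  set E : ℕ → Finset ℕ := fun j => (Finset.range j).image (s.arrs 5) with hE
  have hEsub : ∀ j, j ≤ D.card → E j ⊆ D := by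
    intro j hj x hx
    simp only [hE, Finset.mem_image, Finset.mem_range] at hx
    obtain ⟨i, hi, rfl⟩ := hx
    exact hmem i (by omega)
  have hEtop : E D.card = D := by simpa [hE] using hD.image_range 0
  refine (Run.seq h1 ?_).mono (T := 10 + ((80 + 10) * D.card + 10 + 10)) (by omega) fun _ _ _ h => h
  rintro s₁ hS₁ _ rfl
  refine Run.seq (Run.forUp (fun j s' => SetFam r (s'.arrs 8) (s'.arrs 9) (s'.arrs 10)
      (single (B ∪ (E j).filter big)) ∧ s'.arrs 27 = flag (B ∪ (E j).filter big) ∧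
      ∀ v, s'.arrs 17 v = if v ∈ E j then 0 else s.arrs 17 v) D.card 80
      (by decide) (by decide) (by decide) (by simp) ⟨by simpa [hE] using hB, by simpa [hE] using hflag,
        by simp [hE]⟩ (fun _ _ _ h => h) ?_) ?_
  · rintro j s' hS hB' hj hij ⟨g1, g2, g3⟩
    have f5 : s'.arrs 5 = s.arrs 5 := hS.arrs 5 (by decide)
    have f4 : s'.arrs 4 = s.arrs 4 := hS.arrs 4 (by decide)
    have v8 : s'.vars 8 = r := by rw [hS.vars 8 (by decide)]; simpa using h8
    have v5 : s'.vars 5 = s.vars 5 := by rw [hS.vars 5 (by decide)]; simp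
    have v4 : s'.vars 4 = s.vars 4 := by rw [hS.vars 4 (by decide)]; simp
    set v := s.arrs 5 j with hv
    have hvD : v ∈ D := hmem j hj
    have hEs : E (j + 1) = insert v (E j) := image_range_succ _ _
    have hvE : v ∉ E j := by simpa [hE] using hD.notMem_image (b := 0) (j := j) (by simpa using hj)
    have hvB : v ∉ B := fun h => Finset.disjoint_left.1 hDB hvD h
    have g3' : ∀ w, Function.update (s'.arrs 17) v 0 w =
        if w ∈ E (j + 1) then 0 else s.arrs 17 w := by
      intro w
      by_cases hw : w = v
      · rw [hw, hEs]; simp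
      · rw [Function.update_of_ne hw, g3 w, hEs]; simp [hw]
    refine (Run.seq (P₁ := fun s'' => s'' = s'.setVar 15 v) (T₁ := 10) (T₂ := 70)
      (Run.block rfl rfl (by simp [Cmd.wp, hij, f5, hv])) ?_).mono (by omega) fun _ _ _ h => h
    rintro s₂ _ _ rfl
    refine (Run.seq (P₁ := fun s'' => s'' = (s'.setVar 15 v).setArr 17 v 0) (T₁ := 5) (T₂ := 65)
      (Run.block rfl rfl (by simp [Cmd.wp])) ?_).mono (by omega) fun _ _ _ h => h
    rintro s₃ _ _ rfl
    refine (Run.ite (T := 50) rfl (fun hb => ?_) (fun hb => ?_)).mono (by decide) fun _ _ _ h => h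
    · have hnb : ¬ big v := by
        rw [hbig]; simpa [f4, v5, v4] using hb
      have hfe : (E (j + 1)).filter big = (E j).filter big := by
        rw [hEs, Finset.filter_insert, if_neg hnb]
      refine Run.block rfl rfl ?_
      simp only [Cmd.wp]
      rw [hfe]
      exact ⟨by simpa using g1, by simpa using g2, by simpa using g3'⟩
    · have hnb : big v := by
        rw [hbig]; simpa [f4, v5, v4] using hb
      have hfe : B ∪ (E (j + 1)).filter big = insert v (B ∪ (E j).filter big) := by
        rw [hEs, Finset.filter_insert, if_pos hnb, Finset.union_insert]
      refine (Run.seq (P₁ := fun s'' => s'' = ((s'.setVar 15 v).setArr 17 v 0).setVar 14 0) (T₁ := 5)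
        (T₂ := 45) (Run.block rfl rfl (by simp [Cmd.wp])) ?_).mono (by omega) fun _ _ _ h => h
      rintro s₄ _ _ rfl
      refine (Run.seq (T₂ := 10) (Run.setInsert (m := r) (b := 0) (x := v)
        (F := single (B ∪ (E j).filter big)) (by decide) (by decide) (by decide) (by simpa using g1)
        (by simpa using v8) (by simp) (by simp) (hlt v hvD) (by simp [hvE, hvB]) hr) ?_).mono (by omega)
        fun _ _ _ h => h
      rintro s₅ hS₅ _ ⟨k1, -, -⟩
      have f27 : s₅.arrs 27 = s'.arrs 27 := by rw [hS₅.arrs 27 (by decide)]; simp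
      have f17 : s₅.arrs 17 = Function.update (s'.arrs 17) v 0 := by
        rw [hS₅.arrs 17 (by decide)]; simp
      have f15 : s₅.vars 15 = v := by rw [hS₅.vars 15 (by decide)]; simp
      refine Run.block rfl rfl ?_
      simp only [single_zero, update_single] at k1
      simp [Cmd.wp, f15, f17, f27]
      rw [hfe, g2, update_flag_insert]
      exact ⟨k1, rfl, g3'⟩
  · rintro s₂ hS₂ _ ⟨g1, g2, g3⟩
    rw [hEtop] at g1 g2 g3
    refine Run.block rfl rfl ?_
    have f5 : s₂.arrs 5 = s.arrs 5 := by rw [hS₂.arrs 5 (by decide)]; rfl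
    have f6 : s₂.arrs 6 = s.arrs 6 := by rw [hS₂.arrs 6 (by decide)]; rfl
    have f7 : s₂.arrs 7 = s.arrs 7 := by rw [hS₂.arrs 7 (by decide)]; rfl
    simp [Cmd.wp, f5, f6, f7]
    exact ⟨hD.clear, g1, g2, g3⟩

/-! ### Collecting the edges of a phase -/

/-- The neighbourhoods of a graph on `{0, …, n - 1}` with degrees at most `d`. -/
structure Neighbours (n d : ℕ) (N : ℕ → Finset ℕ) : Prop where
  lt : ∀ v, ∀ w ∈ N v, w < n
  ne : ∀ v, ∀ w ∈ N v, w ≠ v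
  symm : ∀ v, ∀ w ∈ N v, v ∈ N w
  card : ∀ v, (N v).card ≤ d

/-- The table `id` contains the numbers of the edges `1, …, m` with the endpoints `a` and `b`. -/
structure EdgeTable (N : ℕ → Finset ℕ) (r m : ℕ) (a b id : ℕ → ℕ) : Prop where
  adj : ∀ e, 1 ≤ e → e ≤ m → b e ∈ N (a e)
  id_left : ∀ e, 1 ≤ e → e ≤ m → id (a e * r + b e) = e
  id_right : ∀ e, 1 ≤ e → e ≤ m → id (b e * r + a e) = e
  support : ∀ x, id x ≠ 0 → id x ≤ m ∧
    (x = a (id x) * r + b (id x) ∨ x = b (id x) * r + a (id x))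

theorem EdgeTable.add {n d r m u w : ℕ} {N : ℕ → Finset ℕ} {a b id : ℕ → ℕ}
    (h : EdgeTable N r m a b id) (hN : Neighbours n d N) (hnr : n ≤ r) (hw : w ∈ N u)
    (hid : id (u * r + w) = 0) :
    EdgeTable N r (m + 1) (Function.update a (m + 1) u) (Function.update b (m + 1) w)
      (Function.update (Function.update id (u * r + w) (m + 1)) (w * r + u) (m + 1)) := by
  have hlt : ∀ v, ∀ z ∈ N v, z < r := fun v z hz => lt_of_lt_of_le (hN.lt v z hz) hnr
  have hur := hlt w u (hN.symm u w hw)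
  have hwr := hlt u w hw
  -- The table is symmetric: an edge stored in the reversed cell would also be stored in the cell
  -- that is known to be empty.
  have hid' : id (w * r + u) = 0 := by
    by_contra h0
    obtain ⟨h1, h2⟩ := h.support _ h0
    have hpos : 1 ≤ id (w * r + u) := Nat.one_le_iff_ne_zero.2 h0
    have hadj := h.adj _ hpos h1
    have ha := hlt _ _ (hN.symm _ _ hadj)
    have hb := hlt _ _ hadj
    rcases h2 with h2 | h2
    · rw [index_inj hur hb] at h2
      have := h.id_right _ hpos h1
      rw [← h2.1, ← h2.2, hid] at this; omega
    · rw [index_inj hur ha] at h2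
      have := h.id_left _ hpos h1
      rw [← h2.1, ← h2.2, hid] at this; omega
  set id' := Function.update (Function.update id (u * r + w) (m + 1)) (w * r + u) (m + 1) with hdef
  have i1 : id' (w * r + u) = m + 1 := by rw [hdef, Function.update_self]
  have i2 : id' (u * r + w) = m + 1 := by
    by_cases h' : u * r + w = w * r + u
    · rw [h', i1]
    · rw [hdef, Function.update_of_ne h', Function.update_self]
  have i3 : ∀ x, id x ≠ 0 → id' x = id x := by
    intro x hx
    rw [hdef, Function.update_of_ne, Function.update_of_ne]
    · rintro rfl; exact hx hid
    · rintro rfl; exact hx hid'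
  constructor
  · intro e h1 h2
    by_cases he : e = m + 1
    · subst he; simpa using hw
    · simpa [he] using h.adj e h1 (by omega)
  · intro e h1 h2
    by_cases he : e = m + 1
    · subst he; simpa using i2
    · have := h.id_left e h1 (by omega)
      rw [Function.update_of_ne he, Function.update_of_ne he, i3 _ (by omega), this]
  · intro e h1 h2
    by_cases he : e = m + 1
    · subst he; simpa using i1
    · have := h.id_right e h1 (by omega)
      rw [Function.update_of_ne he, Function.update_of_ne he, i3 _ (by omega), this]
  · intro x hx
    by_cases hx1 : x = w * r + u
    · rw [hx1, i1]; simp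
    by_cases hx2 : x = u * r + w
    · rw [hx2, i2]; simp
    have : id' x = id x := by rw [hdef, Function.update_of_ne hx1, Function.update_of_ne hx2]
    rw [this] at hx ⊢
    obtain ⟨h1, h2⟩ := h.support x hx
    have hne : id x ≠ m + 1 := by omega
    rw [Function.update_of_ne hne, Function.update_of_ne hne]
    exact ⟨by omega, h2⟩

/-- The state while the edges of a phase are collected. -/
structure Collecting (N : ℕ → Finset ℕ) (r : ℕ) (s : Memory) : Prop where
  table : EdgeTable N r (s.vars 11) (s.arrs 18) (s.arrs 19) (s.arrs 21)
  cls : ∀ e, 1 ≤ e → e ≤ s.vars 11 → s.arrs 20 e = 1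

/-- An edge between two big nodes is met twice. Since its number is entered for both orders of the
endpoints, the second visit finds a nonzero entry and does not number the edge again. -/
theorem Run.collectAt {n d r v k : ℕ} {N : ℕ → Finset ℕ} {s : Memory} (hN : Neighbours n d N)
    (hnr : n ≤ r) (h8 : s.vars 8 = r) (h22 : s.vars 22 = v) (h26 : s.vars 26 = (N v).card)
    (hA : SetFam r (s.arrs 2) (s.arrs 3) (s.arrs 4) N) (hC : Collecting N r s)
    (hk : s.vars 11 ≤ k) (hQ : k + d ≤ M.Q) :
    Run M Cmd.collectAt s (80 * d + 10) fun s' => Collecting N r s' ∧ s'.vars 11 ≤ k + d ∧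
      (∀ x, s.arrs 21 x ≠ 0 → s'.arrs 21 x ≠ 0) ∧ ∀ w ∈ N v, s'.arrs 21 (v * r + w) ≠ 0 := by
  have hd := hN.card v
  refine (Run.forUp (fun j s' => Collecting N r s' ∧ s'.vars 11 ≤ k + j ∧
    (∀ x, s.arrs 21 x ≠ 0 → s'.arrs 21 x ≠ 0) ∧
    ∀ i < j, s'.arrs 21 (v * r + s.arrs 2 (v * r + i)) ≠ 0) (N v).card 70 (by decide) (by decide)
    (by decide) h26 ⟨hC, by omega, fun _ h => h, by simp⟩ ?_ ?_).mono (by omega) ?_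
  · rintro j s' x ⟨⟨h1, h2⟩, h3, h4, h5⟩; exact ⟨⟨h1, h2⟩, h3, h4, h5⟩
  · rintro j s' hS hB hj hij ⟨g1, g2, g3, g4⟩
    have v8 : s'.vars 8 = r := by rw [hS.vars 8 (by decide), h8]
    have v22 : s'.vars 22 = v := by rw [hS.vars 22 (by decide), h22]
    have f2 : s'.arrs 2 = s.arrs 2 := hS.arrs 2 (by decide)
    set w := s.arrs 2 (v * r + j) with hw
    have hwN : w ∈ N v := hA.mem v j hj
    refine Run.block rfl rfl ?_
    by_cases h0 : s'.arrs 21 (v * r + w) = 0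
    · have hadd := g1.table.add hN hnr hwN h0
      set id' := Function.update (Function.update (s'.arrs 21) (v * r + w) (s'.vars 11 + 1))
        (w * r + v) (s'.vars 11 + 1) with hid'
      have i3 : ∀ x, s'.arrs 21 x ≠ 0 → id' x ≠ 0 := by
        intro x hx
        rw [hid']
        by_cases hx1 : x = w * r + v
        · rw [hx1, Function.update_self]; omega
        rw [Function.update_of_ne hx1]
        by_cases hx2 : x = v * r + w
        · rw [hx2, Function.update_self]; omega
        rwa [Function.update_of_ne hx2]
      have i2 : id' (v * r + w) ≠ 0 := by
        rw [hid']
        by_cases hx1 : v * r + w = w * r + v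
        · rw [hx1, Function.update_self]; omega
        rw [Function.update_of_ne hx1, Function.update_self]; omega
      simp [Cmd.wp, hij, v8, v22, f2, ← hw, h0]
      refine ⟨by omega, ⟨by simpa using hadd, fun e h1 h2 => ?_⟩, by omega,
        fun x hx => i3 x (g3 x hx), fun i hi => ?_⟩
      · simp at h2 ⊢
        by_cases he : e = s'.vars 11 + 1
        · subst he; simp
        · rw [Function.update_of_ne he, g1.cls e h1 (by omega)]
      · by_cases hi' : i = j
        · subst hi'; exact i2
        · exact i3 _ (g4 i (by omega))
    · simp [Cmd.wp, hij, v8, v22, f2, ← hw, h0]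
      refine ⟨⟨by simpa using g1.table, fun e h1 h2 => g1.cls e h1 (by simpa using h2)⟩, by omega, g3,
        fun i hi => ?_⟩
      by_cases hi' : i = j
      · subst hi'; exact h0
      · exact g4 i (by omega)
  · rintro s' _ _ ⟨g1, g2, g3, g4⟩
    refine ⟨g1, by omega, g3, fun w hw => ?_⟩
    obtain ⟨i, hi, h1, _⟩ := hA.pos v w hw
    rw [← h1]; exact g4 i hi

theorem Run.collect {n d r : ℕ} {N : ℕ → Finset ℕ} {B : Finset ℕ} {s : Memory}
    (hN : Neighbours n d N) (hnr : n ≤ r) (h8 : s.vars 8 = r)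
    (hA : SetFam r (s.arrs 2) (s.arrs 3) (s.arrs 4) N)
    (hB : SetFam r (s.arrs 8) (s.arrs 9) (s.arrs 10) (single B))
    (h21 : ∀ x, s.arrs 21 x = 0) (hQ : B.card * d + d ≤ M.Q) :
    Run M Cmd.collect s (B.card * (80 * d + 50) + 50) fun s' => Collecting N r s' ∧
      s'.vars 11 ≤ B.card * d ∧ ∀ v ∈ B, ∀ w ∈ N v, s'.arrs 21 (v * r + w) ≠ 0 := by
  have hc : s.arrs 10 0 = B.card := by simpa using hB.card 0
  refine (Run.seq (P₁ := fun s' => s' = (s.setVar 11 0).setVar 25 B.card) (T₁ := 20)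
    (T₂ := (80 * d + 30 + 10) * B.card + 10)
    (Run.block rfl rfl (by simp [Cmd.wp, hc])) ?_).mono (by ring_nf; omega) fun _ _ _ h => h
  rintro s₁ _ _ rfl
  refine (Run.forUp (fun j s' => Collecting N r s' ∧ s'.vars 11 ≤ j * d ∧
    ∀ i < j, ∀ w ∈ N (s.arrs 8 i), s'.arrs 21 (s.arrs 8 i * r + w) ≠ 0) B.card (80 * d + 30)
    (by decide) (by decide) (by decide) (by simp) ?_ ?_ ?_).mono le_rfl ?_
  · refine ⟨⟨⟨?_, ?_, ?_, ?_⟩, ?_⟩, by simp, by simp⟩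
    · intro e h1 h2; simp at h2; omega
    · intro e h1 h2; simp at h2; omega
    · intro e h1 h2; simp at h2; omega
    · intro x hx; exact absurd (h21 x) hx
    · intro e h1 h2; simp at h2; omega
  · rintro j s' x ⟨⟨h1, h2⟩, h3, h4⟩; exact ⟨⟨h1, h2⟩, h3, h4⟩
  · rintro j s' hS hB' hj hij ⟨g1, g2, g3⟩
    have v8 : s'.vars 8 = r := by rw [hS.vars 8 (by decide)]; simpa using h8
    have f8 : s'.arrs 8 = s.arrs 8 := hS.arrs 8 (by decide)
    have f2 : s'.arrs 2 = s.arrs 2 := hS.arrs 2 (by decide)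
    have f3 : s'.arrs 3 = s.arrs 3 := hS.arrs 3 (by decide)
    have f4 : s'.arrs 4 = s.arrs 4 := hS.arrs 4 (by decide)
    set v := s.arrs 8 j with hv
    have hNv : s.arrs 4 v = (N v).card := hA.card v
    refine (Run.seq (P₁ := fun s'' => s'' = (s'.setVar 22 v).setVar 26 (N v).card) (T₁ := 20)
      (T₂ := 80 * d + 10) (Run.block rfl rfl (by simp [Cmd.wp, hij, f8, f4, ← hv, hNv])) ?_).mono
      (by omega) fun _ _ _ h => h
    rintro s₂ _ _ rfl
    refine (Run.collectAt (v := v) (k := j * d) hN hnr (by simpa using v8) (by simp) (by simp)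
      (by simpa [f2, f3, f4] using hA) ⟨by simpa using g1.table, by simpa using g1.cls⟩
      (by simpa using g2) ?_).mono le_rfl ?_
    · have : j * d ≤ B.card * d := Nat.mul_le_mul_right _ hj.le
      omega
    · rintro s₃ _ _ ⟨k1, k2, k3, k4⟩
      refine ⟨k1, by rw [Nat.add_mul]; omega, fun i hi w hw => ?_⟩
      by_cases hij' : i = j
      · subst hij'; exact k4 w hw
      · exact k3 _ (by simpa using g3 i (by omega) w hw)
  · rintro s' _ _ ⟨g1, g2, g3⟩
    refine ⟨g1, g2, fun v hv w hw => ?_⟩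
    obtain ⟨i, hi, h1, _⟩ := hB.pos 0 v (by simpa using hv)
    simp only [zero_mul, zero_add, single_zero] at hi h1
    subst h1
    exact g3 i hi w hw

/-! ### The classes of a phase -/

/-- The edges of the class `c`. -/
def edgesOf (cl : ℕ → ℕ) (m c : ℕ) : Finset ℕ := (Finset.Icc 1 m).filter fun e => cl e = c

theorem Run.distribute {r m : ℕ} {s : Memory} (h8 : s.vars 8 = r) (h11 : s.vars 11 = m) (hm : m < r)
    (hQ : r + 1 ≤ M.Q) (hl : ∀ c, s.arrs 16 c = 0) :
    Run M Cmd.distribute s (60 * m + 10) fun s' =>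
      SetFam r (s'.arrs 14) (s'.arrs 15) (s'.arrs 16) (edgesOf (s.arrs 20) m) := by
  refine (Run.forUp (fun j s' => SetFam r (s'.arrs 14) (s'.arrs 15) (s'.arrs 16)
    (edgesOf (s.arrs 20) j)) m 50 (by decide) (by decide) (by decide) h11 ?_
    (fun _ _ _ h => h) ?_).mono (by omega) fun _ _ _ h => h
  · rw [show s.arrs 16 = fun _ => 0 from funext hl,
      show edgesOf (s.arrs 20) 0 = fun _ => ∅ from funext fun c => by simp [edgesOf]]
    exact SetFam.empty _ _ _
  · intro j s' hS hB hj hij hF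
    have v8 : s'.vars 8 = r := by rw [hS.vars 8 (by decide), h8]
    have f20 : s'.arrs 20 = s.arrs 20 := hS.arrs 20 (by decide)
    refine (Run.seq (P₁ := fun s'' => s'' = (s'.setVar 15 (j + 1)).setVar 14 (s.arrs 20 (j + 1)))
      (T₁ := 20) (T₂ := 30) (Run.block rfl rfl (by simp [Cmd.wp, hij, f20]; omega)) ?_).mono (by omega)
      fun _ _ _ h => h
    rintro s₁ _ _ rfl
    refine (Run.setInsert (m := r) (b := s.arrs 20 (j + 1)) (x := j + 1) (by decide) (by decide)
      (by decide) (by simpa using hF) (by simpa using v8) (by simp) (by simp) (by omega)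
      (by simp [edgesOf]) hQ).mono le_rfl ?_
    rintro s₂ _ _ ⟨h1, -, -⟩
    convert h1 using 1
    funext c
    by_cases hc : c = s.arrs 20 (j + 1)
    · subst hc
      rw [Function.update_self]
      ext e
      simp only [edgesOf, Finset.mem_filter, Finset.mem_Icc, Finset.mem_insert]
      constructor
      · rintro ⟨g1, g2⟩
        by_cases he : e = j + 1
        · exact Or.inl he
        · exact Or.inr ⟨by omega, g2⟩
      · rintro (rfl | ⟨g1, g2⟩)
        · exact ⟨by omega, rfl⟩
        · exact ⟨by omega, g2⟩
    · rw [Function.update_of_ne hc]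
      ext e
      simp only [edgesOf, Finset.mem_filter, Finset.mem_Icc]
      constructor
      · rintro ⟨g1, g2⟩
        have : e ≠ j + 1 := by rintro rfl; exact hc g2.symm
        exact ⟨by omega, g2⟩
      · rintro ⟨g1, g2⟩; exact ⟨by omega, g2⟩

/-- The arrays `0` and `1` contain the endpoints of the edges in the set `X`. -/
structure Listed (r : ℕ) (X : Finset ℕ) (s : Memory) : Prop where
  fam : SetFam r (s.arrs 11) (s.arrs 12) (s.arrs 13) (single X)
  tail : ∀ i < X.card, s.arrs 0 i = s.arrs 18 (s.arrs 11 i)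
  head : ∀ i < X.card, s.arrs 1 i = s.arrs 19 (s.arrs 11 i)

/-- The edges of the class `c` that have not been deleted. -/
def aliveOf (s : Memory) (r m c : ℕ) : Finset ℕ :=
  (Finset.Icc 1 m).filter fun e => s.arrs 20 e = c ∧ s.arrs 21 (s.arrs 18 e * r + s.arrs 19 e) = e

/-- The lists of the classes are never updated within a phase; deleted edges are filtered out here,
being those whose number is missing from the table 21. An edge that is deleted and inserted again
gets no number, so it stays outside `X` until the next phase. -/
theorem Run.load {r m c : ℕ} {X : Finset ℕ} {s : Memory} (h8 : s.vars 8 = r) (h12 : s.vars 12 = c)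
    (hm : m < r) (hQ : r + 1 ≤ M.Q)
    (hF : SetFam r (s.arrs 14) (s.arrs 15) (s.arrs 16) (edgesOf (s.arrs 20) m))
    (hX : SetFam r (s.arrs 11) (s.arrs 12) (s.arrs 13) (single X)) :
    Run M Cmd.load s (100 * (edgesOf (s.arrs 20) m c).card + 30) fun s' =>
      Listed r (aliveOf s r m c) s' := by
  set F := edgesOf (s.arrs 20) m c with hFdef
  have hc : s.arrs 16 c = F.card := hF.card c
  refine (Run.seq (P₁ := fun s' => s' = (s.setArr 13 0 0).setVar 25 F.card) (T₁ := 20)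
    (T₂ := (90 + 10) * F.card + 10) (Run.block rfl rfl (by simp [Cmd.wp, h12, hc])) ?_).mono
    (by omega) fun _ _ _ h => h
  rintro s₁ _ _ rfl
  set E : ℕ → Finset ℕ := fun j => ((Finset.range j).image fun i => s.arrs 14 (c * r + i)).filter
    fun e => s.arrs 21 (s.arrs 18 e * r + s.arrs 19 e) = e with hE
  have hEtop : E F.card = aliveOf s r m c := by
    simp only [hE]
    rw [hF.image_range c, edgesOf, Finset.filter_filter, aliveOf]
  have hmemF : ∀ i < F.card, s.arrs 14 (c * r + i) ∈ F := fun i hi => hF.mem c i hi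
  rw [← hEtop]
  refine (Run.forUp (fun j s' => Listed r (E j) s') F.card 90 (by decide) (by decide) (by decide)
    (by simp) ?_ ?_ ?_).mono le_rfl fun _ _ _ h => h
  · refine ⟨by simpa [hE] using hX.clear, by simp [hE], by simp [hE]⟩
  · rintro j s' x ⟨h1, h2, h3⟩; exact ⟨h1, h2, h3⟩
  · rintro j s' hS hB hj hij ⟨g1, g2, g3⟩
    have v8 : s'.vars 8 = r := by rw [hS.vars 8 (by decide)]; simpa using h8
    have v12 : s'.vars 12 = c := by rw [hS.vars 12 (by decide)]; simpa using h12
    have f14 : s'.arrs 14 = s.arrs 14 := hS.arrs 14 (by decide)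
    have f18 : s'.arrs 18 = s.arrs 18 := hS.arrs 18 (by decide)
    have f19 : s'.arrs 19 = s.arrs 19 := hS.arrs 19 (by decide)
    have f21 : s'.arrs 21 = s.arrs 21 := hS.arrs 21 (by decide)
    rw [f18] at g2
    rw [f19] at g3
    set e := s.arrs 14 (c * r + j) with he
    have heF : e ∈ F := hmemF j hj
    have hem : e < r := by simp [hFdef, edgesOf] at heF; omega
    have hl : s'.arrs 13 0 = (E j).card := by simpa using g1.card 0
    refine (Run.seq (P₁ := fun s'' => s'' = s'.setVar 15 e) (T₁ := 10) (T₂ := 80)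
      (Run.block rfl rfl (by simp [Cmd.wp, hij, f14, v12, v8, he])) ?_).mono (by omega) fun _ _ _ h => h
    rintro s₂ _ _ rfl
    refine (Run.ite (T := 65) rfl (fun hb => ?_) (fun hb => ?_)).mono (by decide) fun _ _ _ h => h
    · have hb' : s.arrs 21 (s.arrs 18 e * r + s.arrs 19 e) = e := by
        simpa [f21, f18, f19, v8] using hb
      have hEs : E (j + 1) = insert e (E j) := by
        simp only [hE]
        rw [image_range_succ, Finset.filter_insert, if_pos hb']
      have heE : e ∉ E j := by
        intro h'
        simp only [hE, Finset.mem_filter] at h'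
        exact hF.notMem_image (b := c) hj h'.1
      have hEc : (E (j + 1)).card = (E j).card + 1 := by
        rw [hEs, Finset.card_insert_of_notMem heE]
      refine (Run.seq (P₁ := fun s'' => s'' = (s'.setVar 15 e).setVar 14 0) (T₁ := 5) (T₂ := 60)
        (Run.block rfl rfl (by simp [Cmd.wp])) ?_).mono (by omega) fun _ _ _ h => h
      rintro s₃ _ _ rfl
      refine (Run.seq (P₁ := fun s'' => s'' = ((s'.setVar 15 e).setVar 14 0).setArr 0 (E j).card
        (s.arrs 18 e)) (T₁ := 10) (T₂ := 50)
        (Run.block rfl rfl (by simp [Cmd.wp, hl, f18])) ?_).mono (by omega) fun _ _ _ h => h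
      rintro s₄ _ _ rfl
      refine (Run.seq (P₁ := fun s'' => s'' = (((s'.setVar 15 e).setVar 14 0).setArr 0 (E j).card
        (s.arrs 18 e)).setArr 1 (E j).card (s.arrs 19 e)) (T₁ := 10) (T₂ := 40)
        (Run.block rfl rfl (by simp [Cmd.wp, hl, f19])) ?_).mono (by omega) fun _ _ _ h => h
      rintro s₅ _ _ rfl
      refine (Run.setInsert (m := r) (b := 0) (x := e) (F := single (E j)) (by decide) (by decide)
        (by decide) (by simpa using g1) (by simpa using v8) (by simp) (by simp) hem (by simpa using heE)
        hQ).mono (by omega) ?_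
      rintro s₆ hS₆ _ ⟨h1, h2, h3⟩
      simp only [single_zero, update_single, zero_mul, zero_add] at h1 h2
      have k0 : s₆.arrs 0 = Function.update (s'.arrs 0) (E j).card (s.arrs 18 e) := by
        rw [hS₆.arrs 0 (by decide)]; simp
      have k1 : s₆.arrs 1 = Function.update (s'.arrs 1) (E j).card (s.arrs 19 e) := by
        rw [hS₆.arrs 1 (by decide)]; simp
      have k18 : s₆.arrs 18 = s.arrs 18 := by rw [hS₆.arrs 18 (by decide)]; simpa using f18
      have k19 : s₆.arrs 19 = s.arrs 19 := by rw [hS₆.arrs 19 (by decide)]; simpa using f19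
      refine ⟨by rw [hEs]; exact h1, fun i hi => ?_, fun i hi => ?_⟩
      · rw [k0, h2, k18]
        by_cases hi' : i = (E j).card
        · subst hi'; simp
        · simpa [hi'] using g2 i (by omega)
      · rw [k1, h2, k19]
        by_cases hi' : i = (E j).card
        · subst hi'; simp
        · simpa [hi'] using g3 i (by omega)
    · have hb' : ¬ s.arrs 21 (s.arrs 18 e * r + s.arrs 19 e) = e := by
        simpa [f21, f18, f19, v8] using hb
      have hEs : E (j + 1) = E j := by
        simp only [hE]
        rw [image_range_succ, Finset.filter_insert, if_neg hb']
      refine Run.block rfl rfl ?_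
      simp only [Cmd.wp]
      rw [hEs]
      exact ⟨g1, by simpa [f18] using g2, by simpa [f19] using g3⟩

end DynSkeleton

namespace DynSkeleton

/-! ### Estimates for the parameters -/

namespace Params

/-- The number of classes. -/
noncomputable def K (p : Params) : ℕ := 2 ^ p.Ld

theorem K_pos (p : Params) : (0 : ℝ) < p.K := by simp [K]

/-- The reciprocal of `γ`, rounded up. -/
noncomputable def g (p : Params) : ℕ := ⌈1 / p.γ⌉₊

namespace Admissible

variable {p : Params} (hp : p.Admissible)

include hp

/-- From here on, `Ld_ge` enters only in this form, which also excludes the degenerate cases of the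
logarithm. -/
theorem Ld_pos : 1 ≤ p.Ld := by
  have h1 := hp.γ_pos
  have h2 := hp.Ld_ge
  rcases Nat.eq_zero_or_pos p.Ld with h | h
  · rw [h] at h2; norm_num at h2; linarith
  · exact h

theorem logb_lt : (p.Ld : ℝ) - 1 < Real.logb 2 ((p.d : ℝ) / (p.L : ℝ) ^ 4) := by
  have h := hp.Ld_pos
  have h1 : (p.Ld - 1 : ℕ) < ⌈Real.logb 2 ((p.d : ℝ) / (p.L : ℝ) ^ 4)⌉₊ := by
    change p.Ld - 1 < p.Ld; omega
  rw [Nat.lt_ceil] at h1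
  push_cast [h] at h1
  exact h1

theorem logb_pos : 0 < Real.logb 2 ((p.d : ℝ) / (p.L : ℝ) ^ 4) := by
  have h : p.Ld ≠ 0 := by have := hp.Ld_pos; omega
  exact Nat.ceil_pos.1 (Nat.pos_of_ne_zero h)

/-- For L = 0 the quotient d / L⁴ is 0 by convention, and so is its logarithm, contrary to
`logb_pos`. -/
theorem L_pos : 1 ≤ p.L := by
  rcases Nat.eq_zero_or_pos p.L with h | h
  · have := hp.logb_pos
    rw [h] at this; simp at this
  · exact h

theorem d_pos : 1 ≤ p.d := by
  rcases Nat.eq_zero_or_pos p.d with h | h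
  · have := hp.logb_pos
    rw [h] at this; simp at this
  · exact h

theorem d_le_K : (p.d : ℝ) ≤ p.K * (p.L : ℝ) ^ 4 := by
  have hL : (0 : ℝ) < (p.L : ℝ) ^ 4 := by have := hp.L_pos; positivity
  have hd : (0 : ℝ) < p.d := by have := hp.d_pos; positivity
  have h : Real.logb 2 ((p.d : ℝ) / (p.L : ℝ) ^ 4) ≤ p.Ld := Nat.le_ceil _
  rw [Real.logb_le_iff_le_rpow (by norm_num) (by positivity), Real.rpow_natCast, div_le_iff₀ hL] at h
  simpa [K] using h

/-- Rounding the logarithm up costs less than a factor 2; with `d_le_K` this means d ≤ K L⁴ < 2d. -/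
theorem K_lt : (p.K : ℝ) * (p.L : ℝ) ^ 4 < 2 * p.d := by
  have hL : (0 : ℝ) < (p.L : ℝ) ^ 4 := by have := hp.L_pos; positivity
  have hd : (0 : ℝ) < p.d := by have := hp.d_pos; positivity
  have h := hp.logb_lt
  rw [Real.lt_logb_iff_rpow_lt (by norm_num) (by positivity), Real.rpow_sub (by norm_num),
    Real.rpow_natCast, Real.rpow_one, lt_div_iff₀ hL] at h
  rw [K]; push_cast
  linarith

theorem lam_eq : p.lam * (p.K * (p.L : ℝ) ^ 4) = p.d := by
  have hL : (0 : ℝ) < (p.L : ℝ) ^ 4 := by have := hp.L_pos; positivity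
  have : (p.K : ℝ) = 2 ^ p.Ld := by simp [K]
  have hL' : (p.L : ℝ) ≠ 0 := by have := hp.L_pos; positivity
  rw [lam, this]
  field_simp

theorem lam_pos : 0 < p.lam := by
  have hL : (0 : ℝ) < (p.L : ℝ) ^ 4 := by have := hp.L_pos; positivity
  have hd : (0 : ℝ) < p.d := by have := hp.d_pos; positivity
  rw [lam]; positivity

theorem lam_le : p.lam ≤ 1 := by
  have hL : (0 : ℝ) < (p.L : ℝ) ^ 4 := by have := hp.L_pos; positivity
  have h1 := hp.lam_eq
  have h2 := hp.d_le_K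
  have h3 := p.K_pos
  have : 0 < (p.K : ℝ) * (p.L : ℝ) ^ 4 := by positivity
  nlinarith

theorem exp_mul_Ld_le :
    8 * Real.exp p.γ * p.Ld ≤ p.ε * p.γ * p.lam * (p.L : ℝ) ^ 2 := by
  have h := hp.L_sq_ge
  have h1 := hp.lam_pos
  have h2 := hp.ε_pos
  have h3 := hp.γ_pos
  rw [div_le_iff₀ (by positivity)] at h
  linarith

/-- The numerical content of the assumption on L², without the factors e^γ and L_d, which are at
least 1. -/
theorem eight_lt : 8 < p.ε * p.γ * p.lam * (p.L : ℝ) ^ 2 := by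
  have h := hp.exp_mul_Ld_le
  have h1 : (1 : ℝ) ≤ p.Ld := by exact_mod_cast hp.Ld_pos
  have h2 : 1 < Real.exp p.γ := by rw [Real.one_lt_exp_iff]; exact hp.γ_pos
  nlinarith

theorem eight_lt_γ : 8 < p.γ * (p.L : ℝ) ^ 2 := by
  have h := hp.eight_lt
  have h1 := hp.lam_pos
  have h2 := hp.lam_le
  have h3 := hp.ε_pos
  have h4 := hp.ε_lt
  have h5 := hp.γ_pos
  have h6 : p.ε * p.lam ≤ 1 := by nlinarith
  have h7 : 0 ≤ p.γ * (p.L : ℝ) ^ 2 := by positivity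
  nlinarith

theorem eight_lt_sq : 8 < (p.L : ℝ) ^ 2 := by
  have h := hp.eight_lt_γ
  have h5 := hp.γ_lt
  nlinarith [sq_nonneg (p.L : ℝ)]

theorem three_le_L : 3 ≤ p.L := by
  have h := hp.eight_lt_sq
  have : 8 < p.L ^ 2 := by exact_mod_cast h
  by_contra h'
  have : p.L ≤ 2 := by omega
  have : p.L ^ 2 ≤ 2 ^ 2 := Nat.pow_le_pow_left this 2
  omega

theorem K_mul_lt : p.K * p.L ^ 4 < 2 * p.d := by exact_mod_cast hp.K_lt

/-- 81 K ≤ K L⁴ < 2d ≤ 2n, because L ≥ 3. -/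
theorem K_bound : 40 * p.K < p.n := by
  have h1 := hp.K_mul_lt
  have h2 := Nat.pow_le_pow_left hp.three_le_L 4
  have h3 := Nat.mul_le_mul_left p.K h2
  have h4 := hp.d_le
  omega

theorem two_le_K : 2 ≤ p.K := by
  have := Nat.pow_le_pow_right (n := 2) (by omega) hp.Ld_pos
  simpa [K] using this

theorem n_ge : 64 ≤ p.n := by
  have := hp.K_bound
  have := hp.two_le_K
  omega

theorem K_le_d : p.K ≤ p.d := by
  have h1 := hp.K_mul_lt
  have h2 := Nat.pow_le_pow_left hp.three_le_L 4
  have h3 := Nat.mul_le_mul_left p.K h2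
  omega

theorem L_sq_le : p.L ^ 2 ≤ p.n := by
  have h1 := hp.d_ge
  have h2 := hp.d_le
  have h3 : p.L ^ 2 ≤ p.L ^ 4 := Nat.pow_le_pow_right hp.L_pos (by omega)
  omega

theorem L_le : p.L ≤ p.n := by
  have h1 := hp.L_sq_le
  have h2 : p.L ≤ p.L ^ 2 := Nat.le_self_pow (by omega) _
  omega

theorem Ld_le : p.Ld ≤ p.n := by
  have h1 := hp.K_bound
  have h2 : p.Ld < 2 ^ p.Ld := Nat.lt_two_pow_self
  rw [K] at h1
  omega

theorem one_le_γ_g : 1 ≤ p.γ * p.g := by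
  have h := Nat.le_ceil (1 / p.γ)
  have h1 := hp.γ_pos
  rw [div_le_iff₀ h1] at h
  rw [g]; linarith

theorem γ_g_le : p.γ * p.g ≤ 2 := by
  have h1 := hp.γ_pos
  have h2 := hp.γ_lt
  have h := (Nat.ceil_lt_add_one (by positivity : 0 ≤ 1 / p.γ)).le
  have h3 : p.γ * (1 / p.γ + 1) = 1 + p.γ := by field_simp
  have h4 := mul_le_mul_of_nonneg_left h h1.le
  rw [h3] at h4
  rw [g]; linarith

/-- γ g ≤ 2 < 8 < γ L², hence g ≤ L² ≤ L⁴ ≤ d ≤ n. -/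
theorem g_le : p.g ≤ p.n := by
  have h1 := hp.γ_g_le
  have h2 := hp.eight_lt_γ
  have h3 := hp.γ_pos
  have h4 : (p.g : ℝ) ≤ (p.L : ℝ) ^ 2 := by
    by_contra h
    push Not at h
    have := mul_lt_mul_of_pos_left h h3
    linarith
  have h5 : p.g ≤ p.L ^ 2 := by exact_mod_cast h4
  exact h5.trans hp.L_sq_le

theorem εd_pos : 0 < p.ε * p.d := by
  have := hp.ε_pos
  have : (0 : ℝ) < p.d := by exact_mod_cast hp.d_pos
  positivity

end Admissible

/-- The machine that executes the program. -/
noncomputable def machine (p : Params) (hn : 64 ≤ p.n) : Machine where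
  W := p.n ^ 81
  Q := p.n ^ 8
  θ := p.reals
  le_Q := le_trans (by norm_num) (Nat.pow_le_pow_left hn 8)
  -- `Q ^ 10` is n^80, which determines the exponent 81 of the word bound.
  lt_W := by rw [← pow_mul]; exact Nat.pow_lt_pow_right (by omega) (by omega)

end Params

end DynSkeleton

namespace DynSkeleton

/-! ### The state between updates -/

namespace Params

/-- Few updates at a node. -/
def Few (p : Params) (x : ℕ) : Prop :=
  ((x * (12 * (p.L * p.L * p.g)) : ℕ) : ℝ) < p.ε * p.d

/-- Few deleted edges of one class at a node. -/
def FewIn (p : Params) (x : ℕ) : Prop :=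
  ((x * (12 * (p.K * (p.L * p.L * p.g))) : ℕ) : ℝ) < p.ε * p.d

theorem Admissible.few_zero {p : Params} (hp : p.Admissible) : p.Few 0 := by
  simpa [Few] using hp.εd_pos

theorem Admissible.fewIn_zero {p : Params} (hp : p.Admissible) : p.FewIn 0 := by
  simpa [FewIn] using hp.εd_pos

end Params

/-- The constants in the memory. -/
structure Ctx (p : Params) (s : Memory) : Prop where
  n : s.vars 3 = p.n
  d : s.vars 4 = p.d
  L : s.vars 5 = p.L
  Ld : s.vars 6 = p.Ld
  cube : s.vars 8 = p.n ^ 3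
  K : s.vars 9 = p.K
  g : s.vars 10 = p.g

theorem Ctx.same {p : Params} {s s' : Memory} {vs as : List ℕ} (h : Ctx p s) (hS : Same vs as s s')
    (hv : ∀ x ∈ [3, 4, 5, 6, 8, 9, 10], x ∉ vs) : Ctx p s' :=
  ⟨by rw [hS.vars 3 (hv 3 (by decide)), h.n], by rw [hS.vars 4 (hv 4 (by decide)), h.d],
   by rw [hS.vars 5 (hv 5 (by decide)), h.L], by rw [hS.vars 6 (hv 6 (by decide)), h.Ld],
   by rw [hS.vars 8 (hv 8 (by decide)), h.cube], by rw [hS.vars 9 (hv 9 (by decide)), h.K],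
   by rw [hS.vars 10 (hv 10 (by decide)), h.g]⟩

/-- The adjacency lists, the set `B` of clean big nodes and the set `D` of dirty nodes. -/
structure Nodes (p : Params) (N : ℕ → Finset ℕ) (B D : Finset ℕ) (s : Memory) : Prop where
  adj : SetFam (p.n ^ 3) (s.arrs 2) (s.arrs 3) (s.arrs 4) N
  dirty : SetFam (p.n ^ 3) (s.arrs 5) (s.arrs 6) (s.arrs 7) (single D)
  clean : SetFam (p.n ^ 3) (s.arrs 8) (s.arrs 9) (s.arrs 10) (single B)
  mem_dirty : ∀ v, v ∈ D ↔ v < p.n ∧ ¬ p.Few (s.arrs 17 v)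
  mem_clean : ∀ v ∈ B, v < p.n ∧ p.Few (s.arrs 17 v)
  flags : s.arrs 27 = flag B

theorem Nodes.disjoint {p : Params} {N : ℕ → Finset ℕ} {B D : Finset ℕ} {s : Memory}
    (h : Nodes p N B D s) : Disjoint D B :=
  Finset.disjoint_left.2 fun v hD hB => ((h.mem_dirty v).1 hD).2 (h.mem_clean v hB).2

/-- The entry of the edge `e` in the table of edge numbers; it is `0` if `e` has been deleted. -/
def edgeId (s : Memory) (r e : ℕ) : ℕ := s.arrs 21 (s.arrs 18 e * r + s.arrs 19 e)

/-- The edges of the phase at the node `v`. -/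
def edgesAt (s : Memory) (v : ℕ) : Finset ℕ :=
  (Finset.Icc 1 (s.vars 11)).filter fun e => s.arrs 18 e = v ∨ s.arrs 19 e = v

/-- The deleted edges of the class `c` at the node `v`. -/
def lost (s : Memory) (r v c : ℕ) : Finset ℕ :=
  (edgesAt s v).filter fun e => s.arrs 20 e = c ∧ edgeId s r e = 0

/-- The deleted edges of the phase. -/
def dead (s : Memory) (r : ℕ) : Finset ℕ :=
  (Finset.Icc 1 (s.vars 11)).filter fun e => edgeId s r e = 0

open Classical in
/-- The nodes that have lost too many edges of the class `c`. -/
noncomputable def lossy (p : Params) (s : Memory) (c : ℕ) : Finset ℕ :=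
  (Finset.range p.n).filter fun v => ¬ p.FewIn (lost s (p.n ^ 3) v c).card

/-- The edges of the current phase and their classes. -/
structure Phase (p : Params) (N : ℕ → Finset ℕ) (s : Memory) : Prop where
  count_le : s.vars 11 ≤ p.n * p.n
  tail_lt : ∀ e, 1 ≤ e → e ≤ s.vars 11 → s.arrs 18 e < p.n
  head_lt : ∀ e, 1 ≤ e → e ≤ s.vars 11 → s.arrs 19 e < p.n
  ne : ∀ e, 1 ≤ e → e ≤ s.vars 11 → s.arrs 18 e ≠ s.arrs 19 e
  inj : ∀ e e', 1 ≤ e → e ≤ s.vars 11 → 1 ≤ e' → e' ≤ s.vars 11 →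
    (s.arrs 18 e = s.arrs 18 e' ∧ s.arrs 19 e = s.arrs 19 e') ∨
    (s.arrs 18 e = s.arrs 19 e' ∧ s.arrs 19 e = s.arrs 18 e') → e = e'
  support : ∀ x, s.arrs 21 x ≠ 0 → s.arrs 21 x ≤ s.vars 11 ∧
    (x = s.arrs 18 (s.arrs 21 x) * p.n ^ 3 + s.arrs 19 (s.arrs 21 x) ∨
     x = s.arrs 19 (s.arrs 21 x) * p.n ^ 3 + s.arrs 18 (s.arrs 21 x))
  symm : ∀ e, 1 ≤ e → e ≤ s.vars 11 →
    s.arrs 21 (s.arrs 19 e * p.n ^ 3 + s.arrs 18 e) = edgeId s (p.n ^ 3) e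
  alive_adj : ∀ e, 1 ≤ e → e ≤ s.vars 11 → edgeId s (p.n ^ 3) e ≠ 0 → s.arrs 19 e ∈ N (s.arrs 18 e)
  class_ge : ∀ e, 1 ≤ e → e ≤ s.vars 11 → p.K ≤ s.arrs 20 e
  class_lt : ∀ e, 1 ≤ e → e ≤ s.vars 11 → s.arrs 20 e < 2 * p.K
  tails : Balanced (s.arrs 18) (s.arrs 20) (s.vars 11) p.Ld
  heads : Balanced (s.arrs 19) (s.arrs 20) (s.vars 11) p.Ld
  waiting : ∀ x, s.arrs 26 x = 0
  lost : ∀ v c, c < p.n ^ 3 → s.arrs 22 (v * p.n ^ 3 + c) = (lost s (p.n ^ 3) v c).card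
  lossy : ∀ c, s.arrs 23 c = (lossy p s c).card
  classes : SetFam (p.n ^ 3) (s.arrs 14) (s.arrs 15) (s.arrs 16) (edgesOf (s.arrs 20) (s.vars 11))

/-- The degrees of the clean nodes, in comparison with the edges of the current phase. At the node
`v`, the number `σ v` of updates that have not yet been counted is taken into account. -/
structure Degrees (p : Params) (N : ℕ → Finset ℕ) (B D : Finset ℕ) (σ : ℕ → ℕ) (s : Memory) :
    Prop where
  edgesAt_le : ∀ v, (edgesAt s v).card ≤ p.d
  big : ∀ v ∈ B, p.ε * (2 * p.d) <
    (((N v).card : ℝ) + s.arrs 17 v + σ v) * ((p.L : ℝ) * p.L)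
  small : ∀ v < p.n, v ∉ B → p.Few (s.arrs 17 v) →
    ((N v).card : ℝ) * ((p.L : ℝ) * p.L) ≤
      p.ε * (2 * p.d) + ((s.arrs 17 v : ℝ) + σ v) * ((p.L : ℝ) * p.L)
  edges_le : ∀ v < p.n, p.Few (s.arrs 17 v) → (edgesAt s v).card ≤ (N v).card + s.arrs 17 v + σ v
  le_edges : ∀ v ∈ B, (N v).card ≤ (edgesAt s v).card + s.arrs 17 v + σ v
  count : s.vars 11 ≤ (B.card + D.card) * p.d
  passed : ∀ c, p.K ≤ c → c < s.vars 12 → p.δ * ((2 * B.card : ℕ) : ℝ) < s.arrs 23 c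
  cur_le : s.vars 12 ≤ 2 * p.K
  cur_ge : p.K ≤ s.vars 12 ∨ s.vars 11 = 0

/-- The total number of counted updates. -/
def charge (p : Params) (s : Memory) : ℕ := ∑ v ∈ Finset.range p.n, s.arrs 17 v

/-- What remains to be paid for going through the classes. -/
noncomputable def remaining (p : Params) (s : Memory) : ℕ :=
  ((Finset.Icc 1 (s.vars 11)).filter fun e => s.vars 12 < s.arrs 20 e).card +
    if s.vars 11 = 0 then 0 else 2 * p.K - s.vars 12

/-- A nonzero entry is the number of an edge of the phase with the same endpoints, and the endpoints
determine the edge. -/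
theorem Phase.edgeId_eq {p : Params} {N : ℕ → Finset ℕ} {s : Memory} (h : Phase p N s) {e : ℕ} (h1 : 1 ≤ e) (h2 : e ≤ s.vars 11) (h0 : edgeId s (p.n ^ 3) e ≠ 0) :
    edgeId s (p.n ^ 3) e = e := by
  obtain ⟨g1, g2⟩ := h.support _ h0
  change edgeId s (p.n ^ 3) e ≤ _ at g1
  have hr : p.n ≤ p.n ^ 3 := Nat.le_self_pow (by omega) _
  have g3 : 1 ≤ edgeId s (p.n ^ 3) e := Nat.one_le_iff_ne_zero.2 h0
  have a1 := h.tail_lt e h1 h2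
  have a2 := h.head_lt e h1 h2
  have a3 := h.tail_lt _ g3 g1
  have a4 := h.head_lt _ g3 g1
  symm
  apply h.inj e _ h1 h2 g3 g1
  rcases g2 with g2 | g2
  · left; exact (index_inj (by omega) (lt_of_lt_of_le a4 hr)).1 g2
  · right; exact (index_inj (by omega) (lt_of_lt_of_le a3 hr)).1 g2

/-- The edges at a node, as tails and as heads. -/
theorem card_edgesAt {s : Memory} (hne : ∀ e, 1 ≤ e → e ≤ s.vars 11 → s.arrs 18 e ≠ s.arrs 19 e)
    (v : ℕ) : (edgesAt s v).card =
      totalCount (s.arrs 18) (s.vars 11) v + totalCount (s.arrs 19) (s.vars 11) v := by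
  rw [edgesAt, Finset.filter_or, Finset.card_union_of_disjoint, totalCount, totalCount]
  rw [Finset.disjoint_filter]
  intro e he h1 h2
  simp at he
  exact hne e he.1 he.2 (by rw [h1, h2])

/-! ### Degrees in a freshly collected phase -/

section table

variable {n d r : ℕ} {N : ℕ → Finset ℕ} {s : Memory}

/-- The number of an edge can be looked up from its endpoints in either order. -/
theorem EdgeTable.edge_inj
    (h : EdgeTable N r (s.vars 11) (s.arrs 18) (s.arrs 19) (s.arrs 21)) {e e' : ℕ}
    (h1 : 1 ≤ e) (h2 : e ≤ s.vars 11) (h3 : 1 ≤ e') (h4 : e' ≤ s.vars 11)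
    (h5 : (s.arrs 18 e = s.arrs 18 e' ∧ s.arrs 19 e = s.arrs 19 e') ∨
      (s.arrs 18 e = s.arrs 19 e' ∧ s.arrs 19 e = s.arrs 18 e')) : e = e' := by
  rw [← h.id_left e h1 h2]
  rcases h5 with h5 | h5 <;> rw [h5.1, h5.2]
  · rw [h.id_left e' h3 h4]
  · rw [h.id_right e' h3 h4]

/-- An edge at `v` is determined by its other endpoint, which is a neighbour of `v`. -/
theorem EdgeTable.edgesAt_card_le (hN : Neighbours n d N)
    (h : EdgeTable N r (s.vars 11) (s.arrs 18) (s.arrs 19) (s.arrs 21)) (v : ℕ) :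
    (edgesAt s v).card ≤ (N v).card := by
  apply Finset.card_le_card_of_injOn (fun e => if s.arrs 18 e = v then s.arrs 19 e else s.arrs 18 e)
  · intro e he
    simp [edgesAt] at he
    have hadj := h.adj e he.1.1 he.1.2
    by_cases hv : s.arrs 18 e = v
    · simp [hv]; rwa [hv] at hadj
    · have hv' : s.arrs 19 e = v := by tauto
      simp [hv]; rw [← hv']; exact hN.symm _ _ hadj
  · intro e he e' he' hee
    simp [edgesAt] at he he'
    apply h.edge_inj he.1.1 he.1.2 he'.1.1 he'.1.2
    by_cases hv : s.arrs 18 e = v <;> by_cases hv' : s.arrs 18 e' = v <;> simp [hv, hv'] at hee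
    · left; rw [hv, hv', hee]; simp
    · right; exact ⟨by rw [hv]; tauto, hee⟩
    · right; exact ⟨hee, by rw [hv']; tauto⟩
    · left; exact ⟨hee, by have := he.2; have := he'.2; rw [show s.arrs 19 e = v by tauto]; tauto⟩

/-- The hypothesis holds at the big nodes, where all edges are collected. Sending a neighbour to the
number of the joining edge is injective, as no edge is a loop. -/
theorem EdgeTable.card_le_edgesAt (hN : Neighbours n d N) (hnr : n ≤ r)
    (h : EdgeTable N r (s.vars 11) (s.arrs 18) (s.arrs 19) (s.arrs 21)) {v : ℕ}
    (hv : ∀ w ∈ N v, s.arrs 21 (v * r + w) ≠ 0) : (N v).card ≤ (edgesAt s v).card := by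
  have hlt : ∀ v, ∀ z ∈ N v, z < r := fun v z hz => lt_of_lt_of_le (hN.lt v z hz) hnr
  have key : ∀ w ∈ N v, 1 ≤ s.arrs 21 (v * r + w) ∧ s.arrs 21 (v * r + w) ≤ s.vars 11 ∧
      ((v = s.arrs 18 (s.arrs 21 (v * r + w)) ∧ w = s.arrs 19 (s.arrs 21 (v * r + w))) ∨
       (v = s.arrs 19 (s.arrs 21 (v * r + w)) ∧ w = s.arrs 18 (s.arrs 21 (v * r + w)))) := by
    intro w hw
    obtain ⟨g1, g2⟩ := h.support _ (hv w hw)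
    have g3 := Nat.one_le_iff_ne_zero.2 (hv w hw)
    have hadj := h.adj _ g3 g1
    have a1 := hlt _ _ hadj
    have a2 := hlt _ _ (hN.symm _ _ hadj)
    rw [index_inj (hlt _ _ hw) a1, index_inj (hlt _ _ hw) a2] at g2
    exact ⟨g3, g1, g2⟩
  apply Finset.card_le_card_of_injOn (fun w => s.arrs 21 (v * r + w))
  · intro w hw
    obtain ⟨g1, g2, g3⟩ := key w hw
    simp [edgesAt]
    exact ⟨⟨g1, g2⟩, g3.imp (fun h => h.1.symm) fun h => h.1.symm⟩
  · intro w hw w' hw' hee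
    obtain ⟨g1, g2, g3⟩ := key w hw
    obtain ⟨_, _, g3'⟩ := key w' hw'
    simp only at hee
    rw [← hee] at g3'
    have hne := hN.ne _ _ (h.adj _ g1 g2)
    rcases g3 with g3 | g3 <;> rcases g3' with g3' | g3'
    · rw [g3.2, g3'.2]
    · exact absurd (by rw [← g3'.1, ← g3.1]) hne
    · exact absurd (by rw [← g3'.1, ← g3.1]) hne
    · rw [g3.2, g3'.2]

end table

end DynSkeleton

namespace DynSkeleton

variable {M : Machine}

/-! ### A rebuild -/

/-- A machine that is large enough for the program. -/
structure Params.Fit (p : Params) (M : Machine) : Prop where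
  Q : p.n ^ 8 ≤ M.Q
  ε : M.θ 0 = p.ε
  γ : M.θ 1 = p.γ
  δ : M.θ 2 = p.δ

namespace Params.Admissible

variable {p : Params} (hp : p.Admissible)

include hp

theorem cube_add_one_le (hM : p.Fit M) : p.n ^ 3 + 1 ≤ M.Q := by
  have h1 := hp.n_ge
  have h2 := hM.Q
  have h3 : p.n ^ 3 < p.n ^ 8 := Nat.pow_lt_pow_right (by omega) (by omega)
  omega

theorem sq_lt_cube : p.n * p.n < p.n ^ 3 := by
  have h1 := hp.n_ge
  rw [← pow_two]
  exact Nat.pow_lt_pow_right (by omega) (by omega)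

theorem n_lt_cube : p.n < p.n ^ 3 := by
  have h1 := hp.n_ge
  have h2 := hp.sq_lt_cube
  nlinarith

end Params.Admissible

theorem Phase.cleanup {p : Params} {N : ℕ → Finset ℕ} {s : Memory} (hp : p.Admissible)
    (hM : p.Fit M) (hC : Ctx p s) (h : Phase p N s) :
    Run M Cmd.cleanup s (100 * s.vars 11 + 10) fun s' => (∀ x, s'.arrs 21 x = 0) ∧
      (∀ x, s'.arrs 22 x = 0) ∧ (∀ x, s'.arrs 23 x = 0) ∧ ∀ x, s'.arrs 16 x = 0 := by
  have hn := hp.n_lt_cube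
  refine Run.cleanup hC.cube rfl ?_ ?_ ?_ ?_ ?_
  · have := h.count_le; have := hp.sq_lt_cube; have := hp.cube_add_one_le hM; omega
  · intro x hx
    obtain ⟨h1, h2⟩ := h.support x hx
    exact ⟨_, Nat.one_le_iff_ne_zero.2 hx, h1, h2⟩
  · intro x hx
    have hr : 0 < p.n ^ 3 := by omega
    have hx' := h.lost (x / p.n ^ 3) (x % p.n ^ 3) (Nat.mod_lt _ hr)
    rw [Nat.div_add_mod'] at hx'
    rw [hx', Finset.card_ne_zero] at hx
    obtain ⟨e, he⟩ := hx
    simp only [DynSkeleton.lost, edgesAt, Finset.mem_filter, Finset.mem_Icc] at he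
    obtain ⟨⟨⟨h1, h2⟩, h3⟩, h4, _⟩ := he
    refine ⟨e, h1, h2, h3.imp (fun h => ?_) (fun h => ?_)⟩ <;> rw [h, h4, Nat.div_add_mod']
  · intro c hc
    rw [h.lossy c, Finset.card_ne_zero] at hc
    obtain ⟨v, hv⟩ := hc
    simp only [DynSkeleton.lossy, Finset.mem_filter] at hv
    -- A lossy node has lost at least one edge, since ε d > 0 makes 0 count as few.
    have hne : (DynSkeleton.lost s (p.n ^ 3) v c).Nonempty := by
      rw [Finset.nonempty_iff_ne_empty]
      intro h0
      exact hv.2 (by rw [h0]; exact hp.fewIn_zero)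
    obtain ⟨e, he⟩ := hne
    simp only [DynSkeleton.lost, edgesAt, Finset.mem_filter, Finset.mem_Icc] at he
    exact ⟨e, he.1.1.1, he.1.1.2, he.2.1.symm⟩
  · intro c hc
    rw [h.classes.card c, Finset.card_ne_zero] at hc
    obtain ⟨e, he⟩ := hc
    simp only [edgesOf, Finset.mem_filter, Finset.mem_Icc] at he
    exact ⟨e, he.1.1, he.1.2, he.2.symm⟩

/-- A fresh phase, in which no edge has been deleted. -/
theorem EdgeTable.phase {p : Params} {N : ℕ → Finset ℕ} {s : Memory} (hp : p.Admissible)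
    (hN : Neighbours p.n p.d N) (hm : s.vars 11 ≤ p.n * p.n)
    (hT : EdgeTable N (p.n ^ 3) (s.vars 11) (s.arrs 18) (s.arrs 19) (s.arrs 21))
    (hS : Split p.n (s.vars 11) p.Ld s)
    (h22 : ∀ x, s.arrs 22 x = 0) (h23 : ∀ x, s.arrs 23 x = 0)
    (hF : SetFam (p.n ^ 3) (s.arrs 14) (s.arrs 15) (s.arrs 16) (edgesOf (s.arrs 20) (s.vars 11))) :
    Phase p N s := by
  classical
  have hlost : ∀ v c, lost s (p.n ^ 3) v c = ∅ := by
    intro v c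
    rw [lost, Finset.filter_eq_empty_iff]
    intro e he h0
    simp only [edgesAt, Finset.mem_filter, Finset.mem_Icc] at he
    have := hT.id_left e he.1.1 he.1.2
    have := h0.2
    rw [edgeId] at this
    omega
  have hK : 2 ^ (p.Ld + 1) = 2 * p.K := by rw [Params.K]; ring
  exact
    { count_le := hm
      tail_lt := hS.tail_lt
      head_lt := hS.head_lt
      ne := fun e h1 h2 => (hN.ne _ _ (hT.adj e h1 h2)).symm
      inj := fun e e' h1 h2 h3 h4 => hT.edge_inj h1 h2 h3 h4
      support := hT.support
      symm := fun e h1 h2 => by rw [hT.id_right e h1 h2, edgeId, hT.id_left e h1 h2]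
      alive_adj := fun e h1 h2 _ => hT.adj e h1 h2
      class_ge := hS.class_ge
      class_lt := by rw [← hK]; exact hS.class_lt
      tails := hS.tails
      heads := hS.heads
      waiting := hS.waiting
      lost := fun v c _ => by rw [h22, hlost, Finset.card_empty]
      lossy := fun c => by
        rw [h23, lossy, eq_comm, Finset.card_eq_zero, Finset.filter_eq_empty_iff]
        intro v _
        rw [hlost, not_not]
        exact hp.fewIn_zero
      classes := hF }

-- Dirty nodes become clean with the counter 0, whereas clean nodes keep their counters and their
-- side; hence the charge drops by exactly the counters of `D`, which is what a rebuild is paid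
-- with. The old list `X` is arbitrary, because it may belong to a class that has just been given
-- up.
open Classical in
theorem Run.rebuild {p : Params} {N : ℕ → Finset ℕ} {B D X : Finset ℕ} {s : Memory}
    (hp : p.Admissible) (hM : p.Fit M) (hN : Neighbours p.n p.d N) (hC : Ctx p s)
    (hNodes : Nodes p N B D s) (hPhase : Phase p N s) (hDeg : Degrees p N B D (fun _ => 0) s)
    (hX : SetFam (p.n ^ 3) (s.arrs 11) (s.arrs 12) (s.arrs 13) (single X)) :
    Run M Cmd.rebuild s (1300 * p.Ld * ((B.card + D.card) * p.d + 1)) fun s' =>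
      ∃ B', Nodes p N B' ∅ s' ∧ Phase p N s' ∧ Degrees p N B' ∅ (fun _ => 0) s' ∧
        Listed (p.n ^ 3) (aliveOf s' (p.n ^ 3) (s'.vars 11) (s'.vars 12)) s' ∧
        s'.vars 11 ≤ (B.card + D.card) * p.d ∧ s'.vars 12 = p.K ∧ (∀ c, s'.arrs 23 c = 0) ∧
        dead s' (p.n ^ 3) = ∅ ∧ charge p s' + ∑ v ∈ D, s.arrs 17 v = charge p s := by
  have hn64 := hp.n_ge
  have hcube := hp.n_lt_cube
  have hsq := hp.sq_lt_cube
  have hQ := hp.cube_add_one_le hM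
  have hsq2 : p.n * p.n + p.n ≤ p.n ^ 3 := by
    have : p.n ^ 3 = p.n * p.n * p.n := by ring
    nlinarith
  have hd := hp.d_le
  have hd1 := hp.d_pos
  obtain ⟨big, hbig⟩ : ∃ big : ℕ → Prop, ∀ v, big v ↔
      ¬ (((s.arrs 4 v * (s.vars 5 * s.vars 5) : ℕ) : ℝ) ≤ M.θ 0 * ((2 * s.vars 4 : ℕ) : ℝ)) :=
    ⟨_, fun _ => Iff.rfl⟩
  set B' := B ∪ D.filter big with hB'
  have hB'card : B'.card ≤ B.card + D.card :=
    (Finset.card_union_le _ _).trans (Nat.add_le_add_left (Finset.card_filter_le _ _) _)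
  have hB'n : ∀ v ∈ B', v < p.n := by
    intro v hv
    rcases Finset.mem_union.1 hv with hv | hv
    · exact (hNodes.mem_clean v hv).1
    · exact ((hNodes.mem_dirty v).1 (Finset.mem_filter.1 hv).1).1
  have hB'le : B'.card ≤ p.n := by
    have := Finset.card_le_card (fun v hv => Finset.mem_range.2 (hB'n v hv) : B' ⊆ Finset.range p.n)
    simpa using this
  have hB'd : B'.card * p.d ≤ p.n * p.n := Nat.mul_le_mul hB'le hd
  -- This bounds the size of the old phase, by `Degrees.count`, as well as that of the new one, by
  -- the choice of `B'`.
  set w := (B.card + D.card) * p.d with hw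
  have hB'w : B'.card * p.d ≤ w := Nat.mul_le_mul_right _ hB'card
  have hB'w1 : B'.card ≤ w := le_trans hB'card (Nat.le_mul_of_pos_right _ hd1)
  have hDw : D.card ≤ w := le_trans (Nat.le_add_left _ _) (Nat.le_mul_of_pos_right _ hd1)
  have hLd := hp.Ld_pos
  have hcount := hDeg.count
  refine (Run.seq (Phase.cleanup hp hM hC hPhase) (T₂ := 130 * w + 90 + (100 * w + 50 +
    ((600 * w + 210) * p.Ld + 10 + (60 * w + 10 + (10 + (100 * w + 30))))))
    fun s₁ hS₁ _ h₁ => ?_).mono ?_ fun _ _ _ h => h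
  · refine (Run.seq (T₁ := 100 * w + 30) (T₂ := 130 * w + 100 +
      ((600 * w + 210) * p.Ld + 10 + (60 * w + 10 + (10 + (100 * w + 30)))))
      ((Run.reclassify (r := p.n ^ 3) (D := D) (B := B) (big := big) (by
        rw [hS₁.vars 8 (by decide), hC.cube]) hQ (by
        rw [hS₁.arrs 5 (by decide), hS₁.arrs 6 (by decide), hS₁.arrs 7 (by decide)]
        exact hNodes.dirty) (by
        rw [hS₁.arrs 8 (by decide), hS₁.arrs 9 (by decide), hS₁.arrs 10 (by decide)]
        exact hNodes.clean) hNodes.disjoint (by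
        rw [hS₁.arrs 27 (by decide)]; exact hNodes.flags) (by
        rw [hS₁.arrs 4 (by decide), hS₁.vars 5 (by decide), hS₁.vars 4 (by decide)]
        exact hbig)).mono (by omega) fun _ _ _ h => h)
      fun s₂ hS₂ _ h₂ => ?_).mono (by omega) fun _ _ _ h => h
    have hS12 := hS₁.trans hS₂
    obtain ⟨n1, n2, n3, n4⟩ := h₂
    rw [← hB'] at n2 n3
    have adj₂ : SetFam (p.n ^ 3) (s₂.arrs 2) (s₂.arrs 3) (s₂.arrs 4) N := by
      rw [hS12.arrs 2 (by decide), hS12.arrs 3 (by decide), hS12.arrs 4 (by decide)]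
      exact hNodes.adj
    refine Run.seq (T₁ := 130 * w + 50 + 50) (T₂ := (600 * w + 210) * p.Ld + 10 +
      (60 * w + 10 + (10 + (100 * w + 30))))
      ((Run.collect (n := p.n) (d := p.d) (r := p.n ^ 3) hN hcube.le (by
        rw [hS12.vars 8 (by decide), hC.cube]) adj₂ n2 (by
        rw [hS₂.arrs 21 (by decide)]; exact h₁.1) (by omega)).mono (by
          rw [Nat.mul_add, ← mul_assoc, mul_comm B'.card 80, mul_assoc]; omega) fun _ _ _ h => h)
      fun s₃ hS₃ _ h₃ => ?_
    obtain ⟨c1, c2, c3⟩ := h₃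
    have hS13 := hS12.trans hS₃
    have hm₃ : s₃.vars 11 ≤ w := c2.trans hB'w
    have hm₃' : s₃.vars 11 ≤ p.n * p.n := c2.trans hB'd
    have hlt : ∀ v, ∀ z ∈ N v, z < p.n := hN.lt
    have split₃ : Split p.n (s₃.vars 11) 0 s₃ :=
      { size := by rw [hS13.vars 8 (by decide), hC.cube]
        count := rfl
        tail_lt := fun e h1 h2 => hlt _ _ (hN.symm _ _ (c1.table.adj e h1 h2))
        head_lt := fun e h1 h2 => hlt _ _ (c1.table.adj e h1 h2)
        class_ge := fun e h1 h2 => by rw [c1.cls e h1 h2]; simp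
        class_lt := fun e h1 h2 => by rw [c1.cls e h1 h2]; simp
        tails := by
          intro v c h1 h2
          have hc : c = 1 := by simp at h1 h2; omega
          have : classCount (s₃.arrs 18) (s₃.arrs 20) (s₃.vars 11) v c =
              totalCount (s₃.arrs 18) (s₃.vars 11) v := by
            rw [classCount, totalCount]
            congr 1
            apply Finset.filter_congr
            intro e he
            simp at he
            simp [c1.cls e he.1 he.2, hc]
          rw [this]; simp
        heads := by
          intro v c h1 h2
          have hc : c = 1 := by simp at h1 h2; omega
          have : classCount (s₃.arrs 19) (s₃.arrs 20) (s₃.vars 11) v c =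
              totalCount (s₃.arrs 19) (s₃.vars 11) v := by
            rw [classCount, totalCount]
            congr 1
            apply Finset.filter_congr
            intro e he
            simp at he
            simp [c1.cls e he.1 he.2, hc]
          rw [this]; simp
        waiting := by rw [hS13.arrs 26 (by decide)]; exact hPhase.waiting }
    have h2K : 2 ^ (p.Ld + 1) = 2 * p.K := by rw [Params.K]; ring
    refine Run.seq (T₁ := (600 * w + 210) * p.Ld + 10) (T₂ := 60 * w + 10 + (10 + (100 * w + 30)))
      ((Run.split split₃ (by rw [hS13.vars 6 (by decide), hC.Ld]) (by
        rw [h2K]; have := hp.K_bound; omega) (by omega) (by omega) hM.Q).mono (by gcongr)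
        fun _ _ _ h => h) fun s₄ hS₄ _ h₄ => ?_
    have hS14 := hS13.trans hS₄
    refine Run.seq (T₁ := 60 * w + 10) (T₂ := 10 + (100 * w + 30))
      ((Run.distribute (r := p.n ^ 3) (m := s₃.vars 11) h₄.size h₄.count (by omega) hQ (by
        rw [hS₄.arrs 16 (by decide), hS₃.arrs 16 (by decide), hS₂.arrs 16 (by decide)]
        exact h₁.2.2.2)).mono (by omega) fun _ _ _ h => h) fun s₅ hS₅ _ h₅ => ?_
    have hS15 := hS14.trans hS₅
    refine Run.seq (P₁ := fun s₆ => s₆ = s₅.setVar 12 p.K) (T₁ := 10) (Run.block rfl rfl (by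
      simp [Cmd.wp, hS15.vars 9 (by decide), hC.K])) ?_
    rintro s₆ hS₆ _ rfl
    have hS45 := hS₅.trans hS₆
    have hS16 := hS15.trans hS₆
    have m₆ : (s₅.setVar 12 p.K).vars 11 = s₃.vars 11 := by rw [hS45.vars 11 (by decide), h₄.count]
    have f20 : (s₅.setVar 12 p.K).arrs 20 = s₄.arrs 20 := hS45.arrs 20 (by decide)
    refine (Run.load (r := p.n ^ 3) (m := s₃.vars 11) (c := p.K) (X := X) (by
      rw [hS16.vars 8 (by decide), hC.cube]) (by simp) (by omega) hQ (by rw [f20]; exact h₅) (by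
      rw [hS16.arrs 11 (by decide), hS16.arrs 12 (by decide), hS16.arrs 13 (by decide)]
      exact hX)).mono ?_ ?_
    · have : (edgesOf ((s₅.setVar 12 p.K).arrs 20) (s₃.vars 11) p.K).card ≤ s₃.vars 11 := by
        refine (Finset.card_filter_le _ _).trans ?_
        simp
      omega
    intro s₇ hS₇ _ hL
    have hS47 := hS45.trans hS₇
    have hS37 := hS₄.trans hS47
    have hS27 := hS₃.trans hS37
    have hS17 := hS₂.trans hS27
    have hS07 := hS₁.trans hS17
    have v11 : s₇.vars 11 = s₃.vars 11 := by rw [hS47.vars 11 (by decide), h₄.count]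
    have v12 : s₇.vars 12 = p.K := by rw [hS₇.vars 12 (by decide)]; simp
    have a18 : s₇.arrs 18 = s₃.arrs 18 := hS37.arrs 18 (by decide)
    have a19 : s₇.arrs 19 = s₃.arrs 19 := hS37.arrs 19 (by decide)
    have a21 : s₇.arrs 21 = s₃.arrs 21 := hS37.arrs 21 (by decide)
    have a20 : s₇.arrs 20 = s₄.arrs 20 := hS47.arrs 20 (by decide)
    have a17 : ∀ v, s₇.arrs 17 v = if v ∈ D then 0 else s.arrs 17 v := by
      intro v
      rw [hS27.arrs 17 (by decide), n4, hS₁.arrs 17 (by decide)]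
    have a23 : ∀ c, s₇.arrs 23 c = 0 := by rw [hS17.arrs 23 (by decide)]; exact h₁.2.2.1
    have tab : EdgeTable N (p.n ^ 3) (s₇.vars 11) (s₇.arrs 18) (s₇.arrs 19) (s₇.arrs 21) := by
      rw [v11, a18, a19, a21]; exact c1.table
    have hph : Phase p N s₇ := by
      refine tab.phase hp hN (by rw [v11]; exact hm₃') ?_ (by rw [hS17.arrs 22 (by decide)]; exact h₁.2.1)
        a23 ?_
      · have b18 := hS47.arrs 18 (by decide)
        have b19 := hS47.arrs 19 (by decide)
        rw [v11]
        exact ⟨by rw [hS07.vars 8 (by decide), hC.cube], v11, by rw [b18]; exact h₄.tail_lt,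
          by rw [b19]; exact h₄.head_lt, by rw [a20]; exact h₄.class_ge,
          by rw [a20]; exact h₄.class_lt, by rw [b18, a20]; exact h₄.tails,
          by rw [b19, a20]; exact h₄.heads, by rw [hS47.arrs 26 (by decide)]; exact h₄.waiting⟩
      · have hS57 := hS₆.trans hS₇
        rw [hS57.arrs 14 (by decide), hS57.arrs 15 (by decide), hS57.arrs 16 (by decide), a20, v11]
        exact h₅
    refine ⟨B', ?_, hph, ?_, ?_, by rw [v11]; exact hm₃, v12, a23, ?_, ?_⟩
    · exact
        { adj := by
            rw [hS27.arrs 2 (by decide), hS27.arrs 3 (by decide), hS27.arrs 4 (by decide)]; exact adj₂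
          dirty := by
            rw [hS27.arrs 5 (by decide), hS27.arrs 6 (by decide), hS27.arrs 7 (by decide)]; exact n1
          clean := by
            rw [hS27.arrs 8 (by decide), hS27.arrs 9 (by decide), hS27.arrs 10 (by decide)]; exact n2
          mem_dirty := by
            intro v
            simp only [Finset.notMem_empty, false_iff, not_and, not_not]
            intro hv
            rw [a17]
            split_ifs with hD
            · exact hp.few_zero
            · by_contra hf; exact hD ((hNodes.mem_dirty v).2 ⟨hv, hf⟩)
          mem_clean := by
            intro v hv
            refine ⟨hB'n v hv, ?_⟩
            rw [a17]
            split_ifs with hD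
            · exact hp.few_zero
            · by_contra hf; exact hD ((hNodes.mem_dirty v).2 ⟨hB'n v hv, hf⟩)
          flags := by rw [hS27.arrs 27 (by decide)]; exact n3 }
    · have hle := tab.edgesAt_card_le hN
      have hbv : ∀ v, big v ↔ p.ε * (2 * p.d) < ((N v).card : ℝ) * ((p.L : ℝ) * p.L) := by
        intro v
        simp only [hbig, not_le, hM.ε, hC.L, hC.d, hNodes.adj.card v]
        push_cast
        exact Iff.rfl
      have few : ∀ v < p.n, v ∉ D → p.Few (s.arrs 17 v) := by
        intro v hv hD
        by_contra hf; exact hD ((hNodes.mem_dirty v).2 ⟨hv, hf⟩)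
      refine ⟨fun v => (hle v).trans (hN.card v), fun v hv => ?_, fun v hv hvB _ => ?_,
        fun v _ _ => (hle v).trans (by omega), fun v hv => ?_, ?_, ?_, ?_, ?_⟩
      · rw [a17]
        by_cases hD : v ∈ D
        · have hvb : big v := by
            rcases Finset.mem_union.1 hv with h' | h'
            · exact absurd h' (Finset.disjoint_left.1 hNodes.disjoint hD)
            · exact (Finset.mem_filter.1 h').2
          simpa [hD] using (hbv v).1 hvb
        · have hvB : v ∈ B := by
            rcases Finset.mem_union.1 hv with h' | h'
            · exact h'
            · exact absurd (Finset.mem_filter.1 h').1 hD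
          simpa [hD] using hDeg.big v hvB
      · rw [a17]
        by_cases hD : v ∈ D
        · have hvb : ¬ big v := fun h' => hvB (Finset.mem_union_right _ (Finset.mem_filter.2 ⟨hD, h'⟩))
          rw [hbv] at hvb
          simpa [hD] using hvb
        · have hvB' : v ∉ B := fun h' => hvB (Finset.mem_union_left _ h')
          simpa [hD] using hDeg.small v hv hvB' (few v hv hD)
      · have := tab.card_le_edgesAt hN hcube.le (v := v) (by rw [a21]; exact c3 v hv)
        omega
      · rw [v11, Finset.card_empty, add_zero]; exact c2
      · intro c h1 h2; rw [v12] at h2; omega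
      · rw [v12]; omega
      · left; rw [v12]
    · have : aliveOf s₇ (p.n ^ 3) (s₇.vars 11) (s₇.vars 12) =
          aliveOf (s₅.setVar 12 p.K) (p.n ^ 3) (s₃.vars 11) p.K := by
        rw [aliveOf, aliveOf, v11, v12, hS₇.arrs 20 (by decide), hS₇.arrs 21 (by decide),
          hS₇.arrs 18 (by decide), hS₇.arrs 19 (by decide)]
      rw [this]; exact hL
    · rw [dead, Finset.filter_eq_empty_iff]
      intro e he h0
      simp only [Finset.mem_Icc] at he
      have := tab.id_left e he.1 he.2
      rw [edgeId] at h0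
      omega
    · have hDsub : D ⊆ Finset.range p.n := fun v hv =>
        Finset.mem_range.2 ((hNodes.mem_dirty v).1 hv).1
      have hch : charge p s = ∑ v ∈ D, s.arrs 17 v + ∑ v ∈ Finset.range p.n \ D, s.arrs 17 v := by
        rw [charge, add_comm, Finset.sum_sdiff hDsub]
      have hch' : charge p s₇ = ∑ v ∈ Finset.range p.n \ D, s.arrs 17 v := by
        rw [charge, ← Finset.sum_sdiff hDsub]
        rw [Finset.sum_congr rfl fun v hv => by rw [a17, if_neg (Finset.mem_sdiff.1 hv).2],
          Finset.sum_congr (s₁ := D) rfl fun v hv => by rw [a17, if_pos hv]]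
        simp
      rw [hch, hch']; ring
  · have h5 : w ≤ w * p.Ld := Nat.le_mul_of_pos_right _ hLd
    ring_nf
    ring_nf at h5
    omega

end DynSkeleton

namespace DynSkeleton

variable {M : Machine}

/-! ### The parts of an update -/

/-- The machine cannot divide by γ, but it can test 1 ≤ γ j, and the least such j is the number
sought. -/
theorem Params.Admissible.g_le_iff {p : Params} (hp : p.Admissible) (j : ℕ) :
    p.g ≤ j ↔ 1 ≤ p.γ * j := by
  rw [Params.g, Nat.ceil_le, div_le_iff₀ hp.γ_pos, mul_comm]

/-- The constants are computed afresh at every update; O(L_d + 1/γ) steps are within the allowed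
time. -/
theorem Run.setup {p : Params} {s : Memory} (hp : p.Admissible) (hM : p.Fit M) (h3 : s.vars 3 = p.n)
    (h4 : s.vars 4 = p.d) (h5 : s.vars 5 = p.L) (h6 : s.vars 6 = p.Ld) :
    Run M Cmd.setup s (20 * p.Ld + 50 * p.g + 100) (Ctx p) := by
  have hn := hp.n_ge
  have hQ := hp.cube_add_one_le hM
  have hn3 := hp.n_lt_cube
  have hcube : p.n * p.n * p.n = p.n ^ 3 := by ring
  refine (Run.seq (P₁ := fun s' => s' = s.setVar 8 (p.n ^ 3)) (T₁ := 10) (T₂ := 5 + ((6 + 10) * p.Ld + 10 +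
    (5 + (5 + (50 * p.g + 60))))) (Run.block rfl rfl (by
      simp [Cmd.wp, h3, hcube]; omega)) ?_).mono (by omega) fun _ _ _ h => h
  rintro s₁ hS₁ _ rfl
  refine Run.seq (P₁ := fun s' => s'.vars 9 = 1) (T₁ := 5) (Run.block rfl rfl (by simp [Cmd.wp])) ?_
  intro s₂ hS₂ _ h₂
  have hS02 := hS₁.trans hS₂
  refine Run.seq (Run.forUp (fun j s' => s'.vars 9 = 2 ^ j) p.Ld 6 (by decide) (by decide) (by decide)
    (by rw [hS02.vars 6 (by decide), h6]) h₂ (fun _ _ _ h => h) ?_) ?_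
  · intro j s' hS _ hj hij h'
    have h1 : 2 ^ (j + 1) ≤ p.K := Nat.pow_le_pow_right (by omega) (by omega)
    have h2 := hp.K_bound
    have h3 : 2 ^ (j + 1) = 2 ^ j + 2 ^ j := by ring
    refine Run.block rfl rfl ?_
    simp [Cmd.wp, h', h3]
    omega
  intro s₃ hS₃ _ h₃
  refine Run.seq (P₁ := fun s' => s'.vars 10 = 0) (T₁ := 5) (Run.block rfl rfl (by simp [Cmd.wp])) ?_
  intro s₄ hS₄ _ h₄
  refine Run.seq (P₁ := fun s' => s'.vars 10 = 0 ∧ s'.vars 13 = 1) (T₁ := 5)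
    (Run.block rfl rfl (by simp [Cmd.wp, h₄])) ?_
  intro s₅ hS₅ _ ⟨h10, h13⟩
  have hS05 := ((hS02.trans hS₃).trans hS₄).trans hS₅
  refine RunT.mono (RunT.loop (by rfl) (fun k s' => s'.vars 10 ≤ p.g ∧ s'.vars 13 ≤ 1 ∧
    (s'.vars 13 = 0 → s'.vars 10 = p.g) ∧ k = 40 * (p.g - s'.vars 10) + 40 * s'.vars 13) ?_
    (k := 40 * p.g + 40) ⟨by omega, by omega, by omega, by omega⟩) ?_
  · rintro k s' ⟨g1, g2, g3, rfl⟩ hb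
    have hb1 : s'.vars 13 = 1 := by simpa using hb
    have hgn := hp.g_le
    by_cases hg : p.g ≤ s'.vars 10
    · have hg' := (hp.g_le_iff _).1 hg
      refine RunT.mono (Run.block (T := 20) rfl rfl (P := fun s'' => s''.vars 13 = 0 ∧
        s''.vars 10 = s'.vars 10) ?_) ?_
      · simp [Cmd.wp, hM.γ, hg']
      · rintro s'' t _ _ ⟨ht, k1, k2⟩
        refine ⟨_, ⟨by omega, by omega, by omega, rfl⟩, ?_⟩
        rw [hb1, k1, k2]; simp [Test.cost, Expr.cost]; omega
    · have hg' := fun h => hg ((hp.g_le_iff _).2 h)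
      refine RunT.mono (Run.block (T := 20) rfl rfl (P := fun s'' => s''.vars 13 = 1 ∧
        s''.vars 10 = s'.vars 10 + 1) ?_) ?_
      · exact ⟨fun h => absurd (by simpa [hM.γ] using h) hg',
          fun _ => ⟨by simp; have := M.le_Q; have := hM.Q; have := Nat.le_self_pow (n := 8) (by omega) p.n; omega, by simp [hb1]⟩⟩
      · rintro s'' t _ _ ⟨ht, k1, k2⟩
        refine ⟨_, ⟨by omega, by omega, by omega, rfl⟩, ?_⟩
        rw [hb1, k1, k2]; simp [Test.cost, Expr.cost]; omega
  · rintro s₆ t hS₆ _ ⟨k, ⟨g1, g2, g3, rfl⟩, hb, hk⟩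
    have hb0 : s₆.vars 13 ≠ 1 := by simpa using hb
    have hS06 := hS05.trans hS₆
    refine ⟨by simp [Test.cost, Expr.cost] at hk; omega, ?_, ?_, ?_, ?_, ?_, ?_, g3 (by omega)⟩
    · rw [hS06.vars 3 (by decide), h3]
    · rw [hS06.vars 4 (by decide), h4]
    · rw [hS06.vars 5 (by decide), h5]
    · rw [hS06.vars 6 (by decide), h6]
    · have hS26 := (((hS₂.trans hS₃).trans hS₄).trans hS₅).trans hS₆
      rw [hS26.vars 8 (by decide)]; simp
    · rw [((hS₄.trans hS₅).trans hS₆).vars 9 (by decide), h₃]; rfl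

/-- The neighbourhoods after the insertion of an edge. -/
def addEdge (N : ℕ → Finset ℕ) (u v : ℕ) : ℕ → Finset ℕ :=
  Function.update (Function.update N u (insert v (N u))) v (insert u (N v))

/-- The neighbourhoods after the deletion of an edge. -/
def removeEdge (N : ℕ → Finset ℕ) (u v : ℕ) : ℕ → Finset ℕ :=
  Function.update (Function.update N u ((N u).erase v)) v ((N v).erase u)

theorem Run.insertEdge {r u v : ℕ} {N : ℕ → Finset ℕ} {s : Memory} (h8 : s.vars 8 = r)
    (hQ : r + 1 ≤ M.Q) (h1 : s.vars 1 = u) (h2 : s.vars 2 = v) (huv : u ≠ v) (hu : u < r) (hv : v < r)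
    (huN : v ∉ N u) (hvN : u ∉ N v) (hF : SetFam r (s.arrs 2) (s.arrs 3) (s.arrs 4) N) :
    Run M Cmd.insertEdge s 80 fun s' =>
      SetFam r (s'.arrs 2) (s'.arrs 3) (s'.arrs 4) (addEdge N u v) := by
  refine (Run.seq (P₁ := fun s' => s' = (s.setVar 14 u).setVar 15 v) (T₁ := 5) (T₂ := 30 + (5 + 30))
    (Run.block rfl rfl (by simp [Cmd.wp, h1, h2])) ?_).mono (by omega) fun _ _ _ h => h
  rintro s₁ hS₁ _ rfl
  refine Run.seq (Run.setInsert (m := r) (b := u) (x := v) (by decide) (by decide) (by decide) hF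
    (by simpa using h8) (by simp) (by simp) hv huN hQ) ?_
  rintro s₂ hS₂ _ ⟨g1, -, -⟩
  have hS02 := hS₁.trans hS₂
  refine Run.seq (P₁ := fun s' => s' = (s₂.setVar 14 v).setVar 15 u) (T₁ := 5) (Run.block rfl rfl (by
    simp [Cmd.wp, hS02.vars 1 (by decide), hS02.vars 2 (by decide), h1, h2])) ?_
  rintro s₃ hS₃ _ rfl
  have hS03 := hS02.trans hS₃
  refine (Run.setInsert (m := r) (b := v) (x := u) (s := (s₂.setVar 14 v).setVar 15 u) (by decide) (by decide) (by decide)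
    g1 (by rw [hS03.vars 8 (by decide), h8]) (by simp) (by simp) hu
    (by rwa [Function.update_of_ne huv.symm]) hQ).mono le_rfl ?_
  rintro s₄ _ _ ⟨g2, -, -⟩
  rw [Function.update_of_ne huv.symm] at g2
  exact g2

theorem Run.eraseEdge {r u v : ℕ} {N : ℕ → Finset ℕ} {s : Memory} (h8 : s.vars 8 = r)
    (hQ : r + 1 ≤ M.Q) (h1 : s.vars 1 = u) (h2 : s.vars 2 = v) (huv : u ≠ v)
    (huN : v ∈ N u) (hvN : u ∈ N v) (hF : SetFam r (s.arrs 2) (s.arrs 3) (s.arrs 4) N) :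
    Run M Cmd.eraseEdge s 90 fun s' =>
      SetFam r (s'.arrs 2) (s'.arrs 3) (s'.arrs 4) (removeEdge N u v) := by
  refine (Run.seq (P₁ := fun s' => s' = (s.setVar 14 u).setVar 15 v) (T₁ := 5) (T₂ := 40 + (5 + 40))
    (Run.block rfl rfl (by simp [Cmd.wp, h1, h2])) ?_).mono (by omega) fun _ _ _ h => h
  rintro s₁ hS₁ _ rfl
  refine Run.seq (Run.setErase (m := r) (b := u) (x := v) (by decide) (by decide) (by decide) hF
    (by simpa using h8) (by simp) (by simp) huN hQ) ?_
  rintro s₂ hS₂ _ ⟨g1, -, -⟩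
  have hS02 := hS₁.trans hS₂
  refine Run.seq (P₁ := fun s' => s' = (s₂.setVar 14 v).setVar 15 u) (T₁ := 5) (Run.block rfl rfl (by
    simp [Cmd.wp, hS02.vars 1 (by decide), hS02.vars 2 (by decide), h1, h2])) ?_
  rintro s₃ hS₃ _ rfl
  have hS03 := hS02.trans hS₃
  refine (Run.setErase (m := r) (b := v) (x := u) (s := (s₂.setVar 14 v).setVar 15 u) (by decide) (by decide) (by decide)
    g1 (by rw [hS03.vars 8 (by decide), h8]) (by simp) (by simp)
    (by rwa [Function.update_of_ne huv.symm]) hQ).mono le_rfl ?_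
  rintro s₄ _ _ ⟨g2, -, -⟩
  rw [Function.update_of_ne huv.symm] at g2
  exact g2

/-! ### Counting updates at a node -/

theorem Ctx.cleanTest {p : Params} {s : Memory} {v : ℕ} (hM : p.Fit M) (hC : Ctx p s)
    (h15 : s.vars 15 = v) : Cmd.cleanTest.Holds M.θ s ↔ p.Few (s.arrs 17 v) := by
  simp only [Cmd.cleanTest, Test.holds_ltParam, Expr.val_mul, Expr.val_read, Expr.val_var,
    Expr.val_const, hC.L, hC.g, hC.d, hM.ε, h15, Params.Few]

/-- This guards against overflow: the counter of a clean node stays below d, since ε < 1 and 12 L² g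
≥ 1. -/
theorem Params.Admissible.Few.le {p : Params} (hp : p.Admissible) {x : ℕ} (h : p.Few x) :
    x < p.d := by
  have h1 := hp.ε_pos
  have h2 := hp.ε_lt
  have h3 := hp.L_pos
  have h4 : 1 ≤ p.g := by
    by_contra h'
    have h0 : p.g = 0 := by omega
    have := hp.one_le_γ_g
    rw [h0] at this; norm_num at this
  have h5 : x * 1 ≤ x * (12 * (p.L * p.L * p.g)) := by
    apply Nat.mul_le_mul_left
    have : 0 < 12 * (p.L * p.L * p.g) := by positivity
    omega
  have h6 : (x : ℝ) ≤ ((x * (12 * (p.L * p.L * p.g)) : ℕ) : ℝ) := by exact_mod_cast (by omega)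
  have h7 : (0 : ℝ) < p.d := by exact_mod_cast hp.d_pos
  rw [Params.Few] at h
  have : (x : ℝ) < p.d := by nlinarith
  exact_mod_cast this

theorem Params.FewIn.anti {p : Params} {x y : ℕ} (hxy : x ≤ y) (h : p.FewIn y) : p.FewIn x := by
  rw [Params.FewIn] at h ⊢
  refine lt_of_le_of_lt ?_ h
  exact_mod_cast Nat.mul_le_mul_right _ hxy

theorem edgesAt_congr {s s' : Memory} (h11 : s'.vars 11 = s.vars 11)
    (hA : ∀ a ∈ [18, 19], s'.arrs a = s.arrs a) : edgesAt s' = edgesAt s := by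
  funext v
  rw [edgesAt, edgesAt, h11, hA 18 (by simp), hA 19 (by simp)]

theorem charge_congr {p : Params} {s s' : Memory} (h : s'.arrs 17 = s.arrs 17) :
    charge p s' = charge p s := by
  rw [charge, charge, h]

theorem Degrees.congr {p : Params} {N : ℕ → Finset ℕ} {B D : Finset ℕ} {σ : ℕ → ℕ} {s s' : Memory}
    (h : Degrees p N B D σ s) (h11 : s'.vars 11 = s.vars 11) (h12 : s'.vars 12 = s.vars 12)
    (hA : ∀ a ∈ [17, 18, 19, 23], s'.arrs a = s.arrs a) : Degrees p N B D σ s' := by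
  have he := edgesAt_congr (s := s) (s' := s') h11 fun a ha => hA a (by simp at ha ⊢; omega)
  obtain ⟨g1, g2, g3, g4, g5, g6, g7, g8, g9⟩ := h
  have h17 := hA 17 (by simp)
  have h23 := hA 23 (by simp)
  exact ⟨by rwa [he], by rwa [h17], by rwa [h17], by rwa [he, h17], by rwa [he, h17], by rwa [h11],
    by rwa [h12, h23], by rwa [h12], by rwa [h11, h12]⟩

/-- The node `v` gets a charge of `1`, and becomes dirty if that is too much. -/
theorem Run.touch {p : Params} {N : ℕ → Finset ℕ} {B D : Finset ℕ} {σ : ℕ → ℕ} {s : Memory} {v : ℕ}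
    (hp : p.Admissible) (hM : p.Fit M) (hC : Ctx p s) (hN : Nodes p N B D s)
    (hD : Degrees p N B D σ s) (h15 : s.vars 15 = v) (hv : v < p.n) (hσ : σ v ≤ 1) :
    Run M Cmd.touch s 200 fun s' => ∃ B' D', Nodes p N B' D' s' ∧
      Degrees p N B' D' (Function.update σ v 0) s' ∧ charge p s' ≤ charge p s + 1 := by
  have hQ := hp.cube_add_one_le hM
  have hcube := hp.n_lt_cube
  have hT := hC.cleanTest hM h15
  have hσ' : ∀ w, w ≠ v → Function.update σ v 0 w = σ w := fun w hw => Function.update_of_ne hw _ _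
  refine (Run.ite (T := 150) rfl (fun hb => ?_) (fun hb => ?_)).mono (by decide) fun _ _ _ h => h
  · rw [hT] at hb
    have hlt := Params.Admissible.Few.le hp hb
    have hd := hp.d_le
    set x := s.arrs 17 v with hx
    set f := Function.update (s.arrs 17) v (x + 1) with hf
    have hfv : f v = x + 1 := by rw [hf, Function.update_self]
    have hfw : ∀ w, w ≠ v → f w = s.arrs 17 w := fun w hw => Function.update_of_ne hw _ _
    have hcharge : ∀ s' : Memory, s'.arrs 17 = f → charge p s' ≤ charge p s + 1 := by
      intro s' hs'
      rw [charge, charge, hs', hf, Finset.sum_update_of_mem (Finset.mem_range.2 hv),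
        ← Finset.sum_sdiff (Finset.singleton_subset_iff.2 (Finset.mem_range.2 hv)),
        Finset.sum_singleton]
      omega
    have hvD : v ∉ D := fun h => ((hN.mem_dirty v).1 h).2 hb
    -- The incremented counter absorbs the pending update, because `σ v ≤ 1`.
    have hfσ : (x : ℝ) + σ v ≤ (x + 1 : ℕ) := by exact_mod_cast (by omega)
    have hL2 : (0 : ℝ) ≤ (p.L : ℝ) * p.L := by positivity
    refine (Run.seq (P₁ := fun s' => s' = s.setArr 17 v (x + 1)) (T₁ := 10) (T₂ := 140)
      (Run.block rfl rfl (by simp [Cmd.wp, h15, ← hx]; omega)) ?_).mono (by omega) fun _ _ _ h => h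
    rintro s₁ hS₁ _ rfl
    have hC₁ : Ctx p (s.setArr 17 v (x + 1)) := hC.same hS₁ (by decide)
    have hT₁ := hC₁.cleanTest hM (v := v) (by simpa using h15)
    have hf₁ : (s.setArr 17 v (x + 1)).arrs 17 = f := by simp [hf, hx]
    have he₁ := edgesAt_congr (s := s) (s' := s.setArr 17 v (x + 1)) rfl (by simp)
    rw [hf₁, hfv] at hT₁
    refine (Run.ite (T := 100) rfl (fun hb₁ => ?_) (fun hb₁ => ?_)).mono (by decide) fun _ _ _ h => h
    · rw [hT₁] at hb₁
      have hfew : ∀ w, p.Few (f w) ↔ p.Few (s.arrs 17 w) := by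
        intro w
        by_cases hw : w = v
        · subst hw; rw [hfv]; exact ⟨fun _ => hb, fun _ => hb₁⟩
        · rw [hfw w hw]
      refine Run.block rfl rfl ⟨B, D, ⟨hN.adj, hN.dirty, hN.clean, fun w => ?_, fun w hw => ?_, hN.flags⟩,
        ⟨by rw [he₁]; exact hD.edgesAt_le, fun w hw => ?_, fun w hw hwB hfw' => ?_,
          fun w hw hfw' => ?_, fun w hw => ?_, hD.count, hD.passed, hD.cur_le, hD.cur_ge⟩, hcharge _ hf₁⟩
      · rw [hf₁, hfew]; exact hN.mem_dirty w
      · rw [hf₁, hfew]; exact hN.mem_clean w hw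
      · have := hD.big w hw
        rw [hf₁]
        by_cases hwv : w = v
        · subst hwv
          rw [hfv, Function.update_self]
          refine lt_of_lt_of_le this (mul_le_mul_of_nonneg_right ?_ hL2)
          push_cast at hfσ ⊢; linarith
        · rwa [hfw w hwv, hσ' w hwv]
      · rw [hf₁] at hfw' ⊢
        have := hD.small w hw hwB ((hfew w).1 hfw')
        by_cases hwv : w = v
        · subst hwv
          rw [hfv, Function.update_self]
          refine this.trans (add_le_add le_rfl (mul_le_mul_of_nonneg_right ?_ hL2))
          rw [← hx]
          push_cast at hfσ ⊢; linarith
        · rwa [hfw w hwv, hσ' w hwv]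
      · rw [hf₁] at hfw' ⊢
        have := hD.edges_le w hw ((hfew w).1 hfw')
        rw [he₁]
        by_cases hwv : w = v
        · subst hwv; rw [hfv, Function.update_self]; omega
        · rwa [hfw w hwv, hσ' w hwv]
      · have := hD.le_edges w hw
        rw [he₁, hf₁]
        by_cases hwv : w = v
        · subst hwv; rw [hfv, Function.update_self]; omega
        · rwa [hfw w hwv, hσ' w hwv]
    · rw [hT₁] at hb₁
      have hfew : ∀ w, p.Few (f w) ↔ w ≠ v ∧ p.Few (s.arrs 17 w) := by
        intro w
        by_cases hw : w = v
        · subst hw; rw [hfv]; simp [hb₁]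
        · rw [hfw w hw]; simp [hw]
      have hdirty : ∀ w, w ∈ insert v D ↔ w < p.n ∧ ¬ p.Few (f w) := by
        intro w
        rw [hfew, Finset.mem_insert, hN.mem_dirty]
        by_cases hw : w = v
        · subst hw; simp [hv]
        · simp [hw]
      have hcleanB : ∀ w ∈ B.erase v, w < p.n ∧ p.Few (f w) := by
        intro w hw
        rw [Finset.mem_erase] at hw
        have := hN.mem_clean w hw.2
        exact ⟨this.1, (hfew w).2 ⟨hw.1, this.2⟩⟩
      have hBcard : (B.erase v).card ≤ B.card := Finset.card_le_card (Finset.erase_subset _ _)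
      have hdeg : ∀ s' : Memory, s'.arrs 17 = f → s'.vars 11 = s.vars 11 → s'.vars 12 = s.vars 12 →
          (∀ a ∈ [18, 19], s'.arrs a = s.arrs a) → s'.arrs 23 = s.arrs 23 →
          Degrees p N (B.erase v) (insert v D) (Function.update σ v 0) s' := by
        intro s' k17 k11 k12 kA k23
        have he := edgesAt_congr k11 kA
        refine ⟨by rw [he]; exact hD.edgesAt_le, fun w hw => ?_, fun w hw hwB hfw' => ?_,
          fun w hw hfw' => ?_, fun w hw => ?_, ?_, fun c h1 h2 => ?_, by rw [k12]; exact hD.cur_le,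
          by rw [k12, k11]; exact hD.cur_ge⟩
        · rw [Finset.mem_erase] at hw
          rw [k17, hfw w hw.1, hσ' w hw.1]; exact hD.big w hw.2
        · rw [k17, hfew] at hfw'
          rw [k17, hfw w hfw'.1, hσ' w hfw'.1]
          exact hD.small w hw (fun h' => hwB (Finset.mem_erase.2 ⟨hfw'.1, h'⟩)) hfw'.2
        · rw [k17, hfew] at hfw'
          rw [he, k17, hfw w hfw'.1, hσ' w hfw'.1]; exact hD.edges_le w hw hfw'.2
        · rw [Finset.mem_erase] at hw
          rw [he, k17, hfw w hw.1, hσ' w hw.1]; exact hD.le_edges w hw.2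
        -- A node that leaves `B` enters `D`, so |B| + |D| does not decrease and still bounds the
        -- size of the phase.
        · rw [k11, Finset.card_insert_of_notMem hvD]
          refine hD.count.trans (Nat.mul_le_mul_right _ ?_)
          have := Finset.pred_card_le_card_erase (s := B) (a := v)
          omega
        -- Within a phase `B` only shrinks; the threshold 2δ|B| falls, and classes that were given
        -- up remain above it.
        · rw [k12] at h2
          rw [k23]
          refine lt_of_le_of_lt ?_ (hD.passed c h1 h2)
          exact mul_le_mul_of_nonneg_left (by exact_mod_cast (by omega)) hp.δ_pos.le
      refine (Run.seq (P₁ := fun s' => s' = (s.setArr 17 v (x + 1)).setVar 14 0) (T₁ := 5) (T₂ := 95)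
        (Run.block rfl rfl (by simp [Cmd.wp])) ?_).mono (by omega) fun _ _ _ h => h
      rintro s₂ hS₂ _ rfl
      have hS02 := hS₁.trans hS₂
      refine (Run.seq (T₂ := 60) (Run.setInsert (m := p.n ^ 3) (b := 0) (x := v) (F := single D) (by decide)
        (by decide) (by decide) (by simpa using hN.dirty) (by rw [hS02.vars 8 (by decide), hC.cube])
        (by simp) (by simpa using h15) (by omega) (by simpa using hvD) hQ) ?_).mono (by omega)
        fun _ _ _ h => h
      rintro s₃ hS₃ _ ⟨k1, -, -⟩
      rw [single_zero, update_single] at k1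
      have hS03 := hS02.trans hS₃
      have hS23 := hS₂.trans hS₃
      have f17 : s₃.arrs 17 = f := by rw [hS23.arrs 17 (by decide), hf₁]
      have f27 : s₃.arrs 27 = flag B := by rw [hS03.arrs 27 (by decide), hN.flags]
      have f15 : s₃.vars 15 = v := by rw [hS03.vars 15 (by decide), h15]
      have clean₃ : SetFam (p.n ^ 3) (s₃.arrs 8) (s₃.arrs 9) (s₃.arrs 10) (single B) := by
        rw [hS03.arrs 8 (by decide), hS03.arrs 9 (by decide), hS03.arrs 10 (by decide)]
        exact hN.clean
      have adj₃ : SetFam (p.n ^ 3) (s₃.arrs 2) (s₃.arrs 3) (s₃.arrs 4) N := by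
        rw [hS03.arrs 2 (by decide), hS03.arrs 3 (by decide), hS03.arrs 4 (by decide)]
        exact hN.adj
      refine (Run.ite (T := 50) rfl (fun hb₃ => ?_) (fun hb₃ => ?_)).mono (by decide) fun _ _ _ h => h
      · have hvB : v ∉ B := by
          have : flag B v = 0 := by simpa [f15, f27] using hb₃
          intro h'; rw [flag, if_pos h'] at this; omega
        refine Run.block rfl rfl ⟨B.erase v, insert v D, ⟨adj₃, k1, ?_, ?_, ?_, ?_⟩, hdeg _ f17
          (hS03.vars 11 (by decide)) (hS03.vars 12 (by decide)) ?_ (hS03.arrs 23 (by decide)),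
          hcharge _ f17⟩
        · rw [Finset.erase_eq_of_notMem hvB]; exact clean₃
        · rw [f17]; exact hdirty
        · rw [f17]; exact hcleanB
        · rw [Finset.erase_eq_of_notMem hvB, f27]
        · simp only [List.mem_cons, List.not_mem_nil, or_false, forall_eq_or_imp, forall_eq]
          exact ⟨hS03.arrs 18 (by decide), hS03.arrs 19 (by decide)⟩
      · have hvB : v ∈ B := by
          have : ¬ flag B v = 0 := by simpa [f15, f27] using hb₃
          by_contra h'; rw [flag, if_neg h'] at this; omega
        refine (Run.seq (P₁ := fun s' => s' = s₃.setArr 27 v 0) (T₁ := 5) (T₂ := 40)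
          (Run.block rfl rfl (by simp [Cmd.wp, f15])) ?_).mono (by omega) fun _ _ _ h => h
        rintro s₄ hS₄ _ rfl
        have hv14 : s₃.vars 14 = 0 := by rw [hS₃.vars 14 (by decide)]; simp
        refine (Run.setErase (m := p.n ^ 3) (b := 0) (x := v) (F := single B) (by decide)
          (by decide) (by decide) (by simpa using clean₃)
          (by rw [hS₄.vars 8 (by decide), hS03.vars 8 (by decide), hC.cube])
          (by simpa using hv14) (by simpa using f15) (by simpa using hvB) hQ).mono le_rfl ?_
        rintro s₅ hS₅ _ ⟨k2, -⟩
        rw [single_zero, update_single] at k2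
        have hS35 := hS₄.trans hS₅
        have hS05 := hS03.trans hS35
        have f17' : s₅.arrs 17 = f := by rw [hS35.arrs 17 (by decide), f17]
        refine ⟨B.erase v, insert v D, ⟨?_, ?_, k2, ?_, ?_, ?_⟩, hdeg _ f17'
          (hS05.vars 11 (by decide)) (hS05.vars 12 (by decide)) ?_ (hS05.arrs 23 (by decide)),
          hcharge _ f17'⟩
        · rw [hS35.arrs 2 (by decide), hS35.arrs 3 (by decide), hS35.arrs 4 (by decide)]; exact adj₃
        · rw [hS35.arrs 5 (by decide), hS35.arrs 6 (by decide), hS35.arrs 7 (by decide)]; exact k1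
        · rw [f17']; exact hdirty
        · rw [f17']; exact hcleanB
        · rw [hS₅.arrs 27 (by decide), ← update_flag_erase, ← f27]; simp
        · simp only [List.mem_cons, List.not_mem_nil, or_false, forall_eq_or_imp, forall_eq]
          exact ⟨hS05.arrs 18 (by decide), hS05.arrs 19 (by decide)⟩
  -- The counter of a dirty node is frozen. All estimates concern clean nodes only, so the pending
  -- update at `v` may be forgotten.
  · rw [hT] at hb
    refine Run.block rfl rfl ⟨B, D, hN, ⟨hD.edgesAt_le, fun w hw => ?_, fun w hw hwB hfw => ?_,
      fun w hw hfw => ?_, fun w hw => ?_, hD.count, hD.passed, hD.cur_le, hD.cur_ge⟩, Nat.le_succ _⟩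
    · have hwv : w ≠ v := by rintro rfl; exact hb (hN.mem_clean w hw).2
      rw [hσ' w hwv]; exact hD.big w hw
    · have hwv : w ≠ v := by rintro rfl; exact hb hfw
      rw [hσ' w hwv]; exact hD.small w hw hwB hfw
    · have hwv : w ≠ v := by rintro rfl; exact hb hfw
      rw [hσ' w hwv]; exact hD.edges_le w hw hfw
    · have hwv : w ≠ v := by rintro rfl; exact hb (hN.mem_clean w hw).2
      rw [hσ' w hwv]; exact hD.le_edges w hw

end DynSkeleton

namespace DynSkeleton

variable {M : Machine}

/-! ### The phase under edge updates -/

theorem edgeId_congr {s s' : Memory} (hA : ∀ a ∈ [18, 19, 21], s'.arrs a = s.arrs a) :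
    edgeId s' = edgeId s := by
  funext r e
  rw [edgeId, edgeId, hA 18 (by simp), hA 19 (by simp), hA 21 (by simp)]

theorem dead_congr {s s' : Memory} (h11 : s'.vars 11 = s.vars 11)
    (hA : ∀ a ∈ [18, 19, 21], s'.arrs a = s.arrs a) : dead s' = dead s := by
  funext r
  rw [dead, dead, h11, edgeId_congr hA]

theorem lost_congr {s s' : Memory} (h11 : s'.vars 11 = s.vars 11)
    (hA : ∀ a ∈ [18, 19, 20, 21], s'.arrs a = s.arrs a) : lost s' = lost s := by
  funext r v c
  rw [lost, lost, hA 20 (by simp), edgesAt_congr h11 fun a ha => hA a (by simp at ha ⊢; omega),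
    edgeId_congr fun a ha => hA a (by simp at ha ⊢; omega)]

theorem lossy_congr {p : Params} {s s' : Memory} (h11 : s'.vars 11 = s.vars 11)
    (hA : ∀ a ∈ [18, 19, 20, 21], s'.arrs a = s.arrs a) : lossy p s' = lossy p s := by
  funext c
  rw [lossy, lossy, lost_congr h11 hA]

theorem remaining_congr {p : Params} {s s' : Memory} (h11 : s'.vars 11 = s.vars 11)
    (h12 : s'.vars 12 = s.vars 12) (h20 : s'.arrs 20 = s.arrs 20) :
    remaining p s' = remaining p s := by
  rw [remaining, remaining, h11, h12, h20]

theorem aliveOf_congr {s s' : Memory} (hA : ∀ a ∈ [18, 19, 20, 21], s'.arrs a = s.arrs a) :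
    aliveOf s' = aliveOf s := by
  funext r m c
  rw [aliveOf, aliveOf, hA 18 (by simp), hA 19 (by simp), hA 20 (by simp), hA 21 (by simp)]

theorem Listed.congr {r : ℕ} {X : Finset ℕ} {s s' : Memory} (h : Listed r X s)
    (hA : ∀ a ∈ [0, 1, 11, 12, 13, 18, 19], s'.arrs a = s.arrs a) : Listed r X s' := by
  obtain ⟨h1, h2, h3⟩ := h
  refine ⟨?_, ?_, ?_⟩
  · rwa [hA 11 (by simp), hA 12 (by simp), hA 13 (by simp)]
  · rwa [hA 0 (by simp), hA 18 (by simp), hA 11 (by simp)]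
  · rwa [hA 1 (by simp), hA 19 (by simp), hA 11 (by simp)]

theorem Nodes.congr {p : Params} {N : ℕ → Finset ℕ} {B D : Finset ℕ} {s s' : Memory}
    (h : Nodes p N B D s)
    (hA : ∀ a ∈ [2, 3, 4, 5, 6, 7, 8, 9, 10, 17, 27], s'.arrs a = s.arrs a) : Nodes p N B D s' := by
  obtain ⟨h1, h2, h3, h4, h5, h6⟩ := h
  refine ⟨?_, ?_, ?_, ?_, ?_, ?_⟩
  · rwa [hA 2 (by simp), hA 3 (by simp), hA 4 (by simp)]
  · rwa [hA 5 (by simp), hA 6 (by simp), hA 7 (by simp)]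
  · rwa [hA 8 (by simp), hA 9 (by simp), hA 10 (by simp)]
  · rwa [hA 17 (by simp)]
  · rwa [hA 17 (by simp)]
  · rwa [hA 27 (by simp)]

theorem Phase.congr {p : Params} {N N' : ℕ → Finset ℕ} {s s' : Memory} (h : Phase p N s)
    (h11 : s'.vars 11 = s.vars 11)
    (hA : ∀ a ∈ [14, 15, 16, 18, 19, 20, 21, 22, 23, 26], s'.arrs a = s.arrs a)
    (hN : ∀ e, 1 ≤ e → e ≤ s.vars 11 → edgeId s (p.n ^ 3) e ≠ 0 →
      s.arrs 19 e ∈ N (s.arrs 18 e) → s.arrs 19 e ∈ N' (s.arrs 18 e)) : Phase p N' s' := by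
  have a18 := hA 18 (by simp)
  have a19 := hA 19 (by simp)
  have a20 := hA 20 (by simp)
  have a21 := hA 21 (by simp)
  have hl := lost_congr h11 (s := s) (s' := s') fun a ha => hA a (by simp at ha ⊢; omega)
  have hl' := lossy_congr (p := p) h11 (s := s) (s' := s') fun a ha => hA a (by simp at ha ⊢; omega)
  have hi := edgeId_congr (s := s) (s' := s') fun a ha => hA a (by simp at ha ⊢; omega)
  exact
    { count_le := by rw [h11]; exact h.count_le
      tail_lt := by rw [h11, a18]; exact h.tail_lt
      head_lt := by rw [h11, a19]; exact h.head_lt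
      ne := by rw [h11, a18, a19]; exact h.ne
      inj := by rw [h11, a18, a19]; exact h.inj
      support := by rw [h11, a18, a19, a21]; exact h.support
      symm := by rw [h11, a18, a19, a21, hi]; exact h.symm
      alive_adj := by
        rw [h11, a18, a19, hi]
        exact fun e h1 h2 h3 => hN e h1 h2 h3 (h.alive_adj e h1 h2 h3)
      class_ge := by rw [h11, a20]; exact h.class_ge
      class_lt := by rw [h11, a20]; exact h.class_lt
      tails := by rw [h11, a18, a20]; exact h.tails
      heads := by rw [h11, a19, a20]; exact h.heads
      waiting := by rw [hA 26 (by simp)]; exact h.waiting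
      lost := by rw [hA 22 (by simp), hl]; exact h.lost
      lossy := by rw [hA 23 (by simp), hl']; exact h.lossy
      classes := by
        rw [h11, hA 14 (by simp), hA 15 (by simp), hA 16 (by simp), a20]; exact h.classes }

/-- A degree moves by at most `σ v`, and each estimate contains `σ v` as slack in the direction in
which it could fail. Classes that were given up stay bad, since the numbers of lossy nodes do not
decrease. -/
theorem Degrees.edge_change {p : Params} {N N' : ℕ → Finset ℕ} {B D : Finset ℕ} {σ : ℕ → ℕ}
    {s s' : Memory} (h : Degrees p N B D (fun _ => 0) s) (h11 : s'.vars 11 = s.vars 11)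
    (h12 : s'.vars 12 = s.vars 12) (hA : ∀ a ∈ [17, 18, 19], s'.arrs a = s.arrs a)
    (h23 : ∀ c, s.arrs 23 c ≤ s'.arrs 23 c) (h1 : ∀ v, (N v).card ≤ (N' v).card + σ v)
    (h2 : ∀ v, (N' v).card ≤ (N v).card + σ v) : Degrees p N' B D σ s' := by
  have he := edgesAt_congr (s := s) (s' := s') h11 fun a ha => hA a (by simp at ha ⊢; omega)
  have h17 := hA 17 (by simp)
  have hL2 : (0 : ℝ) ≤ (p.L : ℝ) * p.L := by positivity
  have h1' : ∀ v, ((N v).card : ℝ) ≤ (N' v).card + σ v := fun v => by exact_mod_cast h1 v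
  have h2' : ∀ v, ((N' v).card : ℝ) ≤ (N v).card + σ v := fun v => by exact_mod_cast h2 v
  obtain ⟨g1, g2, g3, g4, g5, g6, g7, g8, g9⟩ := h
  refine ⟨by rwa [he], fun v hv => ?_, fun v hv hvB hf => ?_, fun v hv hf => ?_, fun v hv => ?_,
    by rwa [h11], fun c hc hc' => ?_, by rwa [h12], by rwa [h11, h12]⟩
  · rw [h17]
    refine lt_of_lt_of_le (g2 v hv) (mul_le_mul_of_nonneg_right ?_ hL2)
    have := h1' v
    push_cast; linarith
  · rw [h17] at hf ⊢
    have := g3 v hv hvB hf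
    have := mul_le_mul_of_nonneg_right (h2' v) hL2
    push_cast at *
    linarith
  · rw [h17] at hf
    rw [he, h17]
    have := g4 v hv hf
    have := h1 v
    omega
  · rw [he, h17]
    have := g5 v hv
    have := h2 v
    omega
  · rw [h12] at hc'
    exact lt_of_lt_of_le (g7 c hc hc') (by exact_mod_cast h23 c)

/-! ### Deleting an edge of the phase -/

-- `FewIn` is closed downwards, so a growing counter crosses the threshold at most once; the number
-- of lossy nodes is kept exact by looking at the test before and after the increment.
open Classical in
theorem card_not_fewIn_update {p : Params} {f : ℕ → ℕ} {x : ℕ} (hx : x < p.n) :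
    ((Finset.range p.n).filter fun v => ¬ p.FewIn (Function.update f x (f x + 1) v)).card =
      ((Finset.range p.n).filter fun v => ¬ p.FewIn (f v)).card +
        if p.FewIn (f x) ∧ ¬ p.FewIn (f x + 1) then 1 else 0 := by
  have hanti : ∀ y, p.FewIn (y + 1) → p.FewIn y := fun y => Params.FewIn.anti (by omega)
  split_ifs with h
  · rw [← Finset.card_insert_of_notMem (a := x) (by simp [h.1])]
    congr 1
    ext v
    by_cases hv : v = x
    · subst hv; simp [hx, h.2]
    · simp [hv]
  · refine congrArg Finset.card (Finset.filter_congr fun v _ => ?_)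
    by_cases hv : v = x
    · subst hv
      rw [Function.update_self]
      have := hanti (f v)
      tauto
    · rw [Function.update_of_ne hv]

theorem Ctx.classTest {p : Params} {s : Memory} {x c : ℕ} (hM : p.Fit M) (hC : Ctx p s)
    (h18 : s.vars 18 = x) (h19 : s.vars 19 = c) :
    Cmd.classTest.Holds M.θ s ↔ p.FewIn (s.arrs 22 (x * p.n ^ 3 + c)) := by
  simp only [Cmd.classTest, Test.holds_ltParam, Expr.val_mul, Expr.val_read, Expr.val_var,
    Expr.val_add, Expr.val_const, hC.L, hC.g, hC.d, hC.K, hC.cube, hM.ε, h18, h19, Params.FewIn]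

open Classical in
theorem Run.lose {p : Params} {x c y : ℕ} {s : Memory} (hM : p.Fit M) (hC : Ctx p s)
    (h18 : s.vars 18 = x) (h19 : s.vars 19 = c) (hy : s.arrs 22 (x * p.n ^ 3 + c) = y)
    (h22 : y < M.Q) (h23 : s.arrs 23 c < M.Q) :
    Run M Cmd.lose s 150 fun s' =>
      s'.arrs 22 = Function.update (s.arrs 22) (x * p.n ^ 3 + c) (y + 1) ∧
      s'.arrs 23 = Function.update (s.arrs 23) c
        (s.arrs 23 c + if p.FewIn y ∧ ¬ p.FewIn (y + 1) then 1 else 0) := by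
  have hT := hC.classTest hM h18 h19
  rw [hy] at hT
  refine (Run.ite (T := 120) rfl (fun hb => ?_) (fun hb => ?_)).mono (by decide) fun _ _ _ h => h
  · rw [hT] at hb
    refine (Run.seq (P₁ := fun s' => s' = s.setArr 22 (x * p.n ^ 3 + c) (y + 1)) (T₁ := 20) (T₂ := 100)
      (Run.block rfl rfl (by simp [Cmd.wp, h18, h19, hC.cube, hy]; omega)) ?_).mono le_rfl
      fun _ _ _ h => h
    rintro s₁ hS₁ _ rfl
    have hT₁ := (hC.same hS₁ (by decide)).classTest hM (x := x) (c := c) (by simpa using h18)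
      (by simpa using h19)
    rw [Memory.setArr_arrs, Function.update_self, Function.update_self] at hT₁
    refine (Run.ite (T := 50) rfl (fun hb₁ => ?_) (fun hb₁ => ?_)).mono (by decide) fun _ _ _ h => h
    · rw [hT₁] at hb₁
      refine Run.block rfl rfl ?_
      simp [Cmd.wp, hb₁]
    · rw [hT₁] at hb₁
      refine Run.block rfl rfl ?_
      simp [Cmd.wp, hb₁, hb, h19]
      omega
  · rw [hT] at hb
    refine Run.block rfl rfl ?_
    simp [Cmd.wp, hb, h18, h19, hC.cube, hy]
    omega

/-- After `setErase` the variable 16 is the vacated position and the length is the index of the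
former last entry; moving the endpoints accordingly keeps the arrays 0 and 1 parallel to the list
11. -/
theorem Run.eraseX {r e : ℕ} {X : Finset ℕ} {s : Memory} (h8 : s.vars 8 = r) (hQ : r + 1 ≤ M.Q)
    (h15 : s.vars 15 = e) (he : e ∈ X) (hX : Listed r X s) :
    Run M Cmd.eraseX s 80 (Listed r (X.erase e)) := by
  have hcard := Finset.card_pos.2 ⟨e, he⟩
  refine (Run.seq (P₁ := fun s' => s' = s.setVar 14 0) (T₁ := 5) (T₂ := 75)
    (Run.block rfl rfl (by simp [Cmd.wp])) ?_).mono le_rfl fun _ _ _ h => h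
  rintro s₁ hS₁ _ rfl
  refine (Run.seq (T₂ := 35) (Run.setErase (m := r) (b := 0) (x := e) (F := single X) (by decide)
    (by decide) (by decide) (by simpa using hX.fam) (by simpa using h8) (by simp) (by simpa using h15)
    (by simpa using he) hQ) ?_).mono (by omega) fun _ _ _ h => h
  rintro s₂ hS₂ _ ⟨k1, k2, k3, k4, k5⟩
  have hS02 := hS₁.trans hS₂
  simp only [single_zero, update_single, zero_mul, zero_add, Memory.setVar_arrs] at k1 k2 k3 k4 k5
  have h14 : s₂.vars 14 = 0 := by rw [hS₂.vars 14 (by decide)]; simp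
  have h13 : s₂.arrs 13 0 = X.card - 1 := by rw [k3, Function.update_self]
  have a0 : s₂.arrs 0 = s.arrs 0 := hS02.arrs 0 (by decide)
  have a1 : s₂.arrs 1 = s.arrs 1 := hS02.arrs 1 (by decide)
  have a18 : s₂.arrs 18 = s.arrs 18 := hS02.arrs 18 (by decide)
  have a19 : s₂.arrs 19 = s.arrs 19 := hS02.arrs 19 (by decide)
  refine Run.block rfl rfl ?_
  simp only [Cmd.wp, Expr.fits_read, Expr.val_read, Expr.val_var, Memory.setArr_vars,
    Memory.setArr_arrs, true_and, h14]
  refine ⟨by simpa using k1, fun i hi => ?_, fun i hi => ?_⟩ <;>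
    rw [Finset.card_erase_of_mem he] at hi <;>
    simp [h13, a0, a1, a18, a19, k2] <;>
    by_cases hi' : i = s₂.vars 16
  · subst hi'; simpa using hX.tail _ (by omega)
  · rw [Function.update_of_ne hi', Function.update_of_ne hi']; exact hX.tail i (by omega)
  · subst hi'; simpa using hX.head _ (by omega)
  · rw [Function.update_of_ne hi', Function.update_of_ne hi']; exact hX.head i (by omega)

theorem mem_removeEdge {N : ℕ → Finset ℕ} {u v a b : ℕ} (huv : u ≠ v) :
    b ∈ removeEdge N u v a ↔ b ∈ N a ∧ ¬ ((a = u ∧ b = v) ∨ (a = v ∧ b = u)) := by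
  by_cases hv : a = v
  · subst hv
    simp only [removeEdge, Function.update_self, Finset.mem_erase]
    have : a ≠ u := huv.symm
    tauto
  · by_cases hu : a = u
    · subst hu
      simp only [removeEdge, Function.update_of_ne hv, Function.update_self, Finset.mem_erase]
      tauto
    · simp [removeEdge, hv, hu]

theorem mem_addEdge {N : ℕ → Finset ℕ} {u v a b : ℕ} (huv : u ≠ v) :
    b ∈ addEdge N u v a ↔ b ∈ N a ∨ (a = u ∧ b = v) ∨ (a = v ∧ b = u) := by
  by_cases hv : a = v
  · subst hv
    simp only [addEdge, Function.update_self, Finset.mem_insert]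
    have : a ≠ u := huv.symm
    tauto
  · by_cases hu : a = u
    · subst hu
      simp only [addEdge, Function.update_of_ne hv, Function.update_self, Finset.mem_insert]
      tauto
    · simp [addEdge, hv, hu]

end DynSkeleton

/-! ### The deletion of an edge of the current phase -/

namespace DynSkeleton

variable {M : Machine}

theorem Phase.entry {p : Params} {N : ℕ → Finset ℕ} {s : Memory} {u v e : ℕ} (h : Phase p N s)
    (hv : v < p.n) (he : s.arrs 21 (u * p.n ^ 3 + v) = e) (he0 : e ≠ 0) :
    e ≤ s.vars 11 ∧ edgeId s (p.n ^ 3) e = e ∧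
      ((s.arrs 18 e = u ∧ s.arrs 19 e = v) ∨ (s.arrs 18 e = v ∧ s.arrs 19 e = u)) := by
  have hr : p.n ≤ p.n ^ 3 := Nat.le_self_pow (by omega) _
  have h1 : 1 ≤ e := Nat.one_le_iff_ne_zero.2 he0
  obtain ⟨g1, g2⟩ := h.support (u * p.n ^ 3 + v) (by rwa [he])
  rw [he] at g1 g2
  have a1 := h.tail_lt e h1 g1
  have a2 := h.head_lt e h1 g1
  rw [index_inj (lt_of_lt_of_le hv hr) (lt_of_lt_of_le a1 hr),
    index_inj (lt_of_lt_of_le hv hr) (lt_of_lt_of_le a2 hr)] at g2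
  refine ⟨g1, ?_, ?_⟩
  · rcases g2 with g2 | g2
    · rw [edgeId, ← g2.1, ← g2.2, he]
    · rw [← h.symm e h1 g1, ← g2.1, ← g2.2, he]
  · rcases g2 with g2 | g2
    · exact Or.inl ⟨g2.1.symm, g2.2.symm⟩
    · exact Or.inr ⟨g2.2.symm, g2.1.symm⟩

/-- The deletion of the edge `uv`, whose number is `e`, from the table of edge numbers. -/
structure Removed (s s' : Memory) (r u v e : ℕ) : Prop where
  count : s'.vars 11 = s.vars 11
  arrs : ∀ a ∈ [14, 15, 16, 18, 19, 20, 26], s'.arrs a = s.arrs a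
  table : s'.arrs 21 = Function.update (Function.update (s.arrs 21) (u * r + v) 0) (v * r + u) 0

section removed

variable {p : Params} {N : ℕ → Finset ℕ} {s s' : Memory} {u v e : ℕ}

/-- Distinct edges of a phase have distinct pairs of endpoints, so clearing the two cells of one
edge leaves the entries of all others intact. -/
theorem Phase.edgeId_removed (h : Phase p N s) (hR : Removed s s' (p.n ^ 3) u v e) (hu : u < p.n)
    (hv : v < p.n) (he : s.arrs 21 (u * p.n ^ 3 + v) = e) (he0 : e ≠ 0) {e' : ℕ} (h1 : 1 ≤ e')
    (h2 : e' ≤ s.vars 11) :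
    edgeId s' (p.n ^ 3) e' = if e' = e then 0 else edgeId s (p.n ^ 3) e' := by
  have hr : p.n ≤ p.n ^ 3 := Nat.le_self_pow (by omega) _
  obtain ⟨g1, g2, g3⟩ := h.entry hv he he0
  have h1' : 1 ≤ e := Nat.one_le_iff_ne_zero.2 he0
  rw [edgeId, hR.arrs 18 (by simp), hR.arrs 19 (by simp), hR.table]
  split_ifs with h'
  · subst h'
    rcases g3 with g3 | g3 <;> rw [g3.1, g3.2]
    · by_cases hh : u * p.n ^ 3 + v = v * p.n ^ 3 + u
      · rw [hh, Function.update_self]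
      · rw [Function.update_of_ne hh, Function.update_self]
    · rw [Function.update_self]
  · have a2 := lt_of_lt_of_le (h.head_lt e' h1 h2) hr
    have key := fun hh => h' (h.inj e' e h1 h2 h1' g1 hh)
    rw [Function.update_of_ne, Function.update_of_ne, edgeId]
    · rw [Ne, index_inj a2 (lt_of_lt_of_le hv hr)]
      rintro ⟨k1, k2⟩
      apply key
      rcases g3 with g3 | g3 <;> rw [k1, k2, g3.1, g3.2] <;> simp
    · rw [Ne, index_inj a2 (lt_of_lt_of_le hu hr)]
      rintro ⟨k1, k2⟩
      apply key
      rcases g3 with g3 | g3 <;> rw [k1, k2, g3.1, g3.2] <;> simp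

/-- The edge was alive, so it is new among the lost edges, at its two endpoints and in its own class
only. -/
theorem Phase.lost_removed (h : Phase p N s) (hR : Removed s s' (p.n ^ 3) u v e) (hu : u < p.n)
    (hv : v < p.n) (he : s.arrs 21 (u * p.n ^ 3 + v) = e) (he0 : e ≠ 0) (w c : ℕ) :
    (DynSkeleton.lost s' (p.n ^ 3) w c).card = (DynSkeleton.lost s (p.n ^ 3) w c).card +
      if c = s.arrs 20 e ∧ (w = u ∨ w = v) then 1 else 0 := by
  obtain ⟨g1, g2, g3⟩ := h.entry hv he he0
  have h1' : 1 ≤ e := Nat.one_le_iff_ne_zero.2 he0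
  have hE := edgesAt_congr hR.count fun a ha => hR.arrs a (by simp at ha ⊢; omega)
  have h20 := hR.arrs 20 (by simp)
  have hmem : ∀ e', e' ∈ DynSkeleton.lost s' (p.n ^ 3) w c ↔ e' ∈ DynSkeleton.lost s (p.n ^ 3) w c ∨
      (e' = e ∧ c = s.arrs 20 e ∧ (w = u ∨ w = v)) := by
    intro e'
    rw [DynSkeleton.lost, DynSkeleton.lost, hE, h20, edgesAt, Finset.filter_filter,
      Finset.filter_filter, Finset.mem_filter, Finset.mem_filter, Finset.mem_Icc]
    by_cases hr : 1 ≤ e' ∧ e' ≤ s.vars 11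
    · rw [h.edgeId_removed hR hu hv he he0 hr.1 hr.2]
      by_cases hee : e' = e
      · subst hee
        simp only [if_true, g2, he0, and_false, and_true, true_and, false_or, hr]
        rcases g3 with g3 | g3 <;> rw [g3.1, g3.2] <;> constructor <;> rintro ⟨k1, k2⟩
        · exact ⟨k2.symm, k1.imp Eq.symm Eq.symm⟩
        · exact ⟨k2.imp Eq.symm Eq.symm, k1.symm⟩
        · exact ⟨k2.symm, k1.symm.imp Eq.symm Eq.symm⟩
        · exact ⟨k2.symm.imp Eq.symm Eq.symm, k1.symm⟩
      · simp [hee]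
    · have : ¬ (e' = e) := by rintro rfl; exact hr ⟨h1', g1⟩
      tauto
  split_ifs with hc
  · rw [← Finset.card_insert_of_notMem (a := e)]
    · congr 1
      ext e'
      rw [hmem, Finset.mem_insert]
      tauto
    · simp [DynSkeleton.lost, g2, he0]
  · rw [Nat.add_zero]
    congr 1
    ext e'
    rw [hmem]
    tauto

theorem Phase.dead_removed (h : Phase p N s) (hR : Removed s s' (p.n ^ 3) u v e) (hu : u < p.n)
    (hv : v < p.n) (he : s.arrs 21 (u * p.n ^ 3 + v) = e) (he0 : e ≠ 0) :
    (dead s' (p.n ^ 3)).card ≤ (dead s (p.n ^ 3)).card + 1 := by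
  refine le_trans (Finset.card_le_card (t := insert e (dead s (p.n ^ 3))) ?_)
    (Finset.card_insert_le _ _)
  intro e' he'
  rw [dead, hR.count, Finset.mem_filter, Finset.mem_Icc] at he'
  rw [h.edgeId_removed hR hu hv he he0 he'.1.1 he'.1.2] at he'
  rw [Finset.mem_insert, dead, Finset.mem_filter, Finset.mem_Icc]
  by_cases hee : e' = e
  · exact Or.inl hee
  · rw [if_neg hee] at he'; exact Or.inr he'

theorem Phase.alive_removed (h : Phase p N s) (hR : Removed s s' (p.n ^ 3) u v e) (hu : u < p.n)
    (hv : v < p.n) (he : s.arrs 21 (u * p.n ^ 3 + v) = e) (he0 : e ≠ 0) (c : ℕ) :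
    aliveOf s' (p.n ^ 3) (s'.vars 11) c = (aliveOf s (p.n ^ 3) (s.vars 11) c).erase e := by
  ext e'
  rw [aliveOf, aliveOf, Finset.mem_erase, Finset.mem_filter, Finset.mem_filter, hR.count,
    hR.arrs 20 (by simp)]
  by_cases hr : e' ∈ Finset.Icc 1 (s.vars 11)
  · have hr' := Finset.mem_Icc.1 hr
    have := h.edgeId_removed hR hu hv he he0 hr'.1 hr'.2
    rw [edgeId, edgeId] at this
    rw [this]
    by_cases hee : e' = e
    · subst hee
      simp only [if_true, ne_eq, not_true, false_and, iff_false, not_and]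
      intro _ _
      exact fun h0 => he0 h0.symm
    · rw [if_neg hee]; simp [hee]
  · simp [hr]

theorem Phase.removed (h : Phase p N s) (hR : Removed s s' (p.n ^ 3) u v e) (hu : u < p.n)
    (hv : v < p.n) (huv : u ≠ v) (he : s.arrs 21 (u * p.n ^ 3 + v) = e) (he0 : e ≠ 0)
    (h22 : ∀ w c, c < p.n ^ 3 → s'.arrs 22 (w * p.n ^ 3 + c) = s.arrs 22 (w * p.n ^ 3 + c) +
      if c = s.arrs 20 e ∧ (w = u ∨ w = v) then 1 else 0)
    (h23 : ∀ c, s'.arrs 23 c = (DynSkeleton.lossy p s' c).card) :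
    Phase p (removeEdge N u v) s' := by
  obtain ⟨g1, g2, g3⟩ := h.entry hv he he0
  have h1' : 1 ≤ e := Nat.one_le_iff_ne_zero.2 he0
  have hr : p.n ≤ p.n ^ 3 := Nat.le_self_pow (by omega) _
  have a18 := hR.arrs 18 (by simp)
  have a19 := hR.arrs 19 (by simp)
  have a20 := hR.arrs 20 (by simp)
  have h11 := hR.count
  have heid := fun {e'} h1 h2 => h.edgeId_removed hR hu hv he he0 (e' := e') h1 h2
  exact
    { count_le := by rw [h11]; exact h.count_le
      tail_lt := by rw [h11, a18]; exact h.tail_lt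
      head_lt := by rw [h11, a19]; exact h.head_lt
      ne := by rw [h11, a18, a19]; exact h.ne
      inj := by rw [h11, a18, a19]; exact h.inj
      support := by
        intro x hx
        have hx' : s'.arrs 21 x = s.arrs 21 x := by
          rw [hR.table] at hx ⊢
          by_cases k1 : x = v * p.n ^ 3 + u
          · rw [k1, Function.update_self] at hx; exact absurd rfl hx
          rw [Function.update_of_ne k1] at hx ⊢
          by_cases k2 : x = u * p.n ^ 3 + v
          · rw [k2, Function.update_self] at hx; exact absurd rfl hx
          rw [Function.update_of_ne k2]
        rw [hx'] at hx ⊢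
        rw [h11, a18, a19]
        exact h.support x hx
      symm := by
        intro e' h1 h2
        rw [h11] at h2
        rw [heid h1 h2, a18, a19]
        have hsymm := h.symm e' h1 h2
        have a1 := lt_of_lt_of_le (h.tail_lt e' h1 h2) hr
        split_ifs with hee
        · subst hee
          rw [hR.table]
          rcases g3 with g3 | g3 <;> rw [g3.1, g3.2]
          · rw [Function.update_self]
          · by_cases hh : u * p.n ^ 3 + v = v * p.n ^ 3 + u
            · rw [hh, Function.update_self]
            · rw [Function.update_of_ne hh, Function.update_self]
        · have key := fun hh => hee (h.inj e' e h1 h2 h1' g1 hh)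
          rw [hR.table, Function.update_of_ne, Function.update_of_ne, hsymm]
          · rw [Ne, index_inj a1 (lt_of_lt_of_le hv hr)]
            rintro ⟨k1, k2⟩
            apply key
            rcases g3 with g3 | g3 <;> rw [k1, k2, g3.1, g3.2] <;> simp
          · rw [Ne, index_inj a1 (lt_of_lt_of_le hu hr)]
            rintro ⟨k1, k2⟩
            apply key
            rcases g3 with g3 | g3 <;> rw [k1, k2, g3.1, g3.2] <;> simp
      alive_adj := by
        intro e' h1 h2 h3
        rw [h11] at h2
        rw [heid h1 h2] at h3
        have hee : e' ≠ e := by rintro rfl; simp at h3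
        rw [if_neg hee] at h3
        rw [a18, a19, mem_removeEdge huv]
        refine ⟨h.alive_adj e' h1 h2 h3, fun hh => hee (h.inj e' e h1 h2 h1' g1 ?_)⟩
        rcases g3 with g3 | g3 <;> rw [g3.1, g3.2] <;> tauto
      class_ge := by rw [h11, a20]; exact h.class_ge
      class_lt := by rw [h11, a20]; exact h.class_lt
      tails := by rw [h11, a18, a20]; exact h.tails
      heads := by rw [h11, a19, a20]; exact h.heads
      waiting := by rw [hR.arrs 26 (by simp)]; exact h.waiting
      lost := by
        intro w c hc
        rw [h22 w c hc, h.lost w c hc, h.lost_removed hR hu hv he he0]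
      lossy := h23
      classes := by
        rw [h11, hR.arrs 14 (by simp), hR.arrs 15 (by simp), hR.arrs 16 (by simp), a20]
        exact h.classes }

end removed

open Classical in
theorem Run.erasePhase {p : Params} {N : ℕ → Finset ℕ} {s : Memory} {u v : ℕ} (hp : p.Admissible)
    (hM : p.Fit M) (hC : Ctx p s) (h1 : s.vars 1 = u) (h2 : s.vars 2 = v) (hu : u < p.n)
    (hv : v < p.n) (huv : u ≠ v) (hP : Phase p N s)
    (hX : Listed (p.n ^ 3) (aliveOf s (p.n ^ 3) (s.vars 11) (s.vars 12)) s) :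
    Run M Cmd.erasePhase s 500 fun s' => Phase p (removeEdge N u v) s' ∧
      Listed (p.n ^ 3) (aliveOf s' (p.n ^ 3) (s'.vars 11) (s'.vars 12)) s' ∧
      (dead s' (p.n ^ 3)).card ≤ (dead s (p.n ^ 3)).card + 1 ∧ ∀ c, s.arrs 23 c ≤ s'.arrs 23 c := by
  have hQ := hp.cube_add_one_le hM
  have hsq := hp.sq_lt_cube
  have hcube := hp.n_lt_cube
  set r := p.n ^ 3 with hr
  obtain ⟨e, he⟩ : ∃ e, s.arrs 21 (u * r + v) = e := ⟨_, rfl⟩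
  refine (Run.seq (P₁ := fun s' => s' = s.setVar 15 e) (T₁ := 20) (T₂ := 480)
    (Run.block rfl rfl (by simp [Cmd.wp, h1, h2, hC.cube, ← hr, he])) ?_).mono le_rfl fun _ _ _ h => h
  rintro s₁ hS₁ _ rfl
  refine (Run.ite (T := 470) rfl (fun hb => ?_) (fun hb => ?_)).mono (by decide) fun _ _ _ h => h
  -- Without an entry, no living edge of the phase joins `u` and `v`; hence all living edges survive
  -- the deletion.
  · have he0 : e = 0 := by simpa using hb
    refine Run.block rfl rfl ⟨hP.congr rfl (fun _ _ => rfl) fun e' k1 k2 k3 k4 => ?_, hX.congr fun _ _ => rfl,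
      Nat.le_succ _, fun c => le_rfl⟩
    rw [mem_removeEdge huv]
    refine ⟨k4, fun hh => k3 ?_⟩
    rcases hh with hh | hh
    · rw [edgeId, hh.1, hh.2, he, he0]
    · rw [← hP.symm e' k1 k2, hh.1, hh.2, he, he0]
  · have he0 : e ≠ 0 := by simpa using hb
    obtain ⟨g1, g2, g3⟩ := hP.entry hv he he0
    have h1e : 1 ≤ e := Nat.one_le_iff_ne_zero.2 he0
    set c := s.arrs 20 e with hc
    have hcr : c < r := by
      have := hP.class_lt e h1e g1
      have := hp.K_bound
      omega
    set A := Function.update (Function.update (s.arrs 21) (u * r + v) 0) (v * r + u) 0 with hA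
    refine (Run.seq (P₁ := fun s' => s'.arrs 21 = A ∧ s'.vars 18 = u ∧ s'.vars 19 = c) (T₁ := 50)
      (T₂ := 150 + (5 + (150 + 100))) (Run.block rfl rfl (by
        simp [Cmd.wp, h1, h2, hC.cube, ← hr, hA, hc])) ?_).mono (by omega) fun _ _ _ h => h
    rintro s₂ hS₂ _ ⟨k1, k2, k3⟩
    have hS02 := hS₁.trans hS₂
    have hlost : ∀ w, s.arrs 22 (w * r + c) = (DynSkeleton.lost s r w c).card := fun w => hP.lost w c hcr
    have hcl : ∀ w, (DynSkeleton.lost s r w c).card < r := by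
      intro w
      have h3 : DynSkeleton.lost s r w c ⊆ Finset.Icc 1 (s.vars 11) :=
        (Finset.filter_subset _ _).trans (Finset.filter_subset _ _)
      have h4 := Finset.card_le_card h3
      have := hP.count_le
      rw [Nat.card_Icc] at h4
      omega
    have h23 : s.arrs 23 c ≤ p.n := by
      rw [hP.lossy]
      exact (Finset.card_filter_le _ _).trans (by simp)
    set f : ℕ → ℕ := fun w => (DynSkeleton.lost s r w c).card with hf
    refine Run.seq (Run.lose (x := u) (c := c) (y := f u) hM (hC.same hS02 (by decide)) k2 k3
      (by rw [hS02.arrs 22 (by decide), hlost]) (lt_of_lt_of_le (hcl u) (by omega))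
      (by rw [hS02.arrs 23 (by decide)]; omega)) ?_
    rintro s₃ hS₃ _ ⟨l1, l2⟩
    rw [← hr, hS02.arrs 22 (by decide)] at l1
    rw [hS02.arrs 23 (by decide)] at l2
    have hS03 := hS02.trans hS₃
    refine Run.seq (P₁ := fun s' => s' = s₃.setVar 18 v) (T₁ := 5) (Run.block rfl rfl (by
      simp [Cmd.wp, hS03.vars 2 (by decide), h2])) ?_
    rintro s₄ hS₄ _ rfl
    have hS04 := hS03.trans hS₄
    -- Since `u ≠ v`, counting the loss at `u` has not touched the counter of `v`.
    have l3 : s₃.arrs 22 (v * r + c) = f v := by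
      rw [l1, Function.update_of_ne, hlost]
      rw [Ne, index_inj hcr hcr]; exact fun hh => huv hh.1.symm
    have l4 : s₃.arrs 23 c ≤ p.n + 1 := by
      rw [l2, Function.update_self]; split_ifs <;> omega
    refine Run.seq (Run.lose (x := v) (c := c) (y := f v) hM (hC.same hS04 (by decide)) (by simp)
      (by rw [hS₄.vars 19 (by decide), hS₃.vars 19 (by decide), k3])
      (by rw [← hr]; simpa using l3) (lt_of_lt_of_le (hcl v) (by omega)) (by simp; omega)) ?_
    rintro s₅ hS₅ _ ⟨m1, m2⟩
    have hS35 := hS₄.trans hS₅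
    have hS05 := hS03.trans hS35
    rw [← hr, Memory.setVar_arrs, l1] at m1
    rw [Memory.setVar_arrs, l2, Function.update_self, Function.update_idem] at m2
    have v12 : s₅.vars 12 = s.vars 12 := hS05.vars 12 (by decide)
    have hR : Removed s s₅ r u v e := by
      refine ⟨hS05.vars 11 (by decide), ?_, ?_⟩
      · simp only [List.mem_cons, List.not_mem_nil, or_false, forall_eq_or_imp, forall_eq]
        exact ⟨hS05.arrs 14 (by decide), hS05.arrs 15 (by decide), hS05.arrs 16 (by decide),
          hS05.arrs 18 (by decide), hS05.arrs 19 (by decide), hS05.arrs 20 (by decide),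
          hS05.arrs 26 (by decide)⟩
      · rw [hS35.arrs 21 (by decide), hS₃.arrs 21 (by decide), k1]
    have hph : Phase p (removeEdge N u v) s₅ := by
      refine hP.removed hR hu hv huv he he0 (fun w c' hc' => ?_) (fun c' => ?_)
      · rw [m1, ← hr]
        by_cases hcc : c' = c
        · subst hcc
          by_cases hwv : w = v
          · subst hwv
            rw [Function.update_self, hlost]; simp [hf, hc]
          · rw [Function.update_of_ne (by rw [Ne, index_inj hcr hcr]; exact fun hh => hwv hh.1)]
            by_cases hwu : w = u
            · subst hwu
              rw [Function.update_self, hlost]; simp [hf, hc]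
            · rw [Function.update_of_ne (by rw [Ne, index_inj hcr hcr]; exact fun hh => hwu hh.1)]
              simp [hwu, hwv]
        · rw [Function.update_of_ne (by rw [Ne, index_inj hc' hcr]; exact fun hh => hcc hh.2),
            Function.update_of_ne (by rw [Ne, index_inj hc' hcr]; exact fun hh => hcc hh.2)]
          simp [← hc, hcc]
      · have hl : ∀ w, (DynSkeleton.lost s₅ r w c').card = (DynSkeleton.lost s r w c').card +
            if c' = s.arrs 20 e ∧ (w = u ∨ w = v) then 1 else 0 :=
          fun w => hP.lost_removed hR hu hv he he0 w c'
        rw [m2, DynSkeleton.lossy, ← hr]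
        by_cases hcc : c' = c
        · subst hcc
          have hl' : ∀ w, (DynSkeleton.lost s₅ r w c).card =
              Function.update (Function.update f u (f u + 1)) v
                (Function.update f u (f u + 1) v + 1) w := by
            intro w
            rw [hl]
            by_cases hwv : w = v
            · subst hwv
              simp [hf, hc, huv.symm]
            · by_cases hwu : w = u
              · subst hwu; simp [hf, hc, huv]
              · simp [hwv, hwu, hf]
          simp only [hl']
          rw [card_not_fewIn_update hv, card_not_fewIn_update hu, Function.update_self,
            Function.update_of_ne huv.symm, hP.lossy, DynSkeleton.lossy]
        · rw [Function.update_of_ne hcc, hP.lossy, DynSkeleton.lossy]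
          refine congrArg Finset.card (Finset.filter_congr fun w _ => ?_)
          rw [← hr, hl, ← hc]
          simp [hcc]
    have halive : aliveOf s₅ r (s₅.vars 11) (s₅.vars 12) =
        (aliveOf s r (s.vars 11) (s.vars 12)).erase e := by
      rw [v12]; exact hP.alive_removed hR hu hv he he0 _
    have hdead := hP.dead_removed hR hu hv he he0
    have hmono : ∀ c', s.arrs 23 c' ≤ s₅.arrs 23 c' := by
      intro c'
      rw [m2]
      by_cases hcc : c' = c
      · subst hcc; rw [Function.update_self]; omega
      · rw [Function.update_of_ne hcc]
    have hX₅ : Listed r (aliveOf s r (s.vars 11) (s.vars 12)) s₅ := by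
      refine hX.congr ?_
      simp only [List.mem_cons, List.not_mem_nil, or_false, forall_eq_or_imp, forall_eq]
      exact ⟨hS05.arrs 0 (by decide), hS05.arrs 1 (by decide), hS05.arrs 11 (by decide),
          hS05.arrs 12 (by decide), hS05.arrs 13 (by decide), hS05.arrs 18 (by decide),
          hS05.arrs 19 (by decide)⟩
    have v19 : s₅.vars 19 = c := by
      rw [hS35.vars 19 (by decide), hS₃.vars 19 (by decide), k3]
    have hmem : e ∈ aliveOf s r (s.vars 11) (s.vars 12) ↔ c = s.vars 12 := by
      rw [aliveOf, Finset.mem_filter, Finset.mem_Icc]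
      rw [edgeId] at g2
      tauto
    refine (Run.ite (T := 90) rfl (fun hb₁ => ?_) (fun hb₁ => ?_)).mono (by decide) fun _ _ _ h => h
    · have hb₁' : c = s.vars 12 := by simpa [v19, v12] using hb₁
      refine (Run.eraseX (r := r) (e := e) (by rw [hS05.vars 8 (by decide), hC.cube]) hQ
        (by rw [hS35.vars 15 (by decide), hS₃.vars 15 (by decide), hS₂.vars 15 (by decide)]; simp) (hmem.2 hb₁') hX₅).mono (by omega) ?_
      intro s₆ hS₆ _ hL
      have v11' := hS₆.vars 11 (by decide)
      refine ⟨hph.congr v11' ?_ (fun _ _ _ _ h => h), ?_, ?_, ?_⟩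
      · simp only [List.mem_cons, List.not_mem_nil, or_false, forall_eq_or_imp, forall_eq]
        exact ⟨hS₆.arrs 14 (by decide), hS₆.arrs 15 (by decide), hS₆.arrs 16 (by decide),
          hS₆.arrs 18 (by decide), hS₆.arrs 19 (by decide), hS₆.arrs 20 (by decide),
          hS₆.arrs 21 (by decide), hS₆.arrs 22 (by decide), hS₆.arrs 23 (by decide),
          hS₆.arrs 26 (by decide)⟩
      · rw [v11', hS₆.vars 12 (by decide), aliveOf_congr (s := s₅), halive]
        · exact hL
        · simp only [List.mem_cons, List.not_mem_nil, or_false, forall_eq_or_imp, forall_eq]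
          exact ⟨hS₆.arrs 18 (by decide), hS₆.arrs 19 (by decide), hS₆.arrs 20 (by decide),
            hS₆.arrs 21 (by decide)⟩
      · rw [dead_congr (s := s₅) v11']
        · exact hdead
        · simp only [List.mem_cons, List.not_mem_nil, or_false, forall_eq_or_imp, forall_eq]
          exact ⟨hS₆.arrs 18 (by decide), hS₆.arrs 19 (by decide), hS₆.arrs 21 (by decide)⟩
      · rw [hS₆.arrs 23 (by decide)]; exact hmono
    · have hb₁' : ¬ c = s.vars 12 := by simpa [v19, v12] using hb₁
      refine Run.block rfl rfl ⟨hph, ?_, hdead, hmono⟩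
      rw [halive, Finset.erase_eq_of_notMem fun h' => hb₁' (hmem.1 h')]
      exact hX₅

end DynSkeleton

namespace DynSkeleton

variable {M : Machine}

/-! ### An edge update before the bounds are restored -/

/-- The data structure for the graph with the neighbourhoods `N`. -/
structure Inv (p : Params) (N : ℕ → Finset ℕ) (B D : Finset ℕ) (σ : ℕ → ℕ) (s : Memory) : Prop where
  nodes : Nodes p N B D s
  phase : Phase p N s
  degrees : Degrees p N B D σ s
  listed : Listed (p.n ^ 3) (aliveOf s (p.n ^ 3) (s.vars 11) (s.vars 12)) s

theorem Inv.congr {p : Params} {N : ℕ → Finset ℕ} {B D : Finset ℕ} {σ : ℕ → ℕ} {s s' : Memory}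
    (h : Inv p N B D σ s) (h11 : s'.vars 11 = s.vars 11) (h12 : s'.vars 12 = s.vars 12)
    (hA : ∀ a, s'.arrs a = s.arrs a) : Inv p N B D σ s' where
  nodes := h.nodes.congr fun a _ => hA a
  phase := h.phase.congr h11 (fun a _ => hA a) fun _ _ _ _ h => h
  degrees := h.degrees.congr h11 h12 fun a _ => hA a
  listed := by
    rw [h11, h12, aliveOf_congr fun a _ => hA a]
    exact h.listed.congr fun a _ => hA a

theorem card_addEdge {N : ℕ → Finset ℕ} {u v : ℕ} (huv : u ≠ v) (w : ℕ) :
    (N w).card ≤ (addEdge N u v w).card ∧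
      (addEdge N u v w).card ≤ (N w).card + if w = u ∨ w = v then 1 else 0 := by
  refine ⟨Finset.card_le_card fun x hx => (mem_addEdge huv).2 (Or.inl hx), ?_⟩
  by_cases hv : w = v
  · subst hv
    simpa [addEdge] using Finset.card_insert_le _ _
  · by_cases hu : w = u
    · subst hu
      simpa [addEdge, hv] using Finset.card_insert_le _ _
    · simp [addEdge, hv, hu]

theorem card_removeEdge {N : ℕ → Finset ℕ} {u v : ℕ} (huv : u ≠ v) (w : ℕ) :
    (removeEdge N u v w).card ≤ (N w).card ∧
      (N w).card ≤ (removeEdge N u v w).card + if w = u ∨ w = v then 1 else 0 := by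
  refine ⟨Finset.card_le_card fun x hx => ((mem_removeEdge huv).1 hx).1, ?_⟩
  by_cases hv : w = v
  · subst hv
    have := Finset.pred_card_le_card_erase (s := N w) (a := u)
    simp [removeEdge]; omega
  · by_cases hu : w = u
    · subst hu
      have := Finset.pred_card_le_card_erase (s := N w) (a := v)
      simp [removeEdge, hv]; omega
    · simp [removeEdge, hv, hu]

/-- The neighbourhoods `N'` arise from `N` by the insertion (`i = 1`) or deletion of the edge `uv`. -/
def Changes (N N' : ℕ → Finset ℕ) (i u v : ℕ) : Prop :=
  if i = 1 then v ∉ N u ∧ u ∉ N v ∧ N' = addEdge N u v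
  else v ∈ N u ∧ u ∈ N v ∧ N' = removeEdge N u v

/-- The update is not yet counted at the endpoints; the function that is 1 there and 0 elsewhere
keeps the degree estimates true in the meantime. -/
theorem Run.changeEdge {p : Params} {N N' : ℕ → Finset ℕ} {B D : Finset ℕ} {s : Memory} {u v : ℕ}
    (hp : p.Admissible) (hM : p.Fit M) (hC : Ctx p s) (h1 : s.vars 1 = u) (h2 : s.vars 2 = v)
    (hu : u < p.n) (hv : v < p.n) (huv : u ≠ v) (hN : Changes N N' (s.vars 0) u v)
    (hI : Inv p N B D (fun _ => 0) s) :
    Run M (.ite (.eq (.var 0) (.const 1)) .insertEdge (.seq .eraseEdge .erasePhase)) s 600 fun s' =>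
      Inv p N' B D (fun w => if w = u ∨ w = v then 1 else 0) s' ∧
      charge p s' = charge p s ∧ (dead s' (p.n ^ 3)).card ≤ (dead s (p.n ^ 3)).card + 1 ∧
      remaining p s' = remaining p s := by
  have hQ := hp.cube_add_one_le hM
  have hcube := hp.n_lt_cube
  refine (Run.ite (T := 590) rfl (fun hb => ?_) (fun hb => ?_)).mono (by decide) fun _ _ _ h => h
  · have h0 : s.vars 0 = 1 := by simpa using hb
    rw [Changes, if_pos h0] at hN
    obtain ⟨n1, n2, rfl⟩ := hN
    refine (Run.insertEdge hC.cube hQ h1 h2 huv (by omega) (by omega) n1 n2 hI.nodes.adj).mono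
      (by omega) ?_
    intro s' hS _ hF
    -- An inserted edge does not join the phase. The neighbourhoods only grow, so the living edges
    -- remain edges of the graph.
    have hP := hI.phase.congr (s' := s') (N' := addEdge N u v) (hS.vars 11 (by decide)) (by
      simp only [List.mem_cons, List.not_mem_nil, or_false, forall_eq_or_imp, forall_eq]
      exact ⟨hS.arrs 14 (by decide), hS.arrs 15 (by decide), hS.arrs 16 (by decide),
        hS.arrs 18 (by decide), hS.arrs 19 (by decide), hS.arrs 20 (by decide),
        hS.arrs 21 (by decide), hS.arrs 22 (by decide), hS.arrs 23 (by decide),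
        hS.arrs 26 (by decide)⟩) fun _ _ _ _ hh => (mem_addEdge huv).2 (Or.inl hh)
    refine ⟨⟨?_, hP, ?_, ?_⟩, charge_congr (hS.arrs 17 (by decide)), ?_, remaining_congr
      (hS.vars 11 (by decide)) (hS.vars 12 (by decide)) (hS.arrs 20 (by decide))⟩
    · obtain ⟨_, k2, k3, k4, k5, k6⟩ := hI.nodes
      refine ⟨hF, ?_, ?_, ?_, ?_, ?_⟩
      · rwa [hS.arrs 5 (by decide), hS.arrs 6 (by decide), hS.arrs 7 (by decide)]
      · rwa [hS.arrs 8 (by decide), hS.arrs 9 (by decide), hS.arrs 10 (by decide)]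
      · rwa [hS.arrs 17 (by decide)]
      · rwa [hS.arrs 17 (by decide)]
      · rwa [hS.arrs 27 (by decide)]
    · refine hI.degrees.edge_change (hS.vars 11 (by decide)) (hS.vars 12 (by decide)) ?_ ?_
        (fun w => (card_addEdge huv w).1.trans (Nat.le_add_right _ _))
        (fun w => (card_addEdge huv w).2)
      · simp only [List.mem_cons, List.not_mem_nil, or_false, forall_eq_or_imp, forall_eq]
        exact ⟨hS.arrs 17 (by decide), hS.arrs 18 (by decide), hS.arrs 19 (by decide)⟩
      · intro c; rw [hS.arrs 23 (by decide)]
    · rw [hS.vars 11 (by decide), hS.vars 12 (by decide), aliveOf_congr (s := s)]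
      · refine hI.listed.congr ?_
        simp only [List.mem_cons, List.not_mem_nil, or_false, forall_eq_or_imp, forall_eq]
        exact ⟨hS.arrs 0 (by decide), hS.arrs 1 (by decide), hS.arrs 11 (by decide),
          hS.arrs 12 (by decide), hS.arrs 13 (by decide), hS.arrs 18 (by decide),
          hS.arrs 19 (by decide)⟩
      · simp only [List.mem_cons, List.not_mem_nil, or_false, forall_eq_or_imp, forall_eq]
        exact ⟨hS.arrs 18 (by decide), hS.arrs 19 (by decide), hS.arrs 20 (by decide),
          hS.arrs 21 (by decide)⟩
    · rw [dead_congr (s := s) (hS.vars 11 (by decide))]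
      · omega
      · simp only [List.mem_cons, List.not_mem_nil, or_false, forall_eq_or_imp, forall_eq]
        exact ⟨hS.arrs 18 (by decide), hS.arrs 19 (by decide), hS.arrs 21 (by decide)⟩
  · have h0 : ¬ s.vars 0 = 1 := by simpa using hb
    rw [Changes, if_neg h0] at hN
    obtain ⟨n1, n2, rfl⟩ := hN
    refine (Run.seq (T₂ := 500) (Run.eraseEdge hC.cube hQ h1 h2 huv n1 n2 hI.nodes.adj) ?_).mono
      (by omega) fun _ _ _ h => h
    intro s₁ hS₁ _ hF
    have hP := hI.phase.congr (s' := s₁) (N' := N) (hS₁.vars 11 (by decide)) (by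
      simp only [List.mem_cons, List.not_mem_nil, or_false, forall_eq_or_imp, forall_eq]
      exact ⟨hS₁.arrs 14 (by decide), hS₁.arrs 15 (by decide), hS₁.arrs 16 (by decide),
        hS₁.arrs 18 (by decide), hS₁.arrs 19 (by decide), hS₁.arrs 20 (by decide),
        hS₁.arrs 21 (by decide), hS₁.arrs 22 (by decide), hS₁.arrs 23 (by decide),
        hS₁.arrs 26 (by decide)⟩) fun _ _ _ _ hh => hh
    have hL : Listed (p.n ^ 3) (aliveOf s₁ (p.n ^ 3) (s₁.vars 11) (s₁.vars 12)) s₁ := by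
      rw [hS₁.vars 11 (by decide), hS₁.vars 12 (by decide), aliveOf_congr (s := s)]
      · refine hI.listed.congr ?_
        simp only [List.mem_cons, List.not_mem_nil, or_false, forall_eq_or_imp, forall_eq]
        exact ⟨hS₁.arrs 0 (by decide), hS₁.arrs 1 (by decide), hS₁.arrs 11 (by decide),
          hS₁.arrs 12 (by decide), hS₁.arrs 13 (by decide), hS₁.arrs 18 (by decide),
          hS₁.arrs 19 (by decide)⟩
      · simp only [List.mem_cons, List.not_mem_nil, or_false, forall_eq_or_imp, forall_eq]
        exact ⟨hS₁.arrs 18 (by decide), hS₁.arrs 19 (by decide), hS₁.arrs 20 (by decide),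
          hS₁.arrs 21 (by decide)⟩
    refine (Run.erasePhase hp hM (hC.same hS₁ (by decide)) (by rw [hS₁.vars 1 (by decide), h1])
      (by rw [hS₁.vars 2 (by decide), h2]) hu hv huv hP hL).mono le_rfl ?_
    rintro s₂ hS₂ _ ⟨k1, k2, k3, k4⟩
    have hS := hS₁.trans hS₂
    refine ⟨⟨?_, k1, ?_, k2⟩, charge_congr (hS.arrs 17 (by decide)), ?_, remaining_congr
      (hS.vars 11 (by decide)) (hS.vars 12 (by decide)) (hS.arrs 20 (by decide))⟩
    · obtain ⟨_, k2, k3, k4, k5, k6⟩ := hI.nodes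
      refine ⟨?_, ?_, ?_, ?_, ?_, ?_⟩
      · rwa [hS₂.arrs 2 (by decide), hS₂.arrs 3 (by decide), hS₂.arrs 4 (by decide)]
      · rwa [hS.arrs 5 (by decide), hS.arrs 6 (by decide), hS.arrs 7 (by decide)]
      · rwa [hS.arrs 8 (by decide), hS.arrs 9 (by decide), hS.arrs 10 (by decide)]
      · rwa [hS.arrs 17 (by decide)]
      · rwa [hS.arrs 17 (by decide)]
      · rwa [hS.arrs 27 (by decide)]
    · refine hI.degrees.edge_change (hS.vars 11 (by decide)) (hS.vars 12 (by decide)) ?_ ?_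
        (fun w => (card_removeEdge huv w).2)
        (fun w => (card_removeEdge huv w).1.trans (Nat.le_add_right _ _))
      · simp only [List.mem_cons, List.not_mem_nil, or_false, forall_eq_or_imp, forall_eq]
        exact ⟨hS.arrs 17 (by decide), hS.arrs 18 (by decide), hS.arrs 19 (by decide)⟩
      · intro c
        refine le_trans ?_ (k4 c)
        rw [hS₁.arrs 23 (by decide)]
    · refine k3.trans ?_
      rw [dead_congr (s := s) (hS₁.vars 11 (by decide))]
      simp only [List.mem_cons, List.not_mem_nil, or_false, forall_eq_or_imp, forall_eq]
      exact ⟨hS₁.arrs 18 (by decide), hS₁.arrs 19 (by decide), hS₁.arrs 21 (by decide)⟩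

theorem Run.touchAt {p : Params} {N : ℕ → Finset ℕ} {B D : Finset ℕ} {σ : ℕ → ℕ} {s : Memory} {x v : ℕ}
    (hp : p.Admissible) (hM : p.Fit M) (hC : Ctx p s) (hI : Inv p N B D σ s)
    (hx : s.vars x = v) (hv : v < p.n) (hσ : σ v ≤ 1) :
    Run M (.seq (.assign 15 (.var x)) .touch) s 205 fun s' => ∃ B' D',
      Inv p N B' D' (Function.update σ v 0) s' ∧ charge p s' ≤ charge p s + 1 ∧
      dead s' = dead s ∧ remaining p s' = remaining p s := by
  refine Run.seq (P₁ := fun s' => s' = s.setVar 15 v) (T₁ := 5) (T₂ := 200)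
    (Run.block rfl rfl (by simp [Cmd.wp, hx])) ?_
  rintro s₁ hS₁ _ rfl
  have hI₁ := hI.congr (s' := s.setVar 15 v) rfl rfl fun _ => rfl
  refine (Run.touch hp hM (hC.same hS₁ (by simp [Cmd.wv])) hI₁.nodes hI₁.degrees (by simp) hv hσ).mono
    le_rfl ?_
  rintro s' hS₂ _ ⟨B', D', k1, k2, k3⟩
  have hPA : ∀ a ∈ [18, 19, 20, 21], s'.arrs a = s.arrs a := by
    simp only [List.mem_cons, List.not_mem_nil, or_false, forall_eq_or_imp, forall_eq]
    exact ⟨hS₂.arrs 18 (by decide), hS₂.arrs 19 (by decide), hS₂.arrs 20 (by decide),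
      hS₂.arrs 21 (by decide)⟩
  have h11 : s'.vars 11 = s.vars 11 := hS₂.vars 11 (by decide)
  have h12 : s'.vars 12 = s.vars 12 := hS₂.vars 12 (by decide)
  refine ⟨B', D', ⟨k1, ?_, k2, ?_⟩, k3,
    dead_congr h11 fun a ha => hPA a (by simp at ha ⊢; omega),
    remaining_congr h11 h12 (hS₂.arrs 20 (by decide))⟩
  · refine hI.phase.congr h11 ?_ fun _ _ _ _ h => h
    simp only [List.mem_cons, List.not_mem_nil, or_false, forall_eq_or_imp, forall_eq]
    exact ⟨hS₂.arrs 14 (by decide), hS₂.arrs 15 (by decide), hS₂.arrs 16 (by decide),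
      hS₂.arrs 18 (by decide), hS₂.arrs 19 (by decide), hS₂.arrs 20 (by decide),
      hS₂.arrs 21 (by decide), hS₂.arrs 22 (by decide), hS₂.arrs 23 (by decide),
      hS₂.arrs 26 (by decide)⟩
  · rw [h11, h12, aliveOf_congr hPA]
    refine hI.listed.congr ?_
    simp only [List.mem_cons, List.not_mem_nil, or_false, forall_eq_or_imp, forall_eq]
    exact ⟨hS₂.arrs 0 (by decide), hS₂.arrs 1 (by decide), hS₂.arrs 11 (by decide),
      hS₂.arrs 12 (by decide), hS₂.arrs 13 (by decide), hS₂.arrs 18 (by decide),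
      hS₂.arrs 19 (by decide)⟩

end DynSkeleton

namespace DynSkeleton

variable {M : Machine}

/-! ### The cost of a rebuild -/

/-- What an update pays for the rebuilds to come. -/
noncomputable def Params.rate (p : Params) : ℝ :=
  5000 * (p.Ld * (12 * (p.L * p.L * p.g))) / (p.ε * p.δ)

/-- What has been paid in advance. -/
noncomputable def potential (p : Params) (s : Memory) : ℝ :=
  p.rate * (charge p s + (dead s (p.n ^ 3)).card) + 200 * remaining p s

/-- A deleted edge has one class and two endpoints, so it is counted at most twice. -/
theorem sum_lost_le (p : Params) (s : Memory) (r : ℕ) (C : Finset ℕ) :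
    ∑ c ∈ C, ∑ v ∈ Finset.range p.n, (lost s r v c).card ≤ 2 * (dead s r).card := by
  have h1 : ∀ c v, (lost s r v c).card = ∑ e ∈ dead s r,
      if (s.arrs 18 e = v ∨ s.arrs 19 e = v) ∧ s.arrs 20 e = c then 1 else 0 := by
    intro c v
    rw [← Finset.card_filter, lost, edgesAt, dead, Finset.filter_filter, Finset.filter_filter]
    congr 1
    apply Finset.filter_congr
    intros
    tauto
  simp only [h1]
  calc ∑ c ∈ C, ∑ v ∈ Finset.range p.n, ∑ e ∈ dead s r,
        (if (s.arrs 18 e = v ∨ s.arrs 19 e = v) ∧ s.arrs 20 e = c then 1 else 0)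
      = ∑ e ∈ dead s r, ∑ v ∈ Finset.range p.n, ∑ c ∈ C,
        (if (s.arrs 18 e = v ∨ s.arrs 19 e = v) ∧ s.arrs 20 e = c then 1 else 0) := by
        rw [Finset.sum_comm, Finset.sum_comm_cycle, Finset.sum_comm]
    _ ≤ ∑ _e ∈ dead s r, 2 := ?_
    _ = 2 * (dead s r).card := by rw [Finset.sum_const, smul_eq_mul, mul_comm]
  refine Finset.sum_le_sum fun e _ => ?_
  calc ∑ v ∈ Finset.range p.n, ∑ c ∈ C,
        (if (s.arrs 18 e = v ∨ s.arrs 19 e = v) ∧ s.arrs 20 e = c then 1 else 0)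
      ≤ ∑ v ∈ Finset.range p.n, if s.arrs 18 e = v ∨ s.arrs 19 e = v then 1 else 0 := by
        refine Finset.sum_le_sum fun v _ => ?_
        by_cases hv : s.arrs 18 e = v ∨ s.arrs 19 e = v
        · simp only [hv, true_and, if_true]
          rw [Finset.sum_ite_eq]
          split_ifs <;> omega
        · simp [hv]
    _ = ((Finset.range p.n).filter fun v => s.arrs 18 e = v ∨ s.arrs 19 e = v).card := by
        rw [Finset.card_filter]
    _ ≤ ({s.arrs 18 e, s.arrs 19 e} : Finset ℕ).card := by
        apply Finset.card_le_card
        intro v hv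
        rw [Finset.mem_filter] at hv
        simp only [Finset.mem_insert, Finset.mem_singleton]
        exact hv.2.imp Eq.symm Eq.symm
    _ ≤ 2 := Finset.card_le_two

namespace Params.Admissible

variable {p : Params} (hp : p.Admissible)

include hp

/-- The charge of many dirty nodes pays for a rebuild. -/
theorem dirty_pays {B D : Finset ℕ} {f : ℕ → ℕ} (h : p.δ * ((2 * B.card : ℕ) : ℝ) < D.card)
    (hD : ∀ v ∈ D, ¬ p.Few (f v)) :
    1700 * (p.Ld : ℝ) * (((B.card + D.card) * p.d : ℕ) : ℝ) ≤
      p.rate * ((∑ v ∈ D, f v : ℕ) : ℝ) := by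
  set q : ℝ := 12 * (p.L * p.L * p.g) with hq
  -- The counter of a dirty node is at least ε d / q.
  have h1 : (D.card : ℝ) * (p.ε * p.d) ≤ ((∑ v ∈ D, f v : ℕ) : ℝ) * q := by
    rw [Nat.cast_sum, Finset.sum_mul, ← nsmul_eq_mul]
    refine Finset.card_nsmul_le_sum _ _ _ fun v hv => ?_
    have := hD v hv
    rw [Params.Few, not_lt] at this
    rw [hq]; push_cast at this ⊢; exact this
  have hε := hp.ε_pos
  have hδ := hp.δ_pos
  have hδ2 := hp.δ_lt
  -- Both δ|B| and δ|D| are at most |D|/2, by the hypothesis `h` and by δ < 1/2.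
  have hB : ((B.card : ℝ) + D.card) * p.δ ≤ D.card := by
    push_cast at h
    nlinarith [(Nat.cast_nonneg D.card : (0 : ℝ) ≤ D.card)]
  have hLd : (0 : ℝ) ≤ p.Ld := Nat.cast_nonneg _
  have hd : (0 : ℝ) ≤ p.d := Nat.cast_nonneg _
  rw [Params.rate, ← hq, div_mul_eq_mul_div, le_div_iff₀ (by positivity)]
  have h2 := mul_le_mul_of_nonneg_left h1 hLd
  have h3 := mul_le_mul_of_nonneg_left hB (by positivity : 0 ≤ p.Ld * (p.ε * p.d))
  have h4 : 0 ≤ (p.Ld : ℝ) * (D.card * (p.ε * p.d)) := by positivity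
  push_cast at *
  nlinarith

/-- The deleted edges pay for a rebuild if all classes have many lossy nodes. -/
theorem lossy_pays {B D : Finset ℕ} {s : Memory} (hD : (D.card : ℝ) ≤ p.δ * ((2 * B.card : ℕ) : ℝ))
    (h : ∀ c, p.K ≤ c → c < 2 * p.K → p.δ * ((2 * B.card : ℕ) : ℝ) < (lossy p s c).card) :
    1700 * (p.Ld : ℝ) * (((B.card + D.card) * p.d : ℕ) : ℝ) ≤
      p.rate * (dead s (p.n ^ 3)).card := by
  classical
  set q : ℝ := 12 * (p.L * p.L * p.g) with hq
  have hε := hp.ε_pos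
  have hδ := hp.δ_pos
  have hδ2 := hp.δ_lt
  have hK := p.K_pos
  have hLd : (0 : ℝ) ≤ p.Ld := Nat.cast_nonneg _
  have hd : (0 : ℝ) ≤ p.d := Nat.cast_nonneg _
  have h0 : (∑ c ∈ Finset.Ico p.K (2 * p.K), ∑ v ∈ Finset.range p.n,
      ((lost s (p.n ^ 3) v c).card : ℝ)) ≤ 2 * (dead s (p.n ^ 3)).card := by
    exact_mod_cast sum_lost_le p s (p.n ^ 3) (Finset.Ico p.K (2 * p.K))
  -- Each of the K classes has more than 2δ|B| lossy nodes, and each of them has lost at least ε d /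
  -- (K q) edges of the class; the factor K cancels afterwards.
  have h1 : (p.K : ℝ) * (p.δ * ((2 * B.card : ℕ) : ℝ) * (p.ε * p.d)) ≤
      (∑ c ∈ Finset.Ico p.K (2 * p.K), ∑ v ∈ Finset.range p.n,
        ((lost s (p.n ^ 3) v c).card : ℝ)) * (p.K * q) := by
    have hcard : (Finset.Ico p.K (2 * p.K)).card = p.K := by rw [Nat.card_Ico]; omega
    rw [Finset.sum_mul]
    nth_rewrite 1 [← hcard]
    rw [← nsmul_eq_mul]
    refine Finset.card_nsmul_le_sum _ _ _ fun c hc => ?_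
    rw [Finset.mem_Ico] at hc
    refine (mul_le_mul_of_nonneg_right (h c hc.1 hc.2).le hp.εd_pos.le).trans ?_
    have hsub : lossy p s c ⊆ Finset.range p.n := Finset.filter_subset _ _
    rw [Finset.sum_mul, ← nsmul_eq_mul]
    refine le_trans (Finset.card_nsmul_le_sum _ (fun v => ((lost s (p.n ^ 3) v c).card : ℝ) * (p.K * q))
      _ fun v hv => ?_) (Finset.sum_le_sum_of_subset_of_nonneg hsub fun _ _ _ => by positivity)
    rw [lossy, Finset.mem_filter, Params.FewIn, not_lt] at hv
    have := hv.2
    rw [hq]; push_cast at this ⊢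
    linarith
  have h2 := h1.trans (mul_le_mul_of_nonneg_right h0 (by positivity : 0 ≤ p.K * q))
  have h3 : p.δ * B.card * (p.ε * p.d) ≤ (dead s (p.n ^ 3)).card * q := by
    push_cast at h2
    have : (p.K : ℝ) * (p.δ * B.card * (p.ε * p.d)) ≤ p.K * ((dead s (p.n ^ 3)).card * q) := by
      linarith
    exact le_of_mul_le_mul_left this hK
  -- Since 2δ < 1, the dirty nodes at most double |B| + |D|, which the constant 5000 in `rate`
  -- absorbs.
  have h4 : (D.card : ℝ) ≤ B.card := by
    push_cast at hD
    nlinarith [(Nat.cast_nonneg B.card : (0 : ℝ) ≤ B.card)]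
  rw [Params.rate, ← hq, div_mul_eq_mul_div, le_div_iff₀ (by positivity)]
  have h5 := mul_le_mul_of_nonneg_left h3 hLd
  have h6 := mul_le_mul_of_nonneg_left h4 (by positivity : 0 ≤ p.Ld * (p.ε * p.d) * p.δ)
  have h7 : 0 ≤ (p.Ld : ℝ) * (p.δ * B.card * (p.ε * p.d)) := by positivity
  push_cast at *
  nlinarith

end Params.Admissible

/-- In a nonempty phase the K classes are absorbed by the edge bound, as K ≤ d. An empty phase has
no such bound, which is why `remaining` does not charge for its classes. -/
theorem remaining_le {p : Params} (hp : p.Admissible) {s : Memory} {b : ℕ}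
    (h11 : s.vars 11 ≤ b * p.d) (h12 : s.vars 12 = p.K) : remaining p s ≤ 2 * (b * p.d) := by
  have h1 : ((Finset.Icc 1 (s.vars 11)).filter fun e => s.vars 12 < s.arrs 20 e).card ≤ s.vars 11 :=
    (Finset.card_filter_le _ _).trans (by simp)
  rw [remaining, h12]
  rw [h12] at h1
  split_ifs with h0
  · omega
  · have hb : 1 ≤ b := by
      rcases Nat.eq_zero_or_pos b with hb | hb
      · rw [hb] at h11; omega
      · exact hb
    have := hp.K_le_d
    have : p.d ≤ b * p.d := Nat.le_mul_of_pos_left _ hb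
    omega

/-! ### Restoring the bounds on the numbers of bad nodes -/

/-- The search ends at 2K at the latest: no edge has this class, so no node is lossy for it. In an
empty phase it does not move at all. -/
theorem RunT.advance {p : Params} {B : Finset ℕ} {s : Memory} (hp : p.Admissible) (hM : p.Fit M)
    (hB : s.arrs 10 0 = B.card) (hc : ∀ c, s.arrs 23 c ≠ 0 → c < 2 * p.K ∧ s.vars 11 ≠ 0)
    (hcur : s.vars 12 ≤ 2 * p.K) :
    RunT M Cmd.advance s fun s' t => s'.vars 28 = s.vars 12 ∧ s.vars 12 ≤ s'.vars 12 ∧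
      s'.vars 12 ≤ 2 * p.K ∧ (s.vars 11 = 0 → s'.vars 12 = s.vars 12) ∧
      (∀ c, s.vars 12 ≤ c → c < s'.vars 12 → p.δ * ((2 * B.card : ℕ) : ℝ) < s.arrs 23 c) ∧
      (s.arrs 23 (s'.vars 12) : ℝ) ≤ p.δ * ((2 * B.card : ℕ) : ℝ) ∧
      t ≤ 40 * (s'.vars 12 - s.vars 12) + 100 := by
  have hK := hp.K_bound
  have hQ := hp.cube_add_one_le hM
  have hcube := hp.n_lt_cube
  set cur := s.vars 12 with hcur'
  have h1 : Run M (.seq (.assign 28 (.var 12)) (.assign 13 (.const 1))) s 10 fun s' =>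
      s' = (s.setVar 28 cur).setVar 13 1 := Run.block rfl rfl (by simp [Cmd.wp, ← hcur'])
  refine RunT.seq (RunT.mono h1 ?_)
  rintro s₁ t₁ hS₁ _ ⟨ht₁, rfl⟩
  refine RunT.mono (RunT.loop (by rfl) (fun k s' => s'.arrs 23 = s.arrs 23 ∧ s'.arrs 10 = s.arrs 10 ∧
    s'.vars 28 = cur ∧ cur ≤ s'.vars 12 ∧ s'.vars 12 ≤ 2 * p.K ∧
    (s.vars 11 = 0 → s'.vars 12 = cur) ∧
    (∀ c, cur ≤ c → c < s'.vars 12 → p.δ * ((2 * B.card : ℕ) : ℝ) < s.arrs 23 c) ∧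
    s'.vars 13 ≤ 1 ∧
    (s'.vars 13 = 0 → (s.arrs 23 (s'.vars 12) : ℝ) ≤ p.δ * ((2 * B.card : ℕ) : ℝ)) ∧
    k = 40 * (2 * p.K - s'.vars 12) + 40 * s'.vars 13) ?_
    (k := 40 * (2 * p.K - cur) + 40) ⟨rfl, rfl, by simp, by simp [← hcur'], by simpa using hcur,
      fun _ => by simp [← hcur'], fun c h1 h2 => ?_, by simp, by simp, by simp [← hcur']⟩) ?_
  · rintro k s' ⟨g1, g2, g3, g4, g5, g6, g7, g8, g9, rfl⟩ hb
    have hb1 : s'.vars 13 = 1 := by simpa using hb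
    by_cases hle : (s.arrs 23 (s'.vars 12) : ℝ) ≤ p.δ * ((2 * B.card : ℕ) : ℝ)
    · have hle' : (s.arrs 23 (s'.vars 12) : ℝ) ≤ p.δ * (2 * (B.card : ℝ)) := by
        push_cast at hle; exact hle
      refine RunT.mono (Run.block (T := 20) rfl rfl (P := fun s'' => s'' = s'.setVar 13 0) ?_) ?_
      · simp [Cmd.wp, hM.δ, g1, g2, hB]
        intro h; linarith
      · rintro s'' t _ _ ⟨ht, rfl⟩
        refine ⟨_, ⟨g1, g2, by simpa using g3, by simpa using g4, by simpa using g5,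
          by simpa using g6, by simpa using g7, by simp, by simpa using hle', rfl⟩, ?_⟩
        rw [hb1]; simp [Test.cost, Expr.cost]; omega
    · have hle' : ¬ (s.arrs 23 (s'.vars 12) : ℝ) ≤ p.δ * (2 * (B.card : ℝ)) := by
        push_cast at hle; exact hle
      have hne : s.arrs 23 (s'.vars 12) ≠ 0 := by
        intro h0
        rw [h0] at hle
        have := hp.δ_pos
        exact hle (by rw [Nat.cast_zero]; positivity)
      obtain ⟨k1, k2⟩ := hc _ hne
      refine RunT.mono (Run.block (T := 20) rfl rfl
        (P := fun s'' => s'' = s'.setVar 12 (s'.vars 12 + 1)) ?_) ?_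
      · simp [Cmd.wp, hM.δ, g1, g2, hB]
        exact ⟨fun h => absurd h hle', fun _ => by omega⟩
      · rintro s'' t _ _ ⟨ht, rfl⟩
        refine ⟨_, ⟨g1, g2, by simpa using g3, by simp; omega, by simp; omega,
          fun h => absurd h k2, fun c h1 h2 => ?_, by simp [hb1], by simp [hb1], rfl⟩, ?_⟩
        · rw [Memory.setVar_vars, Function.update_self] at h2
          by_cases hcc : c = s'.vars 12
          · rw [hcc]; exact not_le.1 hle
          · exact g7 c h1 (by omega)
        · simp [Test.cost, Expr.cost, hb1]; omega
  · simp [← hcur'] at h2; omega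
  · rintro s₂ t₂ _ _ ⟨k, ⟨g1, g2, g3, g4, g5, g6, g7, g8, g9, rfl⟩, hb, hk⟩
    have hb0 : s₂.vars 13 ≠ 1 := by simpa using hb
    refine ⟨g3, g4, g5, g6, g7, g9 (by omega), ?_⟩
    simp [Test.cost, Expr.cost] at hk
    omega

end DynSkeleton

/-! ### The amortized cost of restoring the bounds -/

namespace DynSkeleton

variable {M : Machine}

/-- The edges of the new current class are no longer ahead of it, and neither are the classes
stepped over; this releases the payment for the search and for loading the class. -/
theorem remaining_advance {p : Params} {s s' : Memory} (h11 : s'.vars 11 = s.vars 11)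
    (h20 : s'.arrs 20 = s.arrs 20) (hlt : s.vars 12 < s'.vars 12) (hle : s'.vars 12 ≤ 2 * p.K)
    (h0 : s.vars 11 ≠ 0) :
    remaining p s' + (s'.vars 12 - s.vars 12) +
      (edgesOf (s.arrs 20) (s.vars 11) (s'.vars 12)).card ≤ remaining p s := by
  rw [remaining, remaining, h11, h20, if_neg h0, if_neg h0]
  have h1 : ((Finset.Icc 1 (s.vars 11)).filter fun e => s'.vars 12 < s.arrs 20 e).card +
      (edgesOf (s.arrs 20) (s.vars 11) (s'.vars 12)).card ≤
      ((Finset.Icc 1 (s.vars 11)).filter fun e => s.vars 12 < s.arrs 20 e).card := by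
    rw [edgesOf, ← Finset.card_union_of_disjoint]
    · apply Finset.card_le_card
      intro e he
      simp only [Finset.mem_union, Finset.mem_filter] at he ⊢
      rcases he with he | he
      · exact ⟨he.1, by omega⟩
      · exact ⟨he.1, by omega⟩
    · rw [Finset.disjoint_filter]
      intro e _ h2 h3
      omega
  omega

/-- The numbers of bad nodes are small. -/
structure Settled (p : Params) (B D : Finset ℕ) (s : Memory) : Prop where
  dirty : (D.card : ℝ) ≤ p.δ * ((2 * B.card : ℕ) : ℝ)
  lossy : (s.arrs 23 (s.vars 12) : ℝ) ≤ p.δ * ((2 * B.card : ℕ) : ℝ)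
  cur_lt : s.vars 12 < 2 * p.K

/-- 1700 consists of 1300 for the rebuild itself and of 400 = 200 · 2 for the classes of the new
phase, which are paid in advance by `remaining_le`. The summand 1300 L_d covers the rebuild of an
empty phase. -/
theorem RunT.rebuild {p : Params} {N : ℕ → Finset ℕ} {B D X : Finset ℕ} {s : Memory}
    (hp : p.Admissible) (hM : p.Fit M) (hN : Neighbours p.n p.d N) (hC : Ctx p s)
    (hNodes : Nodes p N B D s) (hPhase : Phase p N s) (hDeg : Degrees p N B D (fun _ => 0) s)
    (hX : SetFam (p.n ^ 3) (s.arrs 11) (s.arrs 12) (s.arrs 13) (single X))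
    (hpay : 1700 * (p.Ld : ℝ) * (((B.card + D.card) * p.d : ℕ) : ℝ) ≤
      p.rate * ((∑ v ∈ D, s.arrs 17 v : ℕ) + (dead s (p.n ^ 3)).card)) :
    RunT M Cmd.rebuild s fun s' t => ∃ B' D', Inv p N B' D' (fun _ => 0) s' ∧ Settled p B' D' s' ∧
      (t : ℝ) + potential p s' ≤ potential p s + 1300 * p.Ld := by
  refine RunT.mono (Run.rebuild hp hM hN hC hNodes hPhase hDeg hX) ?_
  rintro s' t _ _ ⟨ht, B', k1, k2, k3, k4, k5, k6, k7, k8, k9⟩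
  have hδ := hp.δ_pos
  have hK := hp.two_le_K
  refine ⟨B', ∅, ⟨k1, k2, k3, k4⟩, ⟨by simp; positivity, by rw [k7, Nat.cast_zero]; positivity,
    by omega⟩, ?_⟩
  have hR := remaining_le hp k5 k6
  set w := (B.card + D.card) * p.d with hw
  rw [potential, potential, k8, ← k9]
  have ht' : (t : ℝ) ≤ 1300 * p.Ld * (w + 1) := by exact_mod_cast ht
  have hR' : (remaining p s' : ℝ) ≤ 2 * w := by exact_mod_cast hR
  have hLd : (1 : ℝ) ≤ p.Ld := by exact_mod_cast hp.Ld_pos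
  have h0 : (0 : ℝ) ≤ remaining p s := Nat.cast_nonneg _
  have h1 : (w : ℝ) ≤ p.Ld * w := by nlinarith [(Nat.cast_nonneg w : (0 : ℝ) ≤ w)]
  rw [Finset.card_empty]
  push_cast at *
  nlinarith

theorem RunT.restore {p : Params} {N : ℕ → Finset ℕ} {B D : Finset ℕ} {s : Memory}
    (hp : p.Admissible) (hM : p.Fit M) (hN : Neighbours p.n p.d N) (hC : Ctx p s)
    (hI : Inv p N B D (fun _ => 0) s) :
    RunT M Cmd.restore s fun s' t => ∃ B' D', Inv p N B' D' (fun _ => 0) s' ∧ Settled p B' D' s' ∧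
      (t : ℝ) + potential p s' ≤ potential p s + 2000 * p.Ld := by
  classical
  have hLd : (1 : ℝ) ≤ p.Ld := by exact_mod_cast hp.Ld_pos
  have hB : s.arrs 10 0 = B.card := by simpa using hI.nodes.clean.card 0
  have hD : s.arrs 7 0 = D.card := by simpa using hI.nodes.dirty.card 0
  have hrate : 0 ≤ p.rate := by
    have := hp.ε_pos
    have := hp.δ_pos
    rw [Params.rate]; positivity
  have hK := hp.K_bound
  have hQ := hp.cube_add_one_le hM
  have hcube := hp.n_lt_cube
  have hsq := hp.sq_lt_cube
  refine RunT.ite rfl (fun hb => ?_) (fun hb => ?_)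
  · have hb' : (D.card : ℝ) ≤ p.δ * ((2 * B.card : ℕ) : ℝ) := by
      simpa [hM.δ, hB, hD] using hb
    -- A lossy node has lost an edge, so the class occurs in the phase and is below 2K.
    have hc : ∀ c, s.arrs 23 c ≠ 0 → c < 2 * p.K ∧ s.vars 11 ≠ 0 := by
      intro c h0
      rw [hI.phase.lossy c, Finset.card_ne_zero] at h0
      obtain ⟨v, hv⟩ := h0
      rw [lossy, Finset.mem_filter] at hv
      have hne : (lost s (p.n ^ 3) v c).Nonempty := by
        rw [Finset.nonempty_iff_ne_empty]
        intro h0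
        exact hv.2 (by rw [h0]; exact hp.fewIn_zero)
      obtain ⟨e, he⟩ := hne
      simp only [lost, edgesAt, Finset.mem_filter, Finset.mem_Icc] at he
      have := hI.phase.class_lt e he.1.1.1 he.1.1.2
      omega
    refine RunT.seq (RunT.mono (RunT.advance hp hM hB hc hI.degrees.cur_le) ?_)
    rintro s₁ t₁ hS₁ _ ⟨a1, a2, a3, a4, a5, a6, a7⟩
    have hC₁ := hC.same hS₁ (by decide)
    have f11 : s₁.vars 11 = s.vars 11 := hS₁.vars 11 (by decide)
    have fA : ∀ a, s₁.arrs a = s.arrs a := fun a => hS₁.arrs a (by simp [Cmd.advance, Cmd.wa])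
    have hph₁ : Phase p N s₁ := hI.phase.congr f11 (fun a _ => fA a) fun _ _ _ _ h => h
    have hno₁ : Nodes p N B D s₁ := hI.nodes.congr fun a _ => fA a
    have hpassed : ∀ c, p.K ≤ c → c < s₁.vars 12 → p.δ * ((2 * B.card : ℕ) : ℝ) < s.arrs 23 c := by
      intro c h1 h2
      by_cases h3 : c < s.vars 12
      · exact hI.degrees.passed c h1 h3
      · exact a5 c (not_lt.1 h3) h2
    have hde₁ : Degrees p N B D (fun _ => 0) s₁ := by
      have he := edgesAt_congr f11 fun a _ => fA a
      obtain ⟨g1, g2, g3, g4, g5, g6, g7, g8, g9⟩ := hI.degrees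
      exact ⟨by rwa [he], by rwa [fA], by rwa [fA], by rwa [he, fA], by rwa [he, fA], by rwa [f11],
        by rwa [fA], a3, by rw [f11]; exact g9.imp (fun h => h.trans a2) id⟩
    have hX₁ : SetFam (p.n ^ 3) (s₁.arrs 11) (s₁.arrs 12) (s₁.arrs 13)
        (single (aliveOf s (p.n ^ 3) (s.vars 11) (s.vars 12))) := by
      rw [fA, fA, fA]; exact hI.listed.fam
    have hpot : potential p s₁ = potential p s - 200 * remaining p s + 200 * remaining p s₁ := by
      rw [potential, potential, charge_congr (fA 17), dead_congr f11 fun a _ => fA a]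
      ring
    have hadv : s.vars 12 < s₁.vars 12 → remaining p s₁ + (s₁.vars 12 - s.vars 12) +
        (edgesOf (s.arrs 20) (s.vars 11) (s₁.vars 12)).card ≤ remaining p s := by
      intro hlt
      exact remaining_advance f11 (fA 20) hlt a3 fun h0 => by have := a4 h0; omega
    have hrem : s₁.vars 12 = s.vars 12 → remaining p s₁ = remaining p s :=
      fun h => remaining_congr f11 h (fA 20)
    have hR : 40 * (s₁.vars 12 - s.vars 12) + 40 * remaining p s₁ ≤ 40 * remaining p s := by
      rcases a2.eq_or_lt with h | h
      · rw [← h, hrem h.symm]; omega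
      · have := hadv h; omega
    have hR' : remaining p s₁ ≤ remaining p s := by omega
    have hRr : (remaining p s₁ : ℝ) ≤ remaining p s := by exact_mod_cast hR'
    have ht₁r : (t₁ : ℝ) + 40 * remaining p s₁ ≤ 40 * remaining p s + 100 := by
      exact_mod_cast (by omega : t₁ + 40 * remaining p s₁ ≤ 40 * remaining p s + 100)
    refine RunT.ite rfl (fun hb₁ => ?_) (fun hb₁ => ?_)
    · have h2K : s₁.vars 12 = 2 * p.K := by
        have : s₁.vars 12 = s₁.vars 9 + s₁.vars 9 := hb₁
        rw [this, hC₁.K]; omega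
      refine RunT.mono (RunT.rebuild hp hM hN hC₁ hno₁ hph₁ hde₁ hX₁ ?_) ?_
      -- All classes from K to 2K - 1 have been passed, so each of them has too many lossy nodes.
      · have := hp.lossy_pays (s := s₁) hb' (fun c h1 h2 => by
          rw [← hph₁.lossy c, fA]; exact hpassed c h1 (by omega))
        refine this.trans (mul_le_mul_of_nonneg_left ?_ hrate)
        have : (0 : ℝ) ≤ ((∑ v ∈ D, s₁.arrs 17 v : ℕ) : ℝ) := Nat.cast_nonneg _
        linarith
      · rintro s₂ t₂ _ _ ⟨B', D', k1, k2, k3⟩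
        refine ⟨B', D', k1, k2, ?_⟩
        simp [Test.cost, Expr.cost]
        linarith
    · have h2K : s₁.vars 12 ≠ 2 * p.K := by
        intro h
        apply hb₁
        change s₁.vars 12 = s₁.vars 9 + s₁.vars 9
        rw [h, hC₁.K]; omega
      refine RunT.ite rfl (fun hb₂ => ?_) (fun hb₂ => ?_)
      · have heq : s₁.vars 12 = s.vars 12 := by rw [← a1]; exact hb₂
        refine RunT.mono (Run.block (T := 5) (P := fun s' => s' = s₁) rfl rfl rfl) ?_
        rintro s₂ t₂ _ _ ⟨ht₂, rfl⟩
        refine ⟨B, D, hI.congr f11 heq fA, ⟨hb', by rw [fA]; exact a6, by omega⟩, ?_⟩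
        have : (t₂ : ℝ) ≤ 5 := by exact_mod_cast ht₂
        simp [Test.cost, Expr.cost]
        linarith
      · have hne : s₁.vars 12 ≠ s.vars 12 := by rw [← a1]; exact hb₂
        have hlt : s.vars 12 < s₁.vars 12 := by omega
        have hadv' := hadv hlt
        refine RunT.mono (Run.load (r := p.n ^ 3) (m := s.vars 11) (c := s₁.vars 12) hC₁.cube rfl
          (by have := hI.phase.count_le; omega) hQ (by
            rw [fA, fA, fA, fA]; exact hI.phase.classes) hX₁) ?_
        rintro s₂ t₂ hS₂ _ ⟨ht₂, hL⟩
        have f12 : s₂.vars 12 = s₁.vars 12 := hS₂.vars 12 (by decide)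
        have f11' : s₂.vars 11 = s₁.vars 11 := hS₂.vars 11 (by decide)
        rw [fA] at ht₂
        refine ⟨B, D, ⟨hno₁.congr ?_, hph₁.congr f11' ?_ fun _ _ _ _ h => h, hde₁.congr f11' f12 ?_, ?_⟩,
          ⟨hb', by rw [hS₂.arrs 23 (by decide), fA, f12]; exact a6, by omega⟩, ?_⟩
        · simp only [List.mem_cons, List.not_mem_nil, or_false, forall_eq_or_imp, forall_eq]
          exact ⟨hS₂.arrs 2 (by decide), hS₂.arrs 3 (by decide), hS₂.arrs 4 (by decide),
            hS₂.arrs 5 (by decide), hS₂.arrs 6 (by decide), hS₂.arrs 7 (by decide),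
            hS₂.arrs 8 (by decide), hS₂.arrs 9 (by decide), hS₂.arrs 10 (by decide),
            hS₂.arrs 17 (by decide), hS₂.arrs 27 (by decide)⟩
        · simp only [List.mem_cons, List.not_mem_nil, or_false, forall_eq_or_imp, forall_eq]
          exact ⟨hS₂.arrs 14 (by decide), hS₂.arrs 15 (by decide), hS₂.arrs 16 (by decide),
            hS₂.arrs 18 (by decide), hS₂.arrs 19 (by decide), hS₂.arrs 20 (by decide),
            hS₂.arrs 21 (by decide), hS₂.arrs 22 (by decide), hS₂.arrs 23 (by decide),
            hS₂.arrs 26 (by decide)⟩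
        · simp only [List.mem_cons, List.not_mem_nil, or_false, forall_eq_or_imp, forall_eq]
          exact ⟨hS₂.arrs 17 (by decide), hS₂.arrs 18 (by decide), hS₂.arrs 19 (by decide),
            hS₂.arrs 23 (by decide)⟩
        · rw [f11', f11, f12, aliveOf_congr (s := s₁)]
          · exact hL
          · simp only [List.mem_cons, List.not_mem_nil, or_false, forall_eq_or_imp, forall_eq]
            exact ⟨hS₂.arrs 18 (by decide), hS₂.arrs 19 (by decide), hS₂.arrs 20 (by decide),
              hS₂.arrs 21 (by decide)⟩
        · have hpot₂ : potential p s₂ = potential p s₁ := by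
            rw [potential, potential, charge_congr (hS₂.arrs 17 (by decide)), dead_congr f11',
              remaining_congr f11' f12 (hS₂.arrs 20 (by decide))]
            simp only [List.mem_cons, List.not_mem_nil, or_false, forall_eq_or_imp, forall_eq]
            exact ⟨hS₂.arrs 18 (by decide), hS₂.arrs 19 (by decide), hS₂.arrs 21 (by decide)⟩
          have ht : t₁ + t₂ + 200 * remaining p s₁ ≤ 200 * remaining p s + 130 := by omega
          have htr : (t₁ : ℝ) + t₂ + 200 * remaining p s₁ ≤ 200 * remaining p s + 130 := by
            exact_mod_cast ht
          simp [Test.cost, Expr.cost]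
          linarith
  · have hb' : p.δ * ((2 * B.card : ℕ) : ℝ) < D.card := by
      rw [← not_le]; intro h; exact hb (by simpa [hM.δ, hB, hD] using h)
    refine RunT.mono (RunT.rebuild hp hM hN hC hI.nodes hI.phase hI.degrees hI.listed.fam ?_) ?_
    · refine (hp.dirty_pays hb' (f := s.arrs 17) fun v hv => ((hI.nodes.mem_dirty v).1 hv).2).trans
        (mul_le_mul_of_nonneg_left ?_ hrate)
      have : (0 : ℝ) ≤ ((dead s (p.n ^ 3)).card : ℝ) := Nat.cast_nonneg _
      linarith
    · rintro s₂ t₂ _ _ ⟨B', D', k1, k2, k3⟩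
      refine ⟨B', D', k1, k2, ?_⟩
      simp [Test.cost, Expr.cost]
      linarith

end DynSkeleton

namespace DynSkeleton

variable {M : Machine}

/-! ### An edge update -/

/-- The state of the machine between two edge updates. -/
structure Ready (p : Params) (N : ℕ → Finset ℕ) (B D : Finset ℕ) (s : Memory) : Prop where
  n : s.vars 3 = p.n
  d : s.vars 4 = p.d
  L : s.vars 5 = p.L
  Ld : s.vars 6 = p.Ld
  inv : Inv p N B D (fun _ => 0) s
  settled : Settled p B D s
  size : s.vars 7 = s.arrs 13 0

theorem potential_congr {p : Params} {s s' : Memory} (h11 : s'.vars 11 = s.vars 11)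
    (h12 : s'.vars 12 = s.vars 12) (hA : ∀ a, s'.arrs a = s.arrs a) :
    potential p s' = potential p s := by
  rw [potential, potential, charge_congr (hA 17), dead_congr h11 fun a _ => hA a,
    remaining_congr h11 h12 (hA 20)]

/-- The amortized cost of an edge update. -/
noncomputable def Params.price (p : Params) : ℝ := 3 * p.rate + 2100 * p.Ld + 50 * p.g + 1200

theorem RunT.update {p : Params} {N N' : ℕ → Finset ℕ} {B D : Finset ℕ} {s : Memory} {u v : ℕ}
    (hp : p.Admissible) (hM : p.Fit M) (h3 : s.vars 3 = p.n) (h4 : s.vars 4 = p.d)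
    (h5 : s.vars 5 = p.L) (h6 : s.vars 6 = p.Ld) (h1 : s.vars 1 = u) (h2 : s.vars 2 = v)
    (hu : u < p.n) (hv : v < p.n) (huv : u ≠ v) (hN : Changes N N' (s.vars 0) u v)
    (hN' : Neighbours p.n p.d N') (hI : Inv p N B D (fun _ => 0) s) :
    RunT M Cmd.update s fun s' t => ∃ B' D', Ready p N' B' D' s' ∧
      (t : ℝ) + potential p s' ≤ potential p s + p.price := by
  refine RunT.seq (RunT.mono (Run.setup hp hM h3 h4 h5 h6) ?_)
  rintro s₁ t₁ hS₁ _ ⟨ht₁, hC₁⟩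
  have fA : ∀ a, s₁.arrs a = s.arrs a := fun a => hS₁.arrs a (by
    simp [Cmd.setup, Cmd.wa, Cmd.forUp])
  have f11 : s₁.vars 11 = s.vars 11 := hS₁.vars 11 (by decide)
  have f12 : s₁.vars 12 = s.vars 12 := hS₁.vars 12 (by decide)
  have hpot₁ : potential p s₁ = potential p s := potential_congr f11 f12 fA
  refine RunT.seq (RunT.mono (Run.changeEdge hp hM hC₁ (by rw [hS₁.vars 1 (by decide), h1])
    (by rw [hS₁.vars 2 (by decide), h2]) hu hv huv (by rwa [hS₁.vars 0 (by decide)])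
    (hI.congr f11 f12 fA)) ?_)
  rintro s₂ t₂ hS₂ _ ⟨ht₂, hI₂, c₂, d₂, r₂⟩
  have hS02 := hS₁.trans hS₂
  have hC₂ := hC₁.same hS₂ (by decide)
  refine RunT.seq (RunT.mono (Run.touchAt (x := 1) (v := u) hp hM hC₂ hI₂ (by
    rw [hS02.vars 1 (by decide), h1]) hu (by simp)) ?_)
  rintro s₃ t₃ hS₃ _ ⟨ht₃, B₃, D₃, hI₃, c₃, d₃, r₃⟩
  have hS03 := hS02.trans hS₃
  have hC₃ := hC₂.same hS₃ (by decide)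
  refine RunT.seq (RunT.mono (Run.touchAt (x := 2) (v := v) hp hM hC₃ hI₃ (by
    rw [hS03.vars 2 (by decide), h2]) hv (by simp [huv.symm])) ?_)
  rintro s₄ t₄ hS₄ _ ⟨ht₄, B₄, D₄, hI₄, c₄, d₄, r₄⟩
  have hS04 := hS03.trans hS₄
  have hC₄ := hC₃.same hS₄ (by decide)
  -- Both pending updates have been counted, so nothing is outstanding.
  have hσ : Function.update (Function.update (fun w => if w = u ∨ w = v then 1 else 0) u 0) v 0 =
      fun _ => 0 := by
    funext w
    by_cases hwv : w = v
    · subst hwv; simp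
    · by_cases hwu : w = u
      · subst hwu; simp [hwv]
      · simp [hwv, hwu]
  rw [hσ] at hI₄
  refine RunT.seq (RunT.mono (RunT.restore hp hM hN' hC₄ hI₄) ?_)
  rintro s₅ t₅ hS₅ _ ⟨B', D', hI₅, hs₅, ht₅⟩
  have hS05 := hS04.trans hS₅
  have hlast : Run M (.assign 7 (.read 13 (.const 0))) s₅ 5
      fun s' => s' = s₅.setVar 7 (s₅.arrs 13 0) := Run.block rfl rfl (by simp [Cmd.wp])
  refine RunT.mono hlast ?_
  rintro s₆ t₆ hS₆ _ ⟨ht₆, rfl⟩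
  have hS06 := hS05.trans hS₆
  have hpot₆ := potential_congr (p := p) (s := s₅) (s' := s₅.setVar 7 (s₅.arrs 13 0))
    (hS₆.vars 11 (by decide)) (hS₆.vars 12 (by decide)) fun _ => rfl
  refine ⟨B', D', ⟨by rw [hS06.vars 3 (by decide), h3], by rw [hS06.vars 4 (by decide), h4],
    by rw [hS06.vars 5 (by decide), h5], by rw [hS06.vars 6 (by decide), h6],
    hI₅.congr (hS₆.vars 11 (by decide)) (hS₆.vars 12 (by decide)) fun _ => rfl,
    ⟨hs₅.dirty, by rw [hS₆.vars 12 (by decide)]; exact hs₅.lossy,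
      by rw [hS₆.vars 12 (by decide)]; exact hs₅.cur_lt⟩, by simp⟩, ?_⟩
  have hrate : 0 ≤ p.rate := by
    have := hp.ε_pos
    have := hp.δ_pos
    rw [Params.rate]; positivity
  -- Two counters and the number of deleted edges grow by at most 1 each.
  have hpot₄ : potential p s₄ ≤ potential p s₁ + 3 * p.rate := by
    rw [potential, potential, d₄, d₃, r₄, r₃, r₂]
    have e1 : charge p s₄ + (dead s₂ (p.n ^ 3)).card ≤ charge p s₁ + (dead s₁ (p.n ^ 3)).card + 3 := by
      omega
    have e2 : (charge p s₄ : ℝ) + (dead s₂ (p.n ^ 3)).card ≤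
        charge p s₁ + (dead s₁ (p.n ^ 3)).card + 3 := by exact_mod_cast e1
    have := mul_le_mul_of_nonneg_left e2 hrate
    linarith
  have ht₁' : (t₁ : ℝ) ≤ 20 * p.Ld + 50 * p.g + 100 := by exact_mod_cast ht₁
  have ht₂' : (t₂ : ℝ) ≤ 600 := by exact_mod_cast ht₂
  have ht₃' : (t₃ : ℝ) ≤ 205 := by exact_mod_cast ht₃
  have ht₄' : (t₄ : ℝ) ≤ 205 := by exact_mod_cast ht₄
  have ht₆' : (t₆ : ℝ) ≤ 5 := by exact_mod_cast ht₆
  have hLd : (0 : ℝ) ≤ p.Ld := Nat.cast_nonneg _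
  rw [hpot₆, Params.price]
  push_cast
  linarith

/-- The rate dominates, and γ g ≤ 2 replaces g by 2/γ. In terms of `V` the sum is at most 360000 +
2100 + 100 + 1200 < 400000. The first power of L_d would suffice; the cube enters only through L_d ≥
1. -/
theorem Params.Admissible.price_le {p : Params} (hp : p.Admissible) :
    p.price ≤ 400000 * ((p.L : ℝ) ^ 2 * (p.Ld : ℝ) ^ 3 / (p.ε * p.γ * p.δ)) := by
  have hε := hp.ε_pos
  have hε1 := hp.ε_lt
  have hγ := hp.γ_pos
  have hγ1 := hp.γ_lt
  have hδ := hp.δ_pos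
  have hδ1 := hp.δ_lt
  have hLd : (1 : ℝ) ≤ p.Ld := by exact_mod_cast hp.Ld_pos
  have hL : (1 : ℝ) ≤ p.L := by exact_mod_cast hp.L_pos
  have hL2 : (1 : ℝ) ≤ (p.L : ℝ) ^ 2 := one_le_pow₀ hL
  have hLd3 : (p.Ld : ℝ) ≤ (p.Ld : ℝ) ^ 3 := le_self_pow₀ hLd (by norm_num)
  have hg := hp.γ_g_le
  have hg' : (p.g : ℝ) ≤ 2 / p.γ := by rw [le_div_iff₀ hγ]; linarith
  set V : ℝ := p.L ^ 2 * p.Ld / (p.ε * p.γ * p.δ) with hV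
  have hVU : V ≤ (p.L : ℝ) ^ 2 * (p.Ld : ℝ) ^ 3 / (p.ε * p.γ * p.δ) := by
    rw [hV]
    gcongr
  have hrate : p.rate ≤ 120000 * V := by
    have : p.rate = 60000 * (p.Ld * p.L ^ 2) / (p.ε * p.δ) * p.g := by
      rw [Params.rate]; ring
    rw [this]
    refine (mul_le_mul_of_nonneg_left hg' (by positivity)).trans_eq ?_
    rw [hV]
    field_simp
    ring
  have hεδ : p.ε * p.δ ≤ 1 := by nlinarith
  have hV1 : 1 / p.γ ≤ V := by
    rw [hV, div_le_div_iff₀ hγ (by positivity)]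
    have : 1 ≤ (p.L : ℝ) ^ 2 * p.Ld := by nlinarith
    nlinarith [mul_le_mul_of_nonneg_right hεδ hγ.le, mul_le_mul_of_nonneg_right this hγ.le]
  have hV2 : (p.Ld : ℝ) ≤ V := by
    rw [hV, le_div_iff₀ (by positivity)]
    have h1 : p.ε * p.γ * p.δ ≤ 1 := by nlinarith
    have h2 : (p.Ld : ℝ) * (p.ε * p.γ * p.δ) ≤ p.Ld * 1 := mul_le_mul_of_nonneg_left h1 (by linarith)
    nlinarith
  have hV3 : 1 ≤ V := hLd.trans hV2
  have hg2 : (p.g : ℝ) ≤ 2 * V := by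
    refine hg'.trans ?_
    rw [div_eq_mul_one_div]
    linarith
  rw [Params.price]
  linarith

end DynSkeleton

namespace DynSkeleton

/-! ### The skeleton that is represented by the data structure -/

section graph

variable {n : ℕ}

open Classical in
/-- The neighbourhoods of a graph, as sets of numbers. -/
noncomputable def nbr (G : SimpleGraph (Fin n)) (v : ℕ) : Finset ℕ :=
  (Finset.range n).filter fun w => ∃ (hv : v < n) (hw : w < n), G.Adj ⟨v, hv⟩ ⟨w, hw⟩

theorem mem_nbr {G : SimpleGraph (Fin n)} {v w : ℕ} :
    w ∈ nbr G v ↔ ∃ (hv : v < n) (hw : w < n), G.Adj ⟨v, hv⟩ ⟨w, hw⟩ := by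
  simp only [nbr, Finset.mem_filter, Finset.mem_range, and_iff_right_iff_imp]
  rintro ⟨_, hw, _⟩
  exact hw

theorem fin_mem_nbr {G : SimpleGraph (Fin n)} {v w : Fin n} : (w : ℕ) ∈ nbr G v ↔ G.Adj v w := by
  rw [mem_nbr]
  exact ⟨fun ⟨_, _, h⟩ => h, fun h => ⟨v.2, w.2, h⟩⟩

theorem card_nbr (G : SimpleGraph (Fin n)) (v : Fin n) : (nbr G v).card = deg v G.edgeSet := by
  -- The pair `s(v, v)` is a dummy for arguments outside the node set, which do not occur among the
  -- neighbours.
  have h : {e ∈ G.edgeSet | v ∈ e} =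
      (fun w : ℕ => if hw : w < n then s(v, ⟨w, hw⟩) else s(v, v)) '' (nbr G v : Set ℕ) := by
    ext e
    simp only [Set.mem_ofPred_eq, Set.mem_image, Finset.mem_coe]
    constructor
    · rintro ⟨he, hv⟩
      obtain ⟨w, rfl⟩ := Sym2.mem_iff_exists.1 hv
      exact ⟨w, fin_mem_nbr.2 he, by simp⟩
    · rintro ⟨w, hw, rfl⟩
      obtain ⟨_, hw', hadj⟩ := mem_nbr.1 hw
      rw [dif_pos hw']
      exact ⟨hadj, Sym2.mem_mk_left _ _⟩
  rw [deg, h, Set.InjOn.ncard_image, Set.ncard_coe_finset]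
  intro w hw w' hw' hee
  obtain ⟨_, hw1, _⟩ := mem_nbr.1 hw
  obtain ⟨_, hw2, _⟩ := mem_nbr.1 hw'
  simp only [dif_pos hw1, dif_pos hw2] at hee
  have := Sym2.congr_right.1 hee
  simpa using this

theorem neighbours_nbr {d : ℕ} {G : SimpleGraph (Fin n)} (h : ∀ v, deg v G.edgeSet ≤ d) :
    Neighbours n d (nbr G) where
  lt v w hw := (mem_nbr.1 hw).2.1
  ne v w hw := by
    obtain ⟨h1, h2, h3⟩ := mem_nbr.1 hw
    rintro rfl
    exact h3.ne rfl
  symm v w hw := by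
    obtain ⟨h1, h2, h3⟩ := mem_nbr.1 hw
    exact mem_nbr.2 ⟨h2, h1, h3.symm⟩
  card v := by
    by_cases hv : v < n
    · exact (card_nbr G ⟨v, hv⟩).trans_le (h _)
    · have : nbr G v = ∅ := by
        apply Finset.eq_empty_of_forall_notMem
        intro w hw
        exact hv (mem_nbr.1 hw).1
      rw [this]; simp

theorem nbr_bot : nbr (⊥ : SimpleGraph (Fin n)) = fun _ => ∅ := by
  funext v
  apply Finset.eq_empty_of_forall_notMem
  intro w hw
  obtain ⟨_, _, h⟩ := mem_nbr.1 hw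
  exact h

theorem EdgeUpdate.changes {σ : EdgeUpdate (Fin n)} {G : SimpleGraph (Fin n)} (h : σ.Valid G) :
    σ.u ≠ σ.v ∧ Changes (nbr G) (nbr (σ.apply G)) (if σ.isInsert then 1 else 0) σ.u σ.v := by
  obtain ⟨i, u, v⟩ := σ
  cases i
  · simp only [Valid, Bool.false_eq_true, if_false] at h
    have huv : u ≠ v := h.ne
    refine ⟨huv, ?_⟩
    rw [Changes, if_neg (by simp)]
    refine ⟨fin_mem_nbr.2 h, fin_mem_nbr.2 h.symm, ?_⟩
    funext a
    ext b
    rw [mem_removeEdge (by simpa [Fin.ext_iff] using huv), mem_nbr, mem_nbr]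
    simp only [EdgeUpdate.apply, Bool.false_eq_true, if_false, SimpleGraph.sdiff_adj,
      SimpleGraph.edge_adj, Fin.ext_iff]
    constructor
    · rintro ⟨ha, hb, h1, h2⟩
      refine ⟨⟨ha, hb, h1⟩, fun h3 => h2 ⟨h3, ?_⟩⟩
      have := h1.ne
      simpa [Fin.ext_iff] using this
    · rintro ⟨⟨ha, hb, h1⟩, h2⟩
      exact ⟨ha, hb, h1, fun h3 => h2 h3.1⟩
  · simp only [Valid, if_true] at h
    obtain ⟨huv, h⟩ := h
    refine ⟨huv, ?_⟩
    rw [Changes, if_pos (by simp)]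
    refine ⟨fun h' => h (fin_mem_nbr.1 h'), fun h' => h (fin_mem_nbr.1 h').symm, ?_⟩
    have huv' : (u : ℕ) ≠ v := by simpa [Fin.ext_iff] using huv
    funext a
    ext b
    rw [mem_addEdge huv', mem_nbr, mem_nbr]
    simp only [EdgeUpdate.apply, if_true, SimpleGraph.sup_adj, SimpleGraph.edge_adj, Fin.ext_iff]
    constructor
    · rintro ⟨ha, hb, h1 | h1⟩
      · exact Or.inl ⟨ha, hb, h1⟩
      · exact Or.inr h1.1
    · rintro (⟨ha, hb, h1⟩ | h1)
      · exact ⟨ha, hb, Or.inl h1⟩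
      · have h2 := u.2
        have h3 := v.2
        exact ⟨by omega, by omega, Or.inr ⟨h1, by rw [Ne, Fin.ext_iff]; simp only; omega⟩⟩

end graph

/-- The edges of the phase in `A`, as pairs of nodes. -/
def edgeImage (n : ℕ) (s : Memory) (A : Finset ℕ) : Set (Sym2 (Fin n)) :=
  {x | ∃ e ∈ A, ∃ (h : s.arrs 18 e < n) (h' : s.arrs 19 e < n), x = s(⟨_, h⟩, ⟨_, h'⟩)}

section image

variable {p : Params} {N : ℕ → Finset ℕ} {s : Memory} {A : Finset ℕ}

theorem Phase.deg_edgeImage (h : Phase p N s) (hA : A ⊆ Finset.Icc 1 (s.vars 11)) (v : Fin p.n) :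
    deg v (edgeImage p.n s A) =
      (A.filter fun e => s.arrs 18 e = v ∨ s.arrs 19 e = v).card := by
  have hA' : ∀ e ∈ A, 1 ≤ e ∧ e ≤ s.vars 11 := fun e he => Finset.mem_Icc.1 (hA he)
  have hset : {x ∈ edgeImage p.n s A | v ∈ x} =
      (fun e : ℕ => if he : s.arrs 18 e < p.n ∧ s.arrs 19 e < p.n then
        s((⟨_, he.1⟩ : Fin p.n), ⟨_, he.2⟩) else s(v, v)) ''
      ((A.filter fun e => s.arrs 18 e = v ∨ s.arrs 19 e = v : Finset ℕ) : Set ℕ) := by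
    ext x
    simp only [Set.mem_ofPred_eq, Set.mem_image, Finset.mem_coe, Finset.mem_filter, edgeImage]
    constructor
    · rintro ⟨⟨e, he, h1, h2, rfl⟩, hv⟩
      refine ⟨e, ⟨he, ?_⟩, by rw [dif_pos ⟨h1, h2⟩]⟩
      rw [Sym2.mem_iff, Fin.ext_iff, Fin.ext_iff] at hv
      exact hv.imp Eq.symm Eq.symm
    · rintro ⟨e, ⟨he, hv⟩, rfl⟩
      have h1 := h.tail_lt e (hA' e he).1 (hA' e he).2
      have h2 := h.head_lt e (hA' e he).1 (hA' e he).2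
      rw [dif_pos ⟨h1, h2⟩]
      refine ⟨⟨e, he, h1, h2, rfl⟩, ?_⟩
      rw [Sym2.mem_iff, Fin.ext_iff, Fin.ext_iff]
      exact hv.imp Eq.symm Eq.symm
  rw [deg, hset, Set.InjOn.ncard_image, Set.ncard_coe_finset]
  intro e he e' he' hee
  have g := hA' e (Finset.mem_filter.1 he).1
  have g' := hA' e' (Finset.mem_filter.1 he').1
  simp only [dif_pos (And.intro (h.tail_lt e g.1 g.2) (h.head_lt e g.1 g.2)),
    dif_pos (And.intro (h.tail_lt e' g'.1 g'.2) (h.head_lt e' g'.1 g'.2))] at hee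
  refine h.inj e e' g.1 g.2 g'.1 g'.2 ?_
  simpa [Fin.ext_iff] using hee

theorem Listed.holds {s : Memory} (h : Phase p N s) (hA : A ⊆ Finset.Icc 1 (s.vars 11))
    (hL : Listed (p.n ^ 3) A s) (h7 : s.vars 7 = s.arrs 13 0) : s.Holds (edgeImage p.n s A) := by
  have hc : s.vars 7 = A.card := by rw [h7]; simpa using hL.fam.card 0
  have hmem : ∀ i < s.vars 7, s.arrs 11 i ∈ A := by
    intro i hi
    simpa using hL.fam.mem 0 i (by simpa [← hc] using hi)
  have hA' : ∀ i < s.vars 7, 1 ≤ s.arrs 11 i ∧ s.arrs 11 i ≤ s.vars 11 :=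
    fun i hi => Finset.mem_Icc.1 (hA (hmem i hi))
  have ht : ∀ i : Fin (s.vars 7), s.arrs 18 (s.arrs 11 i) < p.n :=
    fun i => h.tail_lt _ (hA' i i.2).1 (hA' i i.2).2
  have hh : ∀ i : Fin (s.vars 7), s.arrs 19 (s.arrs 11 i) < p.n :=
    fun i => h.head_lt _ (hA' i i.2).1 (hA' i i.2).2
  refine ⟨fun i => ⟨_, ht i⟩, fun i => ⟨_, hh i⟩,
    fun i => ⟨hL.tail i (by have := i.2; omega), hL.head i (by have := i.2; omega)⟩, ?_, ?_⟩
  · intro i j hij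
    have hij' := h.inj _ _ (hA' i i.2).1 (hA' i i.2).2 (hA' j j.2).1 (hA' j j.2).2
      (by simpa [Fin.ext_iff] using hij)
    have := hL.fam.inj (b := 0) (i := i) (j := j) (by have := i.2; simp; omega)
      (by have := j.2; simp; omega) (by simpa using hij')
    exact Fin.ext this
  · ext x
    simp only [Set.mem_range, edgeImage, Set.mem_ofPred_eq]
    constructor
    · rintro ⟨i, rfl⟩
      exact ⟨_, hmem i i.2, ht i, hh i, rfl⟩
    · rintro ⟨e, he, h1, h2, rfl⟩
      obtain ⟨i, hi, h3, _⟩ := hL.fam.pos 0 e (by simpa using he)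
      simp only [zero_mul, zero_add, single_zero] at hi h3
      exact ⟨⟨i, by omega⟩, by simp [h3]⟩

end image

end DynSkeleton

/-! ### Verification of the skeleton conditions -/

namespace DynSkeleton

section balance

variable {p : Params} {N : ℕ → Finset ℕ} {s : Memory}

/-- An edge of the class at `v` is either alive or lost, and `v` is either its tail or its head, but
not both. -/
theorem Phase.alive_card (h : Phase p N s) (v c : ℕ) :
    ((aliveOf s (p.n ^ 3) (s.vars 11) c).filter fun e => s.arrs 18 e = v ∨ s.arrs 19 e = v).card +
      (DynSkeleton.lost s (p.n ^ 3) v c).card =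
      classCount (s.arrs 18) (s.arrs 20) (s.vars 11) v c +
        classCount (s.arrs 19) (s.arrs 20) (s.vars 11) v c := by
  rw [classCount, classCount, ← Finset.card_union_of_disjoint, ← Finset.card_union_of_disjoint]
  · congr 1
    ext e
    simp only [aliveOf, DynSkeleton.lost, edgesAt, Finset.mem_union, Finset.mem_filter]
    by_cases he : e ∈ Finset.Icc 1 (s.vars 11)
    · have he' := Finset.mem_Icc.1 he
      have h1 := h.edgeId_eq he'.1 he'.2
      change edgeId s (p.n ^ 3) e ≠ 0 → edgeId s (p.n ^ 3) e = e at h1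
      change (((_ ∧ _ ∧ edgeId s (p.n ^ 3) e = e) ∧ _) ∨ _) ↔ _
      have h2 : edgeId s (p.n ^ 3) e = e ∨ edgeId s (p.n ^ 3) e = 0 := by tauto
      tauto
    · tauto
  · rw [Finset.disjoint_filter]
    rintro e he h1 h2
    have he' := Finset.mem_Icc.1 he
    exact h.ne e he'.1 he'.2 (h1.1.trans h2.1.symm)
  · rw [Finset.disjoint_left]
    intro e he he'
    simp only [aliveOf, DynSkeleton.lost, edgesAt, Finset.mem_filter, Finset.mem_Icc] at he he'
    have := he.1.2.2
    have h3 := he'.2.2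
    rw [edgeId] at h3
    omega

/-- Every class has about the fraction `1 / K` of the edges at every node. -/
theorem Phase.balance (h : Phase p N s) {c : ℕ}
    (hc : p.K ≤ c ∧ c < 2 * p.K ∨ s.vars 11 = 0) (v : ℕ) {x l : ℕ}
    (hx : ((aliveOf s (p.n ^ 3) (s.vars 11) c).filter
      fun e => s.arrs 18 e = v ∨ s.arrs 19 e = v).card = x)
    (hl : (DynSkeleton.lost s (p.n ^ 3) v c).card = l) :
    p.K * x ≤ (edgesAt s v).card + 2 * p.K ∧
      (edgesAt s v).card ≤ p.K * x + p.K * l + 2 * p.K := by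
  have hal := h.alive_card v c
  rw [hx, hl] at hal
  rw [← mul_add, hal, card_edgesAt h.ne]
  have hxl : p.K * x ≤ p.K * (x + l) := Nat.mul_le_mul_left _ (Nat.le_add_right _ _)
  rw [hal] at hxl
  rcases hc with ⟨h1, h2⟩ | h0
  · have h3 : 2 ^ (p.Ld + 1) = 2 * p.K := by rw [Params.K]; ring
    -- The errors at tails and at heads are at most K - 1 each, which gives the 2K.
    have ht := h.tails v c h1 (by omega)
    have hh := h.heads v c h1 (by omega)
    change p.K * _ + 1 ≤ _ + p.K ∧ _ + 1 ≤ p.K * _ + p.K at ht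
    change p.K * _ + 1 ≤ _ + p.K ∧ _ + 1 ≤ p.K * _ + p.K at hh
    rw [mul_add] at hxl ⊢
    omega
  · rw [h0] at hxl ⊢
    simp [classCount, totalCount] at hxl ⊢
    rcases hxl with h | h <;> simp [h]

end balance

namespace Params.Admissible

variable {p : Params} (hp : p.Admissible)

include hp

/-- The inequality 1 ≤ γ g turns the integer threshold used by the machine into the fraction γ/12 of
ε d / L². -/
theorem Few.mul_le {x : ℕ} (h : p.Few x) :
    12 * (x : ℝ) ≤ p.γ * (p.ε * p.d / (p.L : ℝ) ^ 2) := by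
  have hL : (0 : ℝ) < (p.L : ℝ) ^ 2 := by have := hp.L_pos; positivity
  have hg := hp.one_le_γ_g
  have hγ := hp.γ_pos
  rw [Params.Few] at h
  push_cast at h
  rw [← mul_div_assoc, le_div_iff₀ hL]
  have h1 : (12 * (x : ℝ) * (p.L : ℝ) ^ 2) * 1 ≤ (12 * (x : ℝ) * (p.L : ℝ) ^ 2) * (p.γ * p.g) :=
    mul_le_mul_of_nonneg_left hg (by positivity)
  nlinarith

theorem FewIn.mul_le {x : ℕ} (h : p.FewIn x) :
    12 * ((p.K : ℝ) * x) ≤ p.γ * (p.ε * p.d / (p.L : ℝ) ^ 2) := by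
  have : p.Few (p.K * x) := by
    rw [Params.FewIn] at h
    rw [Params.Few]
    convert h using 2
    ring
  have := Few.mul_le hp this
  push_cast at this
  exact this

/-- Here d = λ K L⁴, so ε d / L² = ε λ K L², and the assumption on L² makes the rounding error 2K at
most a quarter of γ ε d / L². -/
theorem eight_K_le : 8 * (p.K : ℝ) ≤ p.γ * (p.ε * p.d / (p.L : ℝ) ^ 2) := by
  have hL : (0 : ℝ) < (p.L : ℝ) ^ 2 := by have := hp.L_pos; positivity
  have h1 := hp.eight_lt
  have h2 := hp.lam_eq
  rw [← mul_div_assoc, le_div_iff₀ hL, ← h2]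
  have := mul_le_mul_of_nonneg_right h1.le (by have := p.K_pos; positivity : 0 ≤ p.K * (p.L : ℝ) ^ 2)
  nlinarith

theorem ratio : p.lam * (p.L : ℝ) ^ 4 / p.d = 1 / p.K := by
  have hd : (0 : ℝ) < p.d := by exact_mod_cast hp.d_pos
  rw [div_eq_div_iff hd.ne' p.K_pos.ne', ← hp.lam_eq]
  ring

end Params.Admissible

open Classical in
/-- The data structure represents a skeleton. -/
theorem Inv.isSkeleton {p : Params} {G : SimpleGraph (Fin p.n)} {B D : Finset ℕ} {s : Memory}
    (hp : p.Admissible) (hI : Inv p (nbr G) B D (fun _ => 0) s) (hs : Settled p B D s) :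
    ∃ B' T S : Set (Fin p.n), IsSkeleton p G B' T S
      (edgeImage p.n s (aliveOf s (p.n ^ 3) (s.vars 11) (s.vars 12))) := by
  set A := aliveOf s (p.n ^ 3) (s.vars 11) (s.vars 12) with hA
  have hAs : A ⊆ Finset.Icc 1 (s.vars 11) := Finset.filter_subset _ _
  have hph := hI.phase
  have hcur : p.K ≤ s.vars 12 ∧ s.vars 12 < 2 * p.K ∨ s.vars 11 = 0 :=
    hI.degrees.cur_ge.imp (fun h => ⟨h, hs.cur_lt⟩) id
  have hε := hp.ε_pos
  have hγ := hp.γ_pos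
  have hγ1 := hp.γ_lt
  have hδ := hp.δ_pos
  have hK := p.K_pos
  have hL : (0 : ℝ) < (p.L : ℝ) ^ 2 := by have := hp.L_pos; positivity
  have hd : (0 : ℝ) < p.d := by exact_mod_cast hp.d_pos
  -- All degree thresholds are multiples of `a`: above 1 for big nodes, below 3 for tiny ones, and 2
  -- at the time of classification.
  set a : ℝ := p.ε * p.d / (p.L : ℝ) ^ 2 with ha
  have ha0 : 0 < a := by positivity
  have haL : a * ((p.L : ℝ) * p.L) = p.ε * p.d := by
    rw [ha, ← pow_two, div_mul_cancel₀ _ hL.ne']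
  have hL' : (0 : ℝ) < (p.L : ℝ) * p.L := by rw [← pow_two]; exact hL
  have hKa : 8 * (p.K : ℝ) ≤ p.γ * a := hp.eight_K_le
  have haK : a / p.K = p.ε * p.lam * (p.L : ℝ) ^ 2 := by
    rw [ha, ← hp.lam_eq]
    have hLn : (p.L : ℝ) ≠ 0 := by have := hp.L_pos; positivity
    field_simp
  have hdK : p.d / p.K = p.lam * (p.L : ℝ) ^ 4 := by
    rw [← hp.lam_eq]; field_simp
  have hγa : p.γ * a ≤ a := by nlinarith
  have few : ∀ x, p.Few x → 12 * (x : ℝ) ≤ p.γ * a := fun x h => Params.Admissible.Few.mul_le hp h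
  have hdeg : ∀ v : Fin p.n, ((nbr G v).card : ℝ) = deg v G.edgeSet := fun v => by rw [card_nbr]
  have hX : ∀ v : Fin p.n, deg v (edgeImage p.n s A) =
      (A.filter fun e => s.arrs 18 e = v ∨ s.arrs 19 e = v).card := hph.deg_edgeImage hAs
  have hclean : ∀ v : Fin p.n, (v : ℕ) ∉ D → p.Few (s.arrs 17 v) := by
    intro v hv
    by_contra h
    exact hv ((hI.nodes.mem_dirty v).2 ⟨v.2, h⟩)
  have bal1 : ∀ v : Fin p.n, (p.K : ℝ) * deg v (edgeImage p.n s A) ≤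
      (edgesAt s v).card + 2 * p.K := by
    intro v
    exact_mod_cast (hph.balance hcur v (hX v).symm rfl).1
  have bal2 : ∀ v : Fin p.n, ((edgesAt s v).card : ℝ) ≤ p.K * deg v (edgeImage p.n s A) +
      p.K * (lost s (p.n ^ 3) v (s.vars 12)).card + 2 * p.K := by
    intro v
    exact_mod_cast (hph.balance hcur v (hX v).symm rfl).2
  -- The degree exceeded 2a at classification, and since then fewer than a/12 updates were counted
  -- or at most that many.
  have bigB : ∀ v : Fin p.n, (v : ℕ) ∈ B → (23 / 12) * a < deg v G.edgeSet := by
    intro v hv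
    have h1 := hI.degrees.big v hv
    have h2 := few _ (hI.nodes.mem_clean v hv).2
    rw [hdeg] at h1
    have h3 : 2 * a * ((p.L : ℝ) * p.L) <
        ((deg v G.edgeSet : ℝ) + s.arrs 17 v + (0 : ℕ)) * ((p.L : ℝ) * p.L) := by
      refine lt_of_eq_of_lt ?_ h1
      rw [mul_assoc, haL]; ring
    have h4 := lt_of_mul_lt_mul_right h3 hL'.le
    rw [Nat.cast_zero] at h4
    linarith
  have smallT : ∀ v : Fin p.n, (v : ℕ) ∉ B → (v : ℕ) ∉ D →
      (deg v G.edgeSet : ℝ) ≤ 2 * a + s.arrs 17 v := by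
    intro v hv hvD
    have h1 := hI.degrees.small v v.2 hv (hclean v hvD)
    rw [hdeg] at h1
    have h3 : (deg v G.edgeSet : ℝ) * ((p.L : ℝ) * p.L) ≤
        (2 * a + (s.arrs 17 v : ℝ) + (0 : ℕ)) * ((p.L : ℝ) * p.L) := by
      refine h1.trans_eq ?_
      linear_combination (-2) * haL
    have h4 := le_of_mul_le_mul_right h3 hL'
    rw [Nat.cast_zero] at h4
    linarith
  -- Dirty nodes are spurious anyway and may be put on either side; their present degree decides.
  set B' : Set (Fin p.n) := {v | (v : ℕ) ∈ B ∨ (v : ℕ) ∈ D ∧ a < deg v G.edgeSet} with hB'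
  set S : Set (Fin p.n) := {v | (v : ℕ) ∈ D ∪ lossy p s (s.vars 12)} with hS
  have notS : ∀ v ∉ S, (v : ℕ) ∉ D ∧ p.FewIn (lost s (p.n ^ 3) v (s.vars 12)).card := by
    intro v hv
    rw [hS, Set.mem_ofPred_eq, Finset.mem_union, not_or, lossy, Finset.mem_filter] at hv
    refine ⟨hv.1, ?_⟩
    by_contra h
    exact hv.2 ⟨Finset.mem_range.2 v.2, h⟩
  have memB : ∀ v ∈ B' \ S, (v : ℕ) ∈ B ∧ p.FewIn (lost s (p.n ^ 3) v (s.vars 12)).card := by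
    rintro v ⟨hv, hv'⟩
    obtain ⟨h1, h2⟩ := notS v hv'
    exact ⟨hv.resolve_right fun h => h1 h.1, h2⟩
  -- 5/12 is 1/12 for the counted updates, 1/12 for the lost edges and 2/8 for the rounding error
  -- 2K.
  have key : ∀ v ∈ B' \ S,
      |(p.K : ℝ) * deg v (edgeImage p.n s A) - deg v G.edgeSet| ≤ (5 / 12) * (p.γ * a) := by
    intro v hv
    obtain ⟨h1, h2⟩ := memB v hv
    have h3 := hI.nodes.mem_clean v h1
    have h4 := few _ h3.2
    have h5 := Params.Admissible.FewIn.mul_le hp h2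
    have h6 : ((edgesAt s v).card : ℝ) ≤ (nbr G v).card + s.arrs 17 v := by
      exact_mod_cast hI.degrees.edges_le v h3.1 h3.2
    have h7 : ((nbr G v).card : ℝ) ≤ (edgesAt s v).card + s.arrs 17 v := by
      exact_mod_cast hI.degrees.le_edges v h1
    rw [hdeg] at h6 h7
    rw [← ha] at h5
    have h8 := bal1 v
    have h9 := bal2 v
    rw [abs_le]
    constructor <;> linarith
  refine ⟨B', B'ᶜ, S, ?_, Set.union_compl_self _, Set.inter_compl_self _, ?_, ?_, ?_, ?_, ?_, ?_, ?_⟩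
  · rintro x ⟨e, he, h1, h2, rfl⟩
    have he' := Finset.mem_Icc.1 (hAs he)
    rw [hA, aliveOf, Finset.mem_filter] at he
    have hadj := hph.alive_adj e he'.1 he'.2 (by rw [edgeId, he.2.2]; omega)
    exact (mem_nbr.1 hadj).2.2
  · rintro v (hv | hv)
    · have := bigB v hv
      linarith
    · exact hv.2
  · intro v hv
    rw [hB', Set.mem_compl_iff, Set.mem_ofPred_eq, not_or, not_and] at hv
    have h3a : 3 * p.ε * p.d / (p.L : ℝ) ^ 2 = 3 * a := by rw [ha]; ring
    rw [h3a]
    by_cases hD : (v : ℕ) ∈ D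
    · have := not_lt.1 (hv.2 hD)
      linarith
    · have h1 := smallT v hv.1 hD
      have h2 := few _ (hclean v hD)
      linarith
  -- Dirty and lossy nodes contribute at most 2δ|B| each, and `B` is contained in `B'`.
  · have h1 : (S.ncard : ℝ) ≤ D.card + (lossy p s (s.vars 12)).card := by
      have h2 : S.ncard ≤ (D ∪ lossy p s (s.vars 12)).card := by
        rw [← Set.ncard_coe_finset]
        exact Set.ncard_le_ncard_of_injOn (fun v : Fin p.n => (v : ℕ)) (fun v hv => hv)
          (fun v _ w _ h => Fin.ext h) (Finset.finite_toSet _)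
      exact_mod_cast h2.trans (Finset.card_union_le _ _)
    have h2 : (B.card : ℝ) ≤ B'.ncard := by
      have : B.card ≤ B'.ncard := by
        rw [← Set.ncard_coe_finset]
        refine (Set.ncard_le_ncard (t := (fun v : Fin p.n => (v : ℕ)) '' B') ?_
          (Set.toFinite _)).trans (Set.ncard_image_le (Set.toFinite _))
        intro v hv
        exact ⟨⟨v, (hI.nodes.mem_clean v hv).1⟩, Or.inl hv, rfl⟩
      exact_mod_cast this
    have h3 := hs.dirty
    have h4 := hs.lossy
    rw [hph.lossy] at h4
    push_cast at h3 h4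
    nlinarith
  · intro v hv
    have h1 := abs_le.1 (key v hv)
    have h2 := bigB v (memB v hv).1
    rw [hp.ratio, mul_one_div, div_mul_eq_mul_div, div_le_iff₀ hK]
    have h3 : Real.exp (-p.γ) * (1 + p.γ) ≤ 1 := by
      have := Real.add_one_le_exp p.γ
      have h4 := Real.exp_pos (-p.γ)
      have h5 : Real.exp (-p.γ) * Real.exp p.γ = 1 := by rw [← Real.exp_add]; simp
      nlinarith
    have h4 := Real.exp_pos (-p.γ)
    -- e^(-γ) ≤ 1/(1+γ) ≤ 1 - γ/2 because γ ≤ 1; the relative error, at most (5/12)/(23/12) · γ =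
    -- 5γ/23, is smaller than γ/2.
    have h5 : Real.exp (-p.γ) ≤ 1 - p.γ / 2 := by nlinarith
    have h6 := mul_le_mul_of_nonneg_right h5 (Nat.cast_nonneg (deg v G.edgeSet) : (0 : ℝ) ≤ _)
    nlinarith
  · intro v hv
    have h1 := abs_le.1 (key v hv)
    have h2 := bigB v (memB v hv).1
    rw [hp.ratio, mul_one_div, div_mul_eq_mul_div, le_div_iff₀ hK]
    have h3 := mul_le_mul_of_nonneg_right (Real.add_one_le_exp p.γ)
      (Nat.cast_nonneg (deg v G.edgeSet) : (0 : ℝ) ≤ _)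
    nlinarith
  · intro v
    have h1 := bal1 v
    have h2 : ((edgesAt s v).card : ℝ) ≤ p.d := by exact_mod_cast hI.degrees.edgesAt_le v
    -- Dividing the balance by K turns d into λ L⁴ and the rounding error 2K into the summand 2.
    rw [← hdK, ← sub_le_iff_le_add, le_div_iff₀ hK]
    linarith
  · rintro v ⟨hv, hvS⟩
    rw [hB', Set.mem_compl_iff, Set.mem_ofPred_eq, not_or] at hv
    obtain ⟨hD, -⟩ := notS v hvS
    have h1 := bal1 v
    have h2 := smallT v hv.1 hD
    have h3 := few _ (hclean v hD)
    have h4 : ((edgesAt s v).card : ℝ) ≤ (nbr G v).card + s.arrs 17 v := by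
      exact_mod_cast hI.degrees.edges_le v v.2 (hclean v hD)
    rw [hdeg] at h4
    -- A clean tiny node has at most 2a plus twice its counter, hence at most 3a, edges in the
    -- phase.
    have h5 : 3 * p.ε * p.lam * (p.L : ℝ) ^ 2 = 3 * (a / p.K) := by rw [haK]; ring
    rw [h5, ← sub_le_iff_le_add, ← mul_div_assoc, le_div_iff₀ hK]
    linarith

end DynSkeleton

namespace DynSkeleton

/-! ### The main theorem -/

theorem single_empty : single ∅ = fun _ => ∅ := by
  funext b
  simp [single]

theorem Params.Admissible.fit {p : Params} (hp : p.Admissible) : p.Fit (p.machine hp.n_ge) :=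
  ⟨le_rfl, rfl, rfl, rfl⟩

theorem initial_bounded {p : Params} (hp : p.Admissible) : (initial p).Bounded (p.n ^ 8) := by
  have h : p.n ≤ p.n ^ 8 := Nat.le_self_pow (by omega) _
  have hd := hp.d_le
  have hL := hp.L_le
  have hLd := hp.Ld_le
  refine ⟨fun x => ?_, fun a i => Nat.zero_le _⟩
  simp only [initial]
  split_ifs <;> omega

/-- The initial memory represents the empty graph. -/
theorem initial_ready {p : Params} (hp : p.Admissible) :
    Ready p (fun _ => ∅) ∅ ∅ (initial p) := by
  classical
  have hK := hp.two_le_K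
  have h11 : (initial p).vars 11 = 0 := rfl
  have h12 : (initial p).vars 12 = 0 := rfl
  have hA : ∀ a i, (initial p).arrs a i = 0 := fun _ _ => rfl
  have hno : ∀ {P : ℕ → Prop} (e : ℕ), 1 ≤ e → e ≤ (initial p).vars 11 → P e := by
    intro P e h1 h2; omega
  have hedges : ∀ v, edgesAt (initial p) v = ∅ := by intro v; simp [edgesAt, h11]
  have hempty : ∀ A P : ℕ → ℕ, SetFam (p.n ^ 3) A P (fun _ => 0) (single ∅) := by
    rw [single_empty]; exact SetFam.empty _
  have hbal : ∀ src cl : ℕ → ℕ, Balanced src cl ((initial p).vars 11) p.Ld := by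
    intro src cl v c _ _
    have : 1 ≤ 2 ^ p.Ld := Nat.one_le_two_pow
    simpa [h11, classCount, totalCount] using this
  have hlost : ∀ r v c, lost (initial p) r v c = ∅ := by intro r v c; simp [lost, hedges]
  have halive : aliveOf (initial p) (p.n ^ 3) ((initial p).vars 11) ((initial p).vars 12) = ∅ := by
    simp [aliveOf, h11]
  refine ⟨rfl, rfl, rfl, rfl, ⟨?_, ?_, ?_, ?_⟩, ⟨by simp, by simp [hA], by omega⟩, rfl⟩
  · exact
      { adj := SetFam.empty _ _ _
        dirty := hempty _ _
        clean := hempty _ _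
        mem_dirty := by simpa [hA] using fun _ _ => hp.few_zero
        mem_clean := by simp
        flags := by funext v; simp [hA, flag] }
  · exact
      { count_le := by simp [h11]
        tail_lt := hno
        head_lt := hno
        ne := hno
        inj := fun e e' h1 h2 => by omega
        support := fun x hx => absurd (hA _ _) hx
        symm := hno
        alive_adj := hno
        class_ge := hno
        class_lt := hno
        tails := hbal _ _
        heads := hbal _ _
        waiting := hA _
        lost := fun v c _ => by rw [hlost, hA]; rfl
        lossy := fun c => by
          rw [hA, eq_comm, Finset.card_eq_zero, lossy, Finset.filter_eq_empty_iff]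
          intro v _
          rw [hlost, not_not]
          exact hp.fewIn_zero
        classes := by
          have : edgesOf ((initial p).arrs 20) ((initial p).vars 11) = fun _ => ∅ := by
            funext c; simp [edgesOf, h11]
          rw [this]
          exact SetFam.empty _ _ _ }
  · have hε := hp.ε_pos
    exact
      { edgesAt_le := by simp [hedges]
        big := by simp
        small := fun v _ _ _ => by simp [hA]; positivity
        edges_le := by simp [hedges]
        le_edges := by simp
        count := by simp [h11]
        passed := fun c _ h => by omega
        cur_le := by omega
        -- Before the first phase the current class is 0, which is not a class; the absence of edges
        -- makes up for it.
        cur_ge := Or.inr h11 }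
  · rw [halive]
    exact ⟨hempty _ _, by simp, by simp⟩

theorem potential_initial (p : Params) : potential p (initial p) = 0 := by
  have h11 : (initial p).vars 11 = 0 := rfl
  have h1 : charge p (initial p) = 0 := by
    rw [charge]; exact Finset.sum_eq_zero fun _ _ => rfl
  have h2 : dead (initial p) (p.n ^ 3) = ∅ := by simp [dead, h11]
  have h3 : remaining p (initial p) = 0 := by simp [remaining, h11]
  rw [potential, h1, h2, h3]
  simp

theorem potential_nonneg {p : Params} (hp : p.Admissible) (s : Memory) : 0 ≤ potential p s := by
  have := hp.ε_pos
  have := hp.δ_pos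
  rw [potential, Params.rate]
  positivity

/-- The amortized bounds of the single updates telescope, starting from the potential 0 of the empty
structure. -/
theorem Evolves.serves {p : Params} (hp : p.Admissible) {us : List (EdgeUpdate (Fin p.n))}
    {G : SimpleGraph (Fin p.n)} (h : Evolves p.d us G) :
    ∃ s t, Serves Cmd.update (p.n ^ 81) p us s t ∧ s.Bounded (p.n ^ 8) ∧
      (∃ B D, Ready p (nbr G) B D s) ∧ (t : ℝ) + potential p s ≤ p.price * us.length := by
  induction h with
  | nil =>
    exact ⟨initial p, 0, .nil, initial_bounded hp, ⟨∅, ∅, by rw [nbr_bot]; exact initial_ready hp⟩,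
      by rw [potential_initial]; simp⟩
  | @snoc us G σ _ hv hd ih =>
    obtain ⟨s, t, h1, h2, ⟨B, D, h3⟩, h4⟩ := ih
    obtain ⟨huv, hch⟩ := σ.changes hv
    have hn : p.n ≤ p.n ^ 8 := Nat.le_self_pow (by omega) _
    have hn1 := hp.n_ge
    have hu := σ.u.2
    have hv' := σ.v.2
    have hpot : potential p (s.receive σ) = potential p s :=
      potential_congr (by simp [Memory.receive]) (by simp [Memory.receive]) fun _ => rfl
    obtain ⟨s', t', e1, e2, B', D', e3, e4⟩ := RunT.update (s := s.receive σ) hp hp.fit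
      (by simpa [Memory.receive] using h3.n) (by simpa [Memory.receive] using h3.d)
      (by simpa [Memory.receive] using h3.L) (by simpa [Memory.receive] using h3.Ld)
      (u := σ.u) (v := σ.v) (by simp [Memory.receive]) (by simp [Memory.receive]) hu hv'
      (fun h => huv (Fin.ext h)) (by simpa [Memory.receive] using hch) (neighbours_nbr hd)
      (h3.inv.congr (by simp [Memory.receive]) (by simp [Memory.receive]) fun _ => rfl)
      (((h2.setVar 0 (by split_ifs <;> omega)).setVar 1 (by omega)).setVar 2 (by omega))
    refine ⟨s', t + t', .snoc h1 e1, e2, ⟨B', D', e3⟩, ?_⟩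
    rw [hpot] at e4
    rw [List.length_append, List.length_singleton]
    push_cast
    linarith

end DynSkeleton

theorem mainTheorem3 :
    ∃ (prog : DynSkeleton.Cmd) (k : ℕ) (C : ℝ),
      ∀ p : DynSkeleton.Params, p.Admissible →
        ∀ (us : List (DynSkeleton.EdgeUpdate (Fin p.n))) (G : SimpleGraph (Fin p.n)),
          DynSkeleton.Evolves p.d us G →
            ∃ (s : DynSkeleton.Memory) (time : ℕ),
              DynSkeleton.Serves prog (p.n ^ k) p us s time ∧
              (∃ (B T S : Set (Fin p.n)) (X : Set (Sym2 (Fin p.n))),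
                DynSkeleton.IsSkeleton p G B T S X ∧ s.Holds X) ∧
              (time : ℝ) ≤
                C * ((p.L : ℝ) ^ 2 * (p.Ld : ℝ) ^ 3 / (p.ε * p.γ * p.δ)) * us.length := by
  refine ⟨DynSkeleton.Cmd.update, 81, 400000, fun p hp us G h => ?_⟩
  obtain ⟨s, t, h1, -, ⟨B, D, h2⟩, h3⟩ := h.serves hp
  obtain ⟨B', T, S, h4⟩ := h2.inv.isSkeleton hp h2.settled
  refine ⟨s, t, h1, ⟨B', T, S, _, h4, ?_⟩, ?_⟩
  · exact h2.inv.listed.holds h2.inv.phase (Finset.filter_subset _ _) h2.size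
  · have h5 := DynSkeleton.potential_nonneg hp s
    have h6 := mul_le_mul_of_nonneg_right hp.price_le (Nat.cast_nonneg us.length : (0 : ℝ) ≤ _)
    linarith
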